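/- Let $n\in\mathbb N_0$. Let $m:(0,\infty)\to\mathbb R$ be a locally integrable, a.e. nonnegative function (a Lévy density) with Bernstein function $f(\lambda)=\int_0^\infty(1-e^{-\lambda t})\,m(t)\,dt$, $\lambda\ge 0$, such that: (a) there are $\alpha\in(0,1)$ and $p_k\in\mathbb R$ with $m(t)\sim t^{-1-\alpha}\sum_{k\ge0}p_kt^k$ as $t\to0^+$, i.e. $t^{1+\alpha-N}\bigl(m(t)-\sum_{k=0}^N p_kt^{-1-\alpha+k}\bigr)\to0$ for every $N\ge 0$; (b) for every $\beta\in\mathbb R$ the function $m(t)t^\beta$ is a.e. bounded on $t>1$; (c) $\overline m(0,\infty):=\int_0^\infty\bigl(m(t)-p_0t^{-1-\alpha}\bigr)\,dt<0$. For a symbol $\sigma(x,\xi)$ and $u\in\mathcal S(\mathbb R^n)$ set $\mathrm{Op}(\sigma)u(x)=(2\pi)^{-n/2}\int e^{ix\cdot\xi}\sigma(x,\xi)\hat u(\xi)\,d\xi$, where $\hat u(\xi)=(2\pi)^{-n/2}\int e^{-ix\cdot\xi}u(x)\,dx$. Let $A=\mathrm{Op}(f(|\xi|^2))$ (the negative of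 the generator of the subordinate Brownian motion with Laplace exponent $f$), $\tilde A=A-\overline m(0,\infty)I$ on $\mathcal S(\mathbb R^n)$, and $\alpha_k=-\Gamma(-\alpha+k)\,p_k$ for $k\ge 0$. With $\langle\xi\rangle=(1+|\xi|^2)^{1/2}$, let $S^{r,r'}(\mathbb R^n)$ be the set of smooth $\sigma:\mathbb R^n\times\mathbb R^n\to\mathbb C$ such that for all multi-indices $\beta,\gamma$ there is a constant $C$ with $|\partial_\xi^\beta\partial_x^\gamma\sigma(x,\xi)|\le C\langle x\rangle^{r'-|\gamma|}\langle\xi\rangle^{r-|\beta|}$, and $S^{-\infty,r'}=\bigcap_r S^{r,r'}$. For an $x$-independent $\sigma\in S^{r,0}$ and $\sigma_{r-k}\in C^\infty(\mathbb R^n\setminus\{0\})$ write $\sigma\sim\sum_{k\ge 0}\sigma_{r-k}$ if $\sigma-\sum_{k<N}\chi\sigma_{r-k}\in S^{r-N,0}$ for all $N$ and every cutoff $\chi\in C^\infty(\mathbb R^n)$ with $\chi=1$ for $|\xi|\ge1$ and $\chi=0$ for $|\xi|\le1/2$ (with $-\infty-N=-\infty$ when $r=-\infty$). Write $\sigma\in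 S^{r,0}_{cl}$ if moreover the $\sigma_{r-k}$ can be chosen homogeneous of degree $r-k$, and $S^{-\infty,0}_{cl}=\bigcap_rS^{r,0}_{cl}$. Then: (i) $\tilde A$ maps $\mathcal S(\mathbb R^n)$ to itself and is a classical elliptic pseudodifferential operator: $\tilde A=\mathrm{Op}(\tilde\sigma)$ with an $x$-independent real symbol $\tilde\sigma\in S^{2\alpha,0}_{cl}(\mathbb R^n)$ satisfying $\tilde\sigma(\xi)\ge C\langle\xi\rangle^{2\alpha}$ for some $C>0$, and $$\tilde\sigma(\xi)\sim\sum_{k=0}^\infty\alpha_k|\xi|^{2\alpha-2k}$$ (the term $\alpha_k|\xi|^{2\alpha-2k}$ has order $2\alpha-2k$; the terms of order $2\alpha-j$ with $j$ odd vanish). (ii) The closure of $-\tilde A$ in $L^2(\mathbb R^n)$ generates a strongly continuous semigroup $e^{-t\tilde A}$. For each $t>0$ the heat operator $e^{-t\tilde A}$ maps $\mathcal S(\mathbb R^n)$ to itself and is a pseudodifferential operator with an $x$-independent symbol $h_t\in S^{-\infty,0}_{cl}(\mathbb R^n)$, and $$h_t(\xi)\sim\sum_{j\ge0}h_{-j}(t,\xi),\qquad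 h_{-2i}(t,\xi)=e^{-t\alpha_0|\xi|^{2\alpha}}\sum_{l=0}^{i}\frac{(-t)^l}{l!}\sum_{\substack{k_1+\dots+k_l=i\\k_\nu\ge1}}\ \prod_{\nu=1}^l\alpha_{k_\nu}|\xi|^{2\alpha-2k_\nu},\qquad h_{-2i-1}=0,$$ that is, $$h_t(\xi)\sim e^{-t\alpha_0|\xi|^{2\alpha}}-\bigl[\alpha_1|\xi|^{2\alpha-2}+\alpha_2|\xi|^{2\alpha-4}\bigr]t\,e^{-t\alpha_0|\xi|^{2\alpha}}+\tfrac12\alpha_1^2|\xi|^{4\alpha-4}t^2e^{-t\alpha_0|\xi|^{2\alpha}}+\cdots,$$ where the displayed terms are $h_0$, $h_{-2}$ and $h_{-4}$. The expansion holds for each fixed $t>0$ as an expansion in $S^{-\infty,0}$, and also uniformly in $t$: for every cutoff $\chi$ and every $N\ge 0$, the remainder $h_t-\sum_{j<N}\chi h_{-j}(t,\cdot)$ lies in $S^{-N,0}$ with constants independent of $t>0$. The terms are quasi-homogeneous: $h_{-j}(\tau^{-2\alpha}t,\tau\xi)=\tau^{-j}h_{-j}(t,\xi)$ for $\tau,t>0$,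 $\xi\neq0$. -/

import Mathlib

open MeasureTheory Filter Topology Set
open scoped ContDiff SchwartzMap NNReal

noncomputable section

namespace SubordinateHeat

/-- Euclidean space `ℝⁿ`. -/
abbrev E (n : ℕ) : Type := EuclideanSpace ℝ (Fin n)

/-- The Hilbert space `L²(ℝⁿ)` of complex-valued functions. -/
abbrev L2 (n : ℕ) : Type := Lp ℂ 2 (volume : Measure (E n))

/-- The weight `⟨ξ⟩ = (1 + |ξ|²)^{1/2}`. -/
def bracket {n : ℕ} (ξ : E n) : ℝ := Real.sqrt (1 + ‖ξ‖ ^ 2)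

/-- The iterated partial derivative `∂_{a 0} ⋯ ∂_{a (k-1)} g` at `ξ`. For smooth `g`, letting `k` and
`a` vary gives all `∂^β g`, `|β| = k`. -/
def partialDeriv {n k : ℕ} (a : Fin k → Fin n) (g : E n → ℂ) (ξ : E n) : ℂ :=
  iteratedFDeriv ℝ k g ξ (fun i => EuclideanSpace.single (a i) (1 : ℝ))

/-! ### Symbols and pseudodifferential operators -/

/-- The symbol class `S^{r,r'}(ℝⁿ)`; `σ x ξ` is the value at `(x, ξ)`. -/
def IsSymbol {n : ℕ} (r r' : ℝ) (σ : E n → E n → ℂ) : Prop :=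
  ContDiff ℝ ∞ (fun z : E n × E n => σ z.1 z.2) ∧
  ∀ (k l : ℕ) (a : Fin k → Fin n) (b : Fin l → Fin n), ∃ C : ℝ, ∀ x ξ : E n,
    ‖partialDeriv a (fun η => partialDeriv b (fun y => σ y η) x) ξ‖
      ≤ C * bracket x ^ (r' - l) * bracket ξ ^ (r - k)

/-- A family of symbols that is bounded in `S^{r,r'}(ℝⁿ)`: the constants do not depend on the
index. -/
def IsBoundedSymbolFamily {n : ℕ} {ι : Type} (r r' : ℝ) (σ : ι → E n → E n → ℂ) : Prop :=
  (∀ i, ContDiff ℝ ∞ (fun z : E n × E n => σ i z.1 z.2)) ∧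
  ∀ (k l : ℕ) (a : Fin k → Fin n) (b : Fin l → Fin n), ∃ C : ℝ, ∀ (i : ι) (x ξ : E n),
    ‖partialDeriv a (fun η => partialDeriv b (fun y => σ i y η) x) ξ‖
      ≤ C * bracket x ^ (r' - l) * bracket ξ ^ (r - k)

/-- `S^{-∞,r'}(ℝⁿ)`, the intersection of all `S^{r,r'}(ℝⁿ)`. -/
def IsSmoothingSymbol {n : ℕ} (r' : ℝ) (σ : E n → E n → ℂ) : Prop :=
  ∀ r : ℝ, IsSymbol r r' σ

/-- Cutoff functions: smooth, `1` for `|ξ| ≥ 1`, `0` for `|ξ| ≤ 1/2`. -/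
def IsCutoff {n : ℕ} (χ : E n → ℂ) : Prop :=
  ContDiff ℝ ∞ χ ∧ (∀ ξ, 1 ≤ ‖ξ‖ → χ ξ = 1) ∧ ∀ ξ, ‖ξ‖ ≤ 1 / 2 → χ ξ = 0

/-- `σ ∼ ∑ s k` for an `x`-independent symbol of order `(r, 0)`, where `s k` stands for
`σ_{r-k}`. -/
def HasExpansion {n : ℕ} (r : ℝ) (σ : E n → ℂ) (s : ℕ → E n → ℂ) : Prop :=
  IsSymbol r 0 (fun _ ξ => σ ξ) ∧
  (∀ k, ContDiffOn ℝ ∞ (s k) {0}ᶜ) ∧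
  ∀ χ : E n → ℂ, IsCutoff χ → ∀ N : ℕ,
    IsSymbol (r - N) 0 (fun _ ξ => σ ξ - ∑ k ∈ Finset.range N, χ ξ * s k ξ)

/-- `S^{r,0}_{cl}(ℝⁿ)`: there is an expansion whose `k`-th term is homogeneous of degree `r - k`. -/
def IsClassicalSymbol {n : ℕ} (r : ℝ) (σ : E n → ℂ) : Prop :=
  ∃ s : ℕ → E n → ℂ, HasExpansion r σ s ∧
    ∀ (k : ℕ) (τ : ℝ) (ξ : E n), 0 < τ → ξ ≠ 0 → s k (τ • ξ) = ((τ ^ (r - k) : ℝ) : ℂ) * s k ξ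

/-- `S^{-∞,0}_{cl}(ℝⁿ)`, the intersection of all `S^{r,0}_{cl}(ℝⁿ)`. -/
def IsClassicalSmoothingSymbol {n : ℕ} (σ : E n → ℂ) : Prop :=
  ∀ r : ℝ, IsClassicalSymbol r σ

/-- `σ ∼ ∑ s k` for an `x`-independent symbol of order `(-∞, 0)`; here `-∞ - N = -∞`. -/
def HasSmoothingExpansion {n : ℕ} (σ : E n → ℂ) (s : ℕ → E n → ℂ) : Prop :=
  IsSmoothingSymbol 0 (fun _ ξ => σ ξ) ∧
  (∀ k, ContDiffOn ℝ ∞ (s k) {0}ᶜ) ∧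
  ∀ χ : E n → ℂ, IsCutoff χ → ∀ N : ℕ,
    IsSmoothingSymbol 0 (fun _ ξ => σ ξ - ∑ k ∈ Finset.range N, χ ξ * s k ξ)

/-- `σ_t ∼ ∑ s k t` uniformly in `t > 0`: the remainder after `N` terms is bounded in `S^{-N,0}`
with constants independent of `t`. -/
def HasUniformExpansion {n : ℕ} (σ : ℝ → E n → ℂ) (s : ℕ → ℝ → E n → ℂ) : Prop :=
  ∀ χ : E n → ℂ, IsCutoff χ → ∀ N : ℕ,
    IsBoundedSymbolFamily (-(N : ℝ)) 0 (fun (t : Ioi (0 : ℝ)) (_ : E n) (ξ : E n) =>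
      σ t ξ - ∑ k ∈ Finset.range N, χ ξ * s k t ξ)

/-- Ellipticity of an `x`-independent symbol of order `r > 0`: it is real and bounded below by a
positive multiple of `⟨ξ⟩^r`. -/
def IsElliptic {n : ℕ} (r : ℝ) (σ : E n → ℂ) : Prop :=
  ∃ C : ℝ, 0 < C ∧ ∀ ξ, (σ ξ).im = 0 ∧ C * bracket ξ ^ r ≤ (σ ξ).re

/-- `û(ξ) = (2π)^{-n/2} ∫ e^{-i x·ξ} u(x) dx`. -/
def fourierHat {n : ℕ} (u : 𝓢(E n, ℂ)) (ξ : E n) : ℂ :=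
  (((2 * Real.pi) ^ (-(n : ℝ) / 2) : ℝ) : ℂ) *
    ∫ x : E n, Complex.exp (-(Complex.I * (inner ℝ x ξ : ℝ))) * u x

/-- `Op(σ) u (x) = (2π)^{-n/2} ∫ e^{i x·ξ} σ(x,ξ) û(ξ) dξ`. -/
def opOfSymbol {n : ℕ} (σ : E n → E n → ℂ) (u : 𝓢(E n, ℂ)) (x : E n) : ℂ :=
  (((2 * Real.pi) ^ (-(n : ℝ) / 2) : ℝ) : ℂ) *
    ∫ ξ : E n, Complex.exp (Complex.I * (inner ℝ x ξ : ℝ)) * σ x ξ * fourierHat u ξ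

/-- The operator `B`, defined on Schwartz functions, is the pseudodifferential operator with the
`x`-independent symbol `σ`; it maps Schwartz functions to Schwartz functions. -/
def IsPseudoDiff {n : ℕ} (B : 𝓢(E n, ℂ) → E n → ℂ) (σ : E n → ℂ) : Prop :=
  ∀ u : 𝓢(E n, ℂ), ∃ v : 𝓢(E n, ℂ), (∀ x, v x = B u x) ∧
    ∀ x, v x = opOfSymbol (fun _ ξ => σ ξ) u x

/-- The bounded operator `T` on `L²(ℝⁿ)` is the pseudodifferential operator with the `x`-independent
symbol `σ` (on the dense subspace of Schwartz functions, which it maps to itself). -/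
def IsPseudoDiffL2 {n : ℕ} (T : L2 n →L[ℂ] L2 n) (σ : E n → ℂ) : Prop :=
  ∀ u : 𝓢(E n, ℂ), ∃ v : 𝓢(E n, ℂ), T (u.toLp 2 volume) = v.toLp 2 volume ∧
    ∀ x, v x = opOfSymbol (fun _ ξ => σ ξ) u x

/-! ### Operator semigroups -/

/-- Strongly continuous semigroups of bounded operators on `L²(ℝⁿ)`. -/
def IsC0Semigroup {n : ℕ} (T : ℝ≥0 → L2 n →L[ℂ] L2 n) : Prop :=
  T 0 = ContinuousLinearMap.id ℂ (L2 n) ∧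
  (∀ s t, T (s + t) = (T s).comp (T t)) ∧
  ∀ u, Tendsto (fun t => T t u) (𝓝[>] 0) (𝓝 u)

/-- The graph of the infinitesimal generator of `T`. -/
def generatorGraph {n : ℕ} (T : ℝ≥0 → L2 n →L[ℂ] L2 n) : Set (L2 n × L2 n) :=
  {w | Tendsto (fun h : ℝ≥0 => ((h : ℝ) : ℂ)⁻¹ • (T h w.1 - w.1)) (𝓝[>] 0) (𝓝 w.2)}

/-- The graph in `L² × L²` of an operator with domain the Schwartz functions. -/
def schwartzGraph {n : ℕ} (B : 𝓢(E n, ℂ) → E n → ℂ) : Set (L2 n × L2 n) :=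
  {w | ∃ u : 𝓢(E n, ℂ), w.1 = u.toLp 2 volume ∧ (w.2 : E n → ℂ) =ᵐ[volume] B u}

/-- `T t = e^{-tB}`: the strongly continuous semigroup on `L²(ℝⁿ)` generated by the closure of
`-B`. -/
def IsHeatSemigroup {n : ℕ} (B : 𝓢(E n, ℂ) → E n → ℂ) (T : ℝ≥0 → L2 n →L[ℂ] L2 n) : Prop :=
  IsC0Semigroup T ∧ generatorGraph T = closure (schwartzGraph (fun u x => -B u x))

/-! ### Bernstein functions with a Lévy density -/

/-- `g(t) ∼ ∑ p k t^{a k}` as `t → 0⁺`. -/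
def HasExpansionAtZero (g : ℝ → ℝ) (p a : ℕ → ℝ) : Prop :=
  StrictMono a ∧ Tendsto a atTop atTop ∧
  ∀ N : ℕ, Tendsto (fun t => t ^ (-a N) * (g t - ∑ k ∈ Finset.range (N + 1), p k * t ^ a k))
    (𝓝[>] 0) (𝓝 0)

/-- The Bernstein function `f(λ) = ∫₀^∞ (1 - e^{-λt}) m(t) dt`. -/
def bernstein (m : ℝ → ℝ) (lam : ℝ) : ℝ :=
  ∫ t in Ioi (0 : ℝ), (1 - Real.exp (-lam * t)) * m t

/-- `m̄(0,∞) = ∫₀^∞ (m(t) - p₀ t^{-1-α}) dt`. -/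
def mBar (m : ℝ → ℝ) (p₀ α : ℝ) : ℝ :=
  ∫ t in Ioi (0 : ℝ), (m t - p₀ * t ^ (-1 - α))

/-- The assumptions on the Lévy density `m`. Being the density of a measure, `m` is nonnegative;
`∫ min(t,1) m(t) dt < ∞` follows from the other conditions. -/
structure LevyHypothesis (m : ℝ → ℝ) (α : ℝ) (p : ℕ → ℝ) : Prop where
  nonneg : ∀ᵐ t ∂(volume.restrict (Ioi (0 : ℝ))), 0 ≤ m t
  locallyIntegrable : LocallyIntegrableOn m (Ioi 0)
  alpha_pos : 0 < α
  alpha_lt_one : α < 1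
  expansion : HasExpansionAtZero m p (fun k => -1 - α + k)
  rapidDecay : ∀ β : ℝ, ∃ C : ℝ, ∀ᵐ t ∂(volume.restrict (Ioi (1 : ℝ))), |m t * t ^ β| ≤ C
  mBar_neg : mBar m (p 0) α < 0

/-- `A u (x) = (2π)^{-n/2} ∫ e^{i x·ξ} f(|ξ|²) û(ξ) dξ`. -/
def opA {n : ℕ} (m : ℝ → ℝ) (u : 𝓢(E n, ℂ)) (x : E n) : ℂ :=
  opOfSymbol (fun _ ξ => ((bernstein m (‖ξ‖ ^ 2) : ℝ) : ℂ)) u x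

/-- `Ã = A - m̄(0,∞) I`. -/
def opATilde {n : ℕ} (m : ℝ → ℝ) (α : ℝ) (p : ℕ → ℝ) (u : 𝓢(E n, ℂ)) (x : E n) : ℂ :=
  opA m u x - ((mBar m (p 0) α : ℝ) : ℂ) * u x

/-- `α_k = -Γ(-α+k) p_k`. -/
def coeffAlpha (α : ℝ) (p : ℕ → ℝ) (k : ℕ) : ℝ := -Real.Gamma (-α + k) * p k

/-- The component of order `2α - j` in `∑ α_k |ξ|^{2α-2k}`. -/
def symbolTerm {n : ℕ} (α : ℝ) (p : ℕ → ℝ) (j : ℕ) (ξ : E n) : ℂ :=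
  if Even j then ((coeffAlpha α p (j / 2) * ‖ξ‖ ^ (2 * α - j) : ℝ) : ℂ) else 0

/-- The component of order `-j` in the expansion of the symbol of `e^{-tÃ}`: zero for odd `j`, and
for `j = 2i`
`e^{-t α₀ |ξ|^{2α}} ∑_l ((-t)^l / l!) ∑_{k₁+⋯+k_l = i, k_ν ≥ 1} ∏_ν α_{k_ν} |ξ|^{2α-2k_ν}`. -/
def heatTerm {n : ℕ} (α : ℝ) (p : ℕ → ℝ) (j : ℕ) (t : ℝ) (ξ : E n) : ℂ :=
  if Even j then
    ((Real.exp (-t * coeffAlpha α p 0 * ‖ξ‖ ^ (2 * α)) *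
      ∑ c : Composition (j / 2), (-t) ^ c.length / (c.length.factorial : ℝ) *
        (c.blocks.map fun k => coeffAlpha α p k * ‖ξ‖ ^ (2 * α - 2 * k)).prod : ℝ) : ℂ)
  else 0

end SubordinateHeat

end

open SubordinateHeat

noncomputable section

namespace SubordinateHeat

/-! ### Symbol-type estimates for functions of x = |ξ|², uniform over a family. -/

section

/-! Everything is a function of x = |ξ|². Let σ(x) = f(x) - m̄(0,∞). Splitting p₀ t^{-1-α} off m
turns the Bernstein integral into three pieces: a Gamma integral equal to α₀ x^α, the constant
m̄(0,∞), and minus the Laplace transform of the remainder. The shift by m̄ is exactly what removes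
the constant. Each further term p_k t^{-1-α+k} has a Laplace transform that is a multiple of
x^{α-k}, and the remainder after N ≥ 1 terms is O(t^{N-1-α}), so its transform and derivatives decay
like x^{α-N} and its derivatives (Watson's lemma). This is `levySymbol_eq` with
`radialBound_laplaceDeriv`. Near x = 0 smoothness comes from the rapid decay of m
(`contDiff_levySymbol`). The lower bound `exists_le_levySymbol` uses σ ≥ -m̄ > 0 on x ≥ 0 together
with α₀ > 0 at infinity.

For the heat symbol write σ = a + R with a = α₀ x^α and R of order α - 1 in x. Taylor expansion
gives e^{-tσ} = e^{-ta} ∑ (-tR)^l / l! plus a remainder. A factor t^l is absorbed by the exponential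
at the price x^{-lα}, uniformly in t, while R^l has order l(α - 1). The l-th term thus has order -l
in x. Expanding R^l in the powers x^{α-k} and sorting by total weight produces the sums over
compositions (`RadialBound.exp_mul_expRem`, `radialBound_exp_sub_sum`). For fixed t the exponential
beats every power, which gives the expansion in S^{-∞,0}.

Estimates in x become symbol estimates in ξ by the chain rule, with orders doubled
(`RadialBound.isMultiplierFamily`). They have to hold on a neighbourhood of x = 0, so σ is extended
smoothly to negative x.

On L² the multipliers e^{-tσ} form a contraction semigroup. Both σ and 1/σ preserve Schwartz
functions, and 1/σ is bounded. Hence the graph of -Ã consists of the pairs (-σ⁻¹v, v) with v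
Schwartz, and its closure is the graph of the generator (`generatorGraph_semigroup`,
`closure_schwartzGraph`). A semigroup is determined by its generator, by differentiating S(t -
s)T(s)u in s (`eq_of_generatorGraph_eq`). -/

/-- The derivatives of order `j ≤ k` of the functions `φ i` exist on `U` and are bounded there by
constant multiples of `(1 + x) ^ (s - j)`, uniformly in `i`. -/
def RadialBound {ι : Type} (U : Set ℝ) : ℕ → ℝ → (ι → ℝ → ℝ) → Prop
  | 0, s, φ => ∃ C : ℝ, ∀ i, ∀ x ∈ U, |φ i x| ≤ C * (1 + x) ^ s
  | k + 1, s, φ => (∃ C : ℝ, ∀ i, ∀ x ∈ U, |φ i x| ≤ C * (1 + x) ^ s) ∧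
      (∀ i, ∀ x ∈ U, DifferentiableAt ℝ (φ i) x) ∧ RadialBound U k (s - 1) (fun i => deriv (φ i))

namespace RadialBound

variable {ι κ : Type} {U V : Set ℝ} {k : ℕ} {s r : ℝ} {φ ψ : ι → ℝ → ℝ}

theorem bound (h : RadialBound U k s φ) : ∃ C : ℝ, ∀ i, ∀ x ∈ U, |φ i x| ≤ C * (1 + x) ^ s := by
  cases k with
  | zero => exact h
  | succ k => exact h.1

theorem bound_nonneg (hU : U ⊆ Ioi (-1 / 2)) (h : RadialBound U k s φ) :
    ∃ C : ℝ, 0 ≤ C ∧ ∀ i, ∀ x ∈ U, |φ i x| ≤ C * (1 + x) ^ s := by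
  obtain ⟨C, hC⟩ := h.bound
  refine ⟨|C|, abs_nonneg _, fun i x hx => (hC i x hx).trans ?_⟩
  have : (-1 / 2 : ℝ) < x := hU hx
  exact mul_le_mul_of_nonneg_right (le_abs_self C) (Real.rpow_nonneg (by linarith) _)

theorem of_succ (h : RadialBound U (k + 1) s φ) : RadialBound U k s φ := by
  induction k generalizing s φ with
  | zero => exact h.1
  | succ k ih => exact ⟨h.1, h.2.1, ih h.2.2⟩

theorem congr (hU : IsOpen U) (h : RadialBound U k s φ) (he : ∀ i, ∀ x ∈ U, ψ i x = φ i x) :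
    RadialBound U k s ψ := by
  induction k generalizing s φ ψ with
  | zero =>
    obtain ⟨C, hC⟩ := h
    exact ⟨C, fun i x hx => by rw [he i x hx]; exact hC i x hx⟩
  | succ k ih =>
    obtain ⟨⟨C, hC⟩, hd, hk⟩ := h
    have hev : ∀ i, ∀ x ∈ U, ψ i =ᶠ[𝓝 x] φ i := fun i x hx => by
      filter_upwards [hU.mem_nhds hx] with y hy using he i y hy
    refine ⟨⟨C, fun i x hx => by rw [he i x hx]; exact hC i x hx⟩,
      fun i x hx => (hd i x hx).congr_of_eventuallyEq (hev i x hx),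
      ih hk fun i x hx => (hev i x hx).deriv_eq⟩

theorem mono_set (h : RadialBound U k s φ) (hV : V ⊆ U) : RadialBound V k s φ := by
  induction k generalizing s φ with
  | zero =>
    obtain ⟨C, hC⟩ := h
    exact ⟨C, fun i x hx => hC i x (hV hx)⟩
  | succ k ih =>
    obtain ⟨⟨C, hC⟩, hd, hk⟩ := h
    exact ⟨⟨C, fun i x hx => hC i x (hV hx)⟩, fun i x hx => hd i x (hV hx), ih hk⟩

theorem union (hU : U ⊆ Ioi (-1 / 2)) (hV : V ⊆ Ioi (-1 / 2)) (h : RadialBound U k s φ)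
    (h' : RadialBound V k s φ) : RadialBound (U ∪ V) k s φ := by
  have key : ∀ {k : ℕ} {s : ℝ} {φ : ι → ℝ → ℝ}, RadialBound U k s φ → RadialBound V k s φ →
      ∃ C : ℝ, ∀ i, ∀ x ∈ U ∪ V, |φ i x| ≤ C * (1 + x) ^ s := by
    intro k s φ h h'
    obtain ⟨C, hC0, hC⟩ := h.bound_nonneg hU
    obtain ⟨D, hD0, hD⟩ := h'.bound_nonneg hV
    refine ⟨C + D, fun i x hx => ?_⟩
    have hx0 : (0 : ℝ) ≤ (1 + x) ^ s := by
      have : (-1 / 2 : ℝ) < x := hx.elim (fun h => hU h) (fun h => hV h)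
      exact Real.rpow_nonneg (by linarith) _
    rw [add_mul]
    rcases hx with hx | hx
    · exact (hC i x hx).trans (le_add_of_nonneg_right (by positivity))
    · exact (hD i x hx).trans (le_add_of_nonneg_left (by positivity))
  induction k generalizing s φ with
  | zero => exact key h h'
  | succ k ih =>
    exact ⟨key h h', fun i x hx => hx.elim (h.2.1 i x) (h'.2.1 i x), ih h.2.2 h'.2.2⟩

theorem mono (hU : U ⊆ Ioi (-1 / 2)) (h : RadialBound U k s φ) (hs : s ≤ r) :
    RadialBound U k r φ := by
  have key : ∀ {k : ℕ} {s r : ℝ} {φ : ι → ℝ → ℝ}, RadialBound U k s φ → s ≤ r →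
      ∃ C : ℝ, ∀ i, ∀ x ∈ U, |φ i x| ≤ C * (1 + x) ^ r := by
    intro k s r φ h hs
    obtain ⟨C, hC0, hC⟩ := h.bound_nonneg hU
    -- On `U` only 1 + x ≥ 1/2 is known, so raising the order costs a power of 2.
    refine ⟨C * 2 ^ (r - s), fun i x hx => (hC i x hx).trans ?_⟩
    have hx : (-1 / 2 : ℝ) < x := hU hx
    rw [mul_assoc]
    refine mul_le_mul_of_nonneg_left ?_ hC0
    have h1 : (1 + x) ^ r = (1 + x) ^ s * (1 + x) ^ (r - s) := by
      rw [← Real.rpow_add (by linarith)]; congr 1; ring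
    have h2 : 1 ≤ (2 * (1 + x)) ^ (r - s) := Real.one_le_rpow (by linarith) (by linarith)
    rw [Real.mul_rpow (by norm_num) (by linarith)] at h2
    have h3 : 0 ≤ (1 + x) ^ s := Real.rpow_nonneg (by linarith) _
    rw [h1]
    nlinarith
  induction k generalizing s r φ with
  | zero => exact key h hs
  | succ k ih => exact ⟨key h hs, h.2.1, ih h.2.2 (by linarith)⟩

theorem zero : RadialBound U k s (fun (_ : ι) _ => 0) := by
  induction k generalizing s with
  | zero => exact ⟨0, by simp⟩
  | succ k ih => exact ⟨⟨0, by simp⟩, by simp, by simpa using ih⟩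

theorem const (c : ℝ) : RadialBound U k 0 (fun (_ : ι) _ => c) := by
  cases k with
  | zero => exact ⟨|c|, by simp⟩
  | succ k => exact ⟨⟨|c|, by simp⟩, by simp, by simpa using zero⟩

theorem add (hU : IsOpen U) (h : RadialBound U k s φ) (h' : RadialBound U k s ψ) :
    RadialBound U k s (fun i x => φ i x + ψ i x) := by
  have key : ∀ {k : ℕ} {s : ℝ} {φ ψ : ι → ℝ → ℝ}, RadialBound U k s φ → RadialBound U k s ψ →
      ∃ C : ℝ, ∀ i, ∀ x ∈ U, |φ i x + ψ i x| ≤ C * (1 + x) ^ s := by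
    intro k s φ ψ h h'
    obtain ⟨C, hC⟩ := h.bound
    obtain ⟨D, hD⟩ := h'.bound
    exact ⟨C + D, fun i x hx => (abs_add_le _ _).trans
      (by rw [add_mul]; exact add_le_add (hC i x hx) (hD i x hx))⟩
  induction k generalizing s φ ψ with
  | zero => exact key h h'
  | succ k ih =>
    exact ⟨key h h', fun i x hx => (h.2.1 i x hx).fun_add (h'.2.1 i x hx),
      (ih h.2.2 h'.2.2).congr hU fun i x hx => deriv_fun_add (h.2.1 i x hx) (h'.2.1 i x hx)⟩

theorem mul (hU : IsOpen U) (hU' : U ⊆ Ioi (-1 / 2)) (h : RadialBound U k s φ)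
    (h' : RadialBound U k r ψ) : RadialBound U k (s + r) (fun i x => φ i x * ψ i x) := by
  have key : ∀ {k : ℕ} {s r : ℝ} {φ ψ : ι → ℝ → ℝ}, RadialBound U k s φ → RadialBound U k r ψ →
      ∃ C : ℝ, ∀ i, ∀ x ∈ U, |φ i x * ψ i x| ≤ C * (1 + x) ^ (s + r) := by
    intro k s r φ ψ h h'
    obtain ⟨C, hC0, hC⟩ := h.bound_nonneg hU'
    obtain ⟨D, hD0, hD⟩ := h'.bound_nonneg hU'
    refine ⟨C * D, fun i x hx => ?_⟩
    have hx' : (-1 / 2 : ℝ) < x := hU' hx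
    rw [abs_mul, Real.rpow_add (by linarith)]
    calc |φ i x| * |ψ i x| ≤ (C * (1 + x) ^ s) * (D * (1 + x) ^ r) :=
          mul_le_mul (hC i x hx) (hD i x hx) (abs_nonneg _) ((abs_nonneg _).trans (hC i x hx))
      _ = _ := by ring
  induction k generalizing s r φ ψ with
  | zero => exact key h h'
  | succ k ih =>
    refine ⟨key h h', fun i x hx => (h.2.1 i x hx).fun_mul (h'.2.1 i x hx), ?_⟩
    have h1 := ih h.2.2 h'.of_succ
    have h2 := ih h.of_succ h'.2.2
    rw [show s - 1 + r = s + r - 1 by ring] at h1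
    rw [show s + (r - 1) = s + r - 1 by ring] at h2
    exact (h1.add hU h2).congr hU fun i x hx => deriv_fun_mul (h.2.1 i x hx) (h'.2.1 i x hx)

theorem const_mul (hU : IsOpen U) (hU' : U ⊆ Ioi (-1 / 2)) (c : ℝ) (h : RadialBound U k s φ) :
    RadialBound U k s (fun i x => c * φ i x) := by
  simpa using (const (ι := ι) c).mul hU hU' h

theorem neg (hU : IsOpen U) (hU' : U ⊆ Ioi (-1 / 2)) (h : RadialBound U k s φ) :
    RadialBound U k s (fun i x => -φ i x) := by
  simpa using h.const_mul hU hU' (-1)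

theorem sub (hU : IsOpen U) (hU' : U ⊆ Ioi (-1 / 2)) (h : RadialBound U k s φ)
    (h' : RadialBound U k s ψ) : RadialBound U k s (fun i x => φ i x - ψ i x) := by
  simpa [sub_eq_add_neg] using h.add hU (h'.neg hU hU')

theorem finset_sum (hU : IsOpen U) {A : Finset κ} {Φ : κ → ι → ℝ → ℝ}
    (h : ∀ a ∈ A, RadialBound U k s (Φ a)) : RadialBound U k s (fun i x => ∑ a ∈ A, Φ a i x) := by
  classical
  induction A using Finset.induction_on with
  | empty => simpa using zero
  | insert a A ha ih =>
    simp only [Finset.sum_insert ha]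
    exact (h a (by simp)).add hU (ih fun b hb => h b (by simp [hb]))

theorem finset_prod (hU : IsOpen U) (hU' : U ⊆ Ioi (-1 / 2)) {A : Finset κ} {S : κ → ℝ}
    {Φ : κ → ι → ℝ → ℝ} (h : ∀ a ∈ A, RadialBound U k (S a) (Φ a)) :
    RadialBound U k (∑ a ∈ A, S a) (fun i x => ∏ a ∈ A, Φ a i x) := by
  classical
  induction A using Finset.induction_on with
  | empty => simpa using const 1
  | insert a A ha ih =>
    simp only [Finset.sum_insert ha, Finset.prod_insert ha]
    exact (h a (by simp)).mul hU hU' (ih fun b hb => h b (by simp [hb]))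

theorem pow (hU : IsOpen U) (hU' : U ⊆ Ioi (-1 / 2)) (h : RadialBound U k s φ) (l : ℕ) :
    RadialBound U k (l * s) (fun i x => φ i x ^ l) := by
  simpa using finset_prod hU hU' (A := (Finset.univ : Finset (Fin l))) (S := fun _ => s)
    (Φ := fun _ => φ) fun _ _ => h

/-- Away from 0 the ratio x/(1+x) stays between a positive constant and 1, so x and 1 + x are
interchangeable in powers of either sign. -/
theorem rpow {c : ℝ} (hc : 0 < c) (s : ℝ) : RadialBound (Ioi c) k s (fun (_ : ι) x => x ^ s) := by
  have hU' : Ioi c ⊆ Ioi (-1 / 2 : ℝ) := Ioi_subset_Ioi (by linarith)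
  have key : ∀ s : ℝ, ∃ C : ℝ, ∀ (_ : ι), ∀ x ∈ Ioi c, |x ^ s| ≤ C * (1 + x) ^ s := by
    intro s
    -- The summand 1 serves s ≥ 0, the other summand s ≤ 0.
    refine ⟨((1 + c⁻¹)⁻¹) ^ s + 1, fun i x (hx : c < x) => ?_⟩
    have hx0 : 0 < x := hc.trans hx
    have h1 : x / (1 + x) ≤ 1 := by rw [div_le_one (by linarith)]; linarith
    have h2 : (1 + c⁻¹)⁻¹ ≤ x / (1 + x) := by
      rw [inv_le_comm₀ (by positivity) (by positivity), inv_div, div_le_iff₀ hx0]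
      have : 1 ≤ c⁻¹ * x := by rw [inv_mul_eq_div, one_le_div hc]; exact hx.le
      linarith
    have h3 : (x / (1 + x)) ^ s ≤ ((1 + c⁻¹)⁻¹) ^ s + 1 := by
      rcases le_total 0 s with hs | hs
      · have := Real.rpow_le_one (by positivity) h1 hs
        have : 0 ≤ ((1 + c⁻¹)⁻¹) ^ s := by positivity
        linarith
      · have := Real.rpow_le_rpow_of_nonpos (by positivity) h2 hs
        linarith
    rw [abs_of_nonneg (by positivity)]
    calc x ^ s = (x / (1 + x)) ^ s * (1 + x) ^ s := by
          rw [← Real.mul_rpow (by positivity) (by positivity), div_mul_cancel₀ _ (by positivity)]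
      _ ≤ _ := mul_le_mul_of_nonneg_right h3 (by positivity)
  induction k generalizing s with
  | zero => exact key s
  | succ k ih =>
    have hx0 : ∀ x ∈ Ioi c, x ≠ 0 := fun x hx => (hc.trans hx).ne'
    refine ⟨key s, fun i x hx => Real.differentiableAt_rpow_const_of_ne s (hx0 x hx), ?_⟩
    exact ((ih (s - 1)).const_mul isOpen_Ioi hU' s).congr isOpen_Ioi
      fun i x hx => Real.deriv_rpow_const x s

/-- On a compact interval to the right of -1 the weight is bounded above and below, so the order is
irrelevant. -/
theorem of_contDiff {a b : ℝ} (ha : -1 < a) (hU : U ⊆ Icc a b) {f : ℝ → ℝ} (hf : ContDiff ℝ ∞ f) :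
    RadialBound U k s (fun (_ : ι) => f) := by
  have key : ∀ {f : ℝ → ℝ} (s : ℝ), ContDiff ℝ ∞ f →
      ∃ C : ℝ, ∀ (_ : ι), ∀ x ∈ U, |f x| ≤ C * (1 + x) ^ s := by
    intro f s hf
    have hpos : ∀ x ∈ Icc a b, 0 < 1 + x := fun x hx => by linarith [hx.1]
    have hcont : ContinuousOn (fun x => f x * (1 + x) ^ (-s)) (Icc a b) :=
      hf.continuous.continuousOn.mul ((continuousOn_const.add continuousOn_id).rpow_const
        fun x hx => Or.inl (hpos x hx).ne')
    obtain ⟨C, hC⟩ := isCompact_Icc.exists_bound_of_continuousOn hcont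
    refine ⟨C, fun _ x hx => ?_⟩
    have h1 := hC x (hU hx)
    have h2 := hpos x (hU hx)
    rw [Real.norm_eq_abs, abs_mul, abs_of_nonneg (by positivity : 0 ≤ (1 + x) ^ (-s)),
      Real.rpow_neg h2.le, ← div_eq_mul_inv, div_le_iff₀ (by positivity)] at h1
    exact h1
  induction k generalizing s f with
  | zero => exact key s hf
  | succ k ih =>
    refine ⟨key s hf, fun i x _ => (hf.differentiable (by simp)).differentiableAt, ih ?_⟩
    exact (contDiff_infty_iff_deriv.1 hf).2

/-- One order is lost: at the last level only a bound is recorded, and continuity of a derivative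
comes from the existence of the next one. -/
theorem contDiffOn (hU : IsOpen U) (h : RadialBound U (k + 1) s φ) (i : ι) :
    ContDiffOn ℝ k (φ i) U := by
  induction k generalizing s φ with
  | zero =>
    exact contDiffOn_zero.2 fun x hx => (h.2.1 i x hx).continuousAt.continuousWithinAt
  | succ k ih =>
    rw [Nat.cast_succ, contDiffOn_succ_iff_deriv_of_isOpen hU]
    exact ⟨fun x hx => (h.2.1 i x hx).differentiableWithinAt, by simp, ih h.2.2⟩

theorem iteratedDeriv_le (hU' : U ⊆ Ioi (-1 / 2)) (h : RadialBound U k s φ) :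
    ∃ C : ℝ, 0 ≤ C ∧ ∀ i, ∀ x ∈ U, |iteratedDeriv k (φ i) x| ≤ C * (1 + x) ^ (s - k) := by
  induction k generalizing s φ with
  | zero => simpa using h.bound_nonneg hU'
  | succ k ih =>
    simp only [iteratedDeriv_succ', Nat.cast_succ]
    rw [show s - (k + 1) = s - 1 - k by ring]
    exact ih h.2.2

end RadialBound

end

/-! ### Symbols independent of x, and the passage from |ξ|² to ξ. -/

section

variable {n : ℕ} {ι : Type}

theorem bracket_pos (ξ : E n) : 0 < bracket ξ := Real.sqrt_pos.2 (by positivity)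

theorem bracket_sq (ξ : E n) : bracket ξ ^ 2 = 1 + ‖ξ‖ ^ 2 := Real.sq_sqrt (by positivity)

theorem one_le_bracket (ξ : E n) : 1 ≤ bracket ξ := by
  have h := bracket_sq ξ
  have := bracket_pos ξ
  nlinarith [sq_nonneg ‖ξ‖]

theorem norm_le_bracket (ξ : E n) : ‖ξ‖ ≤ bracket ξ :=
  Real.le_sqrt_of_sq_le (by linarith)

theorem bracket_le_one_add_norm (ξ : E n) : bracket ξ ≤ 1 + ‖ξ‖ :=
  Real.sqrt_le_iff.2 ⟨by positivity, by nlinarith [norm_nonneg ξ]⟩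

theorem one_add_norm_sq_rpow (ξ : E n) (s : ℝ) : (1 + ‖ξ‖ ^ 2) ^ s = bracket ξ ^ (2 * s) := by
  rw [← bracket_sq, Real.rpow_mul (bracket_pos ξ).le, Real.rpow_two]

theorem continuous_bracket : Continuous (bracket : E n → ℝ) := by
  unfold bracket; fun_prop

/-- Families of symbols that do not depend on `x`, with bounds uniform over the family. -/
def IsMultiplierFamily (r : ℝ) (g : ι → E n → ℂ) : Prop :=
  (∀ i, ContDiff ℝ ∞ (g i)) ∧
  ∀ k : ℕ, ∃ C : ℝ, 0 ≤ C ∧ ∀ i ξ, ‖iteratedFDeriv ℝ k (g i) ξ‖ ≤ C * bracket ξ ^ (r - k)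

namespace IsMultiplierFamily

variable {r r' : ℝ} {g g' : ι → E n → ℂ}

theorem isBoundedSymbolFamily (h : IsMultiplierFamily r g) :
    IsBoundedSymbolFamily r 0 (fun i _ ξ => g i ξ) := by
  refine ⟨fun i => (h.1 i).comp contDiff_snd, fun k l a b => ?_⟩
  obtain ⟨C, hC0, hC⟩ := h.2 k
  refine ⟨C, fun i x ξ => ?_⟩
  cases l with
  | zero =>
    simp only [partialDeriv, iteratedFDeriv_zero_apply, Nat.cast_zero, sub_zero, Real.rpow_zero,
      mul_one]
    refine ((iteratedFDeriv ℝ k (g i) ξ).le_opNorm _).trans ?_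
    simpa using hC i ξ
  | succ l =>
    -- A genuine x-derivative kills an x-independent symbol.
    have h0 : (fun η => partialDeriv b (fun _ : E n => g i η) x) = fun _ => 0 := by
      funext η
      simp [partialDeriv, iteratedFDeriv_succ_const]
    rw [h0]
    have : partialDeriv a (fun _ : E n => (0 : ℂ)) ξ = 0 := by
      simp [partialDeriv]
    rw [this, norm_zero]
    have := bracket_pos x
    have := bracket_pos ξ
    positivity

theorem isSymbol (h : IsMultiplierFamily r g) (i : ι) : IsSymbol r 0 (fun _ ξ => g i ξ) := by
  obtain ⟨h1, h2⟩ := h.isBoundedSymbolFamily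
  refine ⟨h1 i, fun k l a b => ?_⟩
  obtain ⟨C, hC⟩ := h2 k l a b
  exact ⟨C, hC i⟩

theorem hasTemperateGrowth (h : IsMultiplierFamily r g) (i : ι) :
    Function.HasTemperateGrowth (g i) := by
  refine ⟨h.1 i, fun k => ?_⟩
  obtain ⟨C, hC0, hC⟩ := h.2 k
  obtain ⟨N, hN⟩ := exists_nat_ge (r - k)
  refine ⟨N, C, fun ξ => (hC i ξ).trans (mul_le_mul_of_nonneg_left ?_ hC0)⟩
  calc bracket ξ ^ (r - k) ≤ bracket ξ ^ (N : ℝ) :=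
        Real.rpow_le_rpow_of_exponent_le (one_le_bracket ξ) hN
    _ = bracket ξ ^ N := Real.rpow_natCast _ _
    _ ≤ (1 + ‖ξ‖) ^ N := pow_le_pow_left₀ (bracket_pos ξ).le (bracket_le_one_add_norm ξ) _

theorem mono (h : IsMultiplierFamily r g) (hr : r ≤ r') : IsMultiplierFamily r' g := by
  refine ⟨h.1, fun k => ?_⟩
  obtain ⟨C, hC0, hC⟩ := h.2 k
  exact ⟨C, hC0, fun i ξ => (hC i ξ).trans (mul_le_mul_of_nonneg_left
    (Real.rpow_le_rpow_of_exponent_le (one_le_bracket ξ) (by linarith)) hC0)⟩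

theorem add (h : IsMultiplierFamily r g) (h' : IsMultiplierFamily r g') :
    IsMultiplierFamily r (fun i ξ => g i ξ + g' i ξ) := by
  refine ⟨fun i => (h.1 i).add (h'.1 i), fun k => ?_⟩
  obtain ⟨C, hC0, hC⟩ := h.2 k
  obtain ⟨D, hD0, hD⟩ := h'.2 k
  refine ⟨C + D, by positivity, fun i ξ => ?_⟩
  have hk : ((k : ℕ∞) : WithTop ℕ∞) ≤ ∞ := by exact_mod_cast le_top
  rw [fun_iteratedFDeriv_add ((h.1 i).of_le hk) ((h'.1 i).of_le hk)]
  refine (norm_add_le _ _).trans ?_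
  rw [add_mul]
  exact add_le_add (hC i ξ) (hD i ξ)

theorem mul (h : IsMultiplierFamily r g) (h' : IsMultiplierFamily r' g') :
    IsMultiplierFamily (r + r') (fun i ξ => g i ξ * g' i ξ) := by
  refine ⟨fun i => (h.1 i).mul (h'.1 i), fun k => ?_⟩
  choose C hC0 hC using h.2
  choose D hD0 hD using h'.2
  refine ⟨∑ j ∈ Finset.range (k + 1), (k.choose j : ℝ) * C j * D (k - j),
    Finset.sum_nonneg fun j _ => mul_nonneg (mul_nonneg (by positivity) (hC0 j)) (hD0 _),
    fun i ξ => ?_⟩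
  have hk : ((k : ℕ∞) : WithTop ℕ∞) ≤ ∞ := by exact_mod_cast le_top
  refine (norm_iteratedFDeriv_mul_le (h.1 i) (h'.1 i) ξ hk).trans ?_
  rw [Finset.sum_mul]
  refine Finset.sum_le_sum fun j hj => ?_
  have hj : j ≤ k := by simpa [Nat.lt_succ_iff] using hj
  have hb := bracket_pos ξ
  calc (k.choose j : ℝ) * ‖iteratedFDeriv ℝ j (g i) ξ‖ * ‖iteratedFDeriv ℝ (k - j) (g' i) ξ‖
      ≤ (k.choose j : ℝ) * (C j * bracket ξ ^ (r - j)) *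
          (D (k - j) * bracket ξ ^ (r' - (k - j : ℕ))) := by
        gcongr
        · exact mul_nonneg (by positivity) (mul_nonneg (hC0 j) (by positivity))
        · exact hC j i ξ
        · exact hD _ i ξ
    _ = (k.choose j : ℝ) * C j * D (k - j) *
          (bracket ξ ^ (r - j) * bracket ξ ^ (r' - (k - j : ℕ))) := by ring
    _ = _ := by
        rw [← Real.rpow_add hb, Nat.cast_sub hj]
        congr 2; ring

theorem of_hasCompactSupport {f : E n → ℂ} (hf : ContDiff ℝ ∞ f) (hc : HasCompactSupport f)
    (r : ℝ) : IsMultiplierFamily r (fun _ : ι => f) := by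
  refine ⟨fun _ => hf, fun k => ?_⟩
  have hk : ((k : ℕ∞) : WithTop ℕ∞) ≤ ∞ := by exact_mod_cast le_top
  have hcont : Continuous fun ξ => bracket ξ ^ (-(r - k)) * ‖iteratedFDeriv ℝ k f ξ‖ :=
    (continuous_bracket.rpow_const fun ξ => Or.inl (bracket_pos ξ).ne').mul
      (hf.continuous_iteratedFDeriv hk).norm
  obtain ⟨C, hC⟩ := ((hc.iteratedFDeriv k).norm.mul_left
    (f := fun ξ => bracket ξ ^ (-(r - k)))).exists_bound_of_continuous hcont
  refine ⟨|C|, abs_nonneg C, fun _ ξ => ?_⟩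
  have hb := bracket_pos ξ
  have h1 := ((le_abs_self _).trans (hC ξ)).trans (le_abs_self C)
  simp only [Pi.mul_apply] at h1
  rwa [Real.rpow_neg hb.le, inv_mul_le_iff₀ (by positivity), mul_comm] at h1

end IsMultiplierFamily

theorem iteratedDeriv_comp_mul_left_eq (f : ℝ → ℝ) (b : ℝ) (k : ℕ) :
    iteratedDeriv k (fun x => f (b * x)) = fun x => b ^ k * iteratedDeriv k f (b * x) := by
  induction k with
  | zero => simp
  | succ k ih =>
    funext x
    rw [iteratedDeriv_succ, ih, deriv_const_mul_field, deriv_comp_mul_left, ← iteratedDeriv_succ,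
      smul_eq_mul]
    ring

/-- The function is quadratic, so only k = 1, 2 matter. The right-hand side is shaped so that, after
division by ⟨ξ⟩², it becomes D^k with D = 2/⟨ξ⟩, the form needed by the chain-rule estimate
`norm_iteratedFDeriv_comp_le'`. -/
theorem norm_iteratedFDeriv_norm_sq_le (ξ : E n) {k : ℕ} (hk : 1 ≤ k) :
    ‖iteratedFDeriv ℝ k (fun η : E n => ‖η‖ ^ 2) ξ‖ ≤ bracket ξ ^ 2 * (2 / bracket ξ) ^ k := by
  have hb := bracket_pos ξ
  obtain ⟨L, hfd, hL⟩ : ∃ L : E n →L[ℝ] E n →L[ℝ] ℝ,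
      fderiv ℝ (fun η : E n => ‖η‖ ^ 2) = ⇑L ∧ ‖L‖ ≤ 2 := by
    have h1 : ‖innerSL ℝ (E := E n)‖ ≤ 1 := norm_innerSL_le ℝ
    refine ⟨innerSL ℝ (E := E n) + innerSL ℝ (E := E n), ?_, ?_⟩
    · rw [fderiv_norm_sq, two_smul]; rfl
    · refine (ContinuousLinearMap.opNorm_add_le _ _).trans ?_
      linarith
  obtain ⟨k, rfl⟩ := Nat.exists_eq_add_of_le' hk
  rw [← norm_iteratedFDeriv_fderiv, hfd]
  match k with
  | 0 =>
    rw [norm_iteratedFDeriv_zero]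
    refine (L.le_of_opNorm_le hL ξ).trans ?_
    have : bracket ξ ^ 2 * (2 / bracket ξ) ^ (0 + 1) = 2 * bracket ξ := by
      rw [zero_add, pow_one]; field_simp
    rw [this]
    linarith [norm_le_bracket ξ]
  | 1 =>
    rw [norm_iteratedFDeriv_one, ContinuousLinearMap.fderiv]
    have : bracket ξ ^ 2 * (2 / bracket ξ) ^ (1 + 1) = 4 := by
      rw [div_pow]; field_simp; norm_num
    rw [this]
    linarith
  | k + 2 =>
    have h0 : ‖iteratedFDeriv ℝ (k + 2) (⇑L) ξ‖ = 0 := by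
      rw [← norm_iteratedFDeriv_fderiv]
      have : fderiv ℝ (⇑L) = fun _ => L := by
        funext η; exact ContinuousLinearMap.fderiv _
      rw [this, iteratedFDeriv_succ_const]
      simp
    rw [h0]
    positivity

/-- The chain-rule estimate wants one constant for all derivatives of the outer function and a
geometric bound D^j for the inner one. Freezing b = ⟨ξ⟩² at the point considered and writing φ(|η|²)
= φ(b · (|η|²/b)) provides both: each outer derivative gains a factor b that cancels its decay, and
the inner ones are bounded by (2/⟨ξ⟩)^j. The margin ε is there because |ξ|² takes the value 0, where
derivatives of φ are needed on both sides. -/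
theorem RadialBound.isMultiplierFamily {ε s : ℝ} (hε : 0 < ε) (hε' : ε ≤ 1 / 2) {φ : ι → ℝ → ℝ}
    (h : ∀ k, RadialBound (Ioi (-ε)) k s φ) :
    IsMultiplierFamily (2 * s) (fun i (ξ : E n) => ((φ i (‖ξ‖ ^ 2) : ℝ) : ℂ)) := by
  have hU : Ioi (-ε) ⊆ Ioi (-1 / 2 : ℝ) := Ioi_subset_Ioi (by linarith)
  have hmem : ∀ ξ : E n, ‖ξ‖ ^ 2 ∈ Ioi (-ε) := fun ξ => by
    have : 0 ≤ ‖ξ‖ ^ 2 := by positivity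
    exact mem_Ioi.2 (by linarith)
  have hφ : ∀ i, ContDiffOn ℝ ∞ (φ i) (Ioi (-ε)) := fun i =>
    contDiffOn_infty.2 fun k => (h (k + 1)).contDiffOn isOpen_Ioi i
  have hsq : ContDiff ℝ ∞ fun ξ : E n => ‖ξ‖ ^ 2 := contDiff_norm_sq ℝ
  have hcomp : ∀ i, ContDiff ℝ ∞ fun ξ : E n => φ i (‖ξ‖ ^ 2) := fun i =>
    (hφ i).comp_contDiff hsq hmem
  refine ⟨fun i => Complex.ofRealCLM.contDiff.comp (hcomp i), fun k => ?_⟩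
  choose C hC0 hC using fun k => (h k).iteratedDeriv_le hU
  refine ⟨k.factorial * (∑ j ∈ Finset.range (k + 1), C j) * 2 ^ k,
    mul_nonneg (mul_nonneg (by positivity) (Finset.sum_nonneg fun j _ => hC0 j)) (by positivity),
    fun i ξ => ?_⟩
  have hk : ((k : ℕ∞) : WithTop ℕ∞) ≤ ∞ := by exact_mod_cast le_top
  have h1 := Complex.ofRealLI.norm_iteratedFDeriv_comp_left (hcomp i).contDiffAt (x := ξ) hk
  change ‖iteratedFDeriv ℝ k (fun ξ : E n => ((φ i (‖ξ‖ ^ 2) : ℝ) : ℂ)) ξ‖ = _ at h1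
  rw [h1]
  have hb := bracket_pos ξ
  set b := bracket ξ ^ 2 with hb2
  have hb0 : 0 < b := by positivity
  set t : Set ℝ := (fun x => b * x) ⁻¹' Ioi (-ε) with ht
  have htopen : IsOpen t := isOpen_Ioi.preimage (by fun_prop)
  have key := norm_iteratedFDeriv_comp_le' (𝕜 := ℝ) (n := k) (N := ∞) (t := t)
    (g := fun x => φ i (b * x)) (f := fun η : E n => b⁻¹ • ‖η‖ ^ 2)
    (C := (∑ j ∈ Finset.range (k + 1), C j) * bracket ξ ^ (2 * s)) (D := 2 / bracket ξ) ?_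
    htopen.uniqueDiffOn ?_ ?_ hk ξ ?_ ?_
  · have hfun : ((fun x => φ i (b * x)) ∘ fun η : E n => b⁻¹ • ‖η‖ ^ 2) =
        fun η => φ i (‖η‖ ^ 2) := by
      funext η
      simp only [Function.comp, smul_eq_mul]
      rw [mul_inv_cancel_left₀ hb0.ne']
    rw [hfun] at key
    refine key.trans (le_of_eq ?_)
    rw [Real.rpow_sub hb, div_pow, Real.rpow_natCast]
    ring
  · rintro _ ⟨η, rfl⟩
    simp only [ht, mem_preimage, smul_eq_mul, mul_inv_cancel_left₀ hb0.ne']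
    exact hmem η
  · exact (hφ i).comp (by fun_prop) fun x hx => hx
  · exact hsq.const_smul _
  · intro j hj
    have hbξ : b * (b⁻¹ • ‖ξ‖ ^ 2) = ‖ξ‖ ^ 2 := by
      rw [smul_eq_mul, mul_inv_cancel_left₀ hb0.ne']
    have hmt : b⁻¹ • ‖ξ‖ ^ 2 ∈ t := by
      simp only [ht, mem_preimage, hbξ]; exact hmem ξ
    rw [iteratedFDerivWithin_of_isOpen j htopen hmt, norm_iteratedFDeriv_eq_norm_iteratedDeriv,
      iteratedDeriv_comp_mul_left_eq]
    simp only [hbξ]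
    rw [Real.norm_eq_abs, abs_mul, abs_of_pos (by positivity)]
    calc b ^ j * |iteratedDeriv j (φ i) (‖ξ‖ ^ 2)|
        ≤ b ^ j * (C j * (1 + ‖ξ‖ ^ 2) ^ (s - j)) := by
          gcongr; exact hC j i _ (hmem ξ)
      _ = C j * bracket ξ ^ (2 * s) := by
          rw [one_add_norm_sq_rpow, mul_sub, Real.rpow_sub hb, hb2, ← pow_mul,
            show (2 * (j : ℝ)) = ((2 * j : ℕ) : ℝ) by push_cast; ring, Real.rpow_natCast]
          field_simp
      _ ≤ _ := by
          gcongr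
          exact Finset.single_le_sum (f := C) (fun j _ => hC0 j)
            (Finset.mem_range.2 (Nat.lt_succ_of_le hj))
  · intro j hj1 hj
    rw [iteratedFDeriv_const_smul_apply' (hsq.contDiffAt.of_le (by exact_mod_cast le_top)),
      norm_smul, Real.norm_eq_abs, abs_of_pos (by positivity), inv_mul_le_iff₀ hb0]
    exact norm_iteratedFDeriv_norm_sq_le ξ hj1

end

/-! ### Taylor remainders of the exponential, with bounds uniform in t. -/

section

/-- The function `x ↦ (exp x - ∑ l < L, x ^ l / l!) / x ^ L`. -/
def expRem : ℕ → ℝ → ℝ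
  | 0, x => Real.exp x
  | L + 1, x => ∫ u in (0 : ℝ)..1, (1 - u) ^ L / L.factorial * Real.exp (u * x)

theorem expRem_nonneg (L : ℕ) (x : ℝ) : 0 ≤ expRem L x := by
  cases L with
  | zero => exact (Real.exp_pos x).le
  | succ L =>
    refine intervalIntegral.integral_nonneg zero_le_one fun u hu => ?_
    have : 0 ≤ 1 - u := by linarith [hu.2]
    positivity

/-- For 0 ≤ u ≤ 1 the value exp (u x) lies between 1 and exp x, and the weight is at most 1. The
maximum is useful because e^{-ta} times this bound at -tR is the larger of e^{-ta} and e^{-t(a+R)},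
both of which decay. -/
theorem expRem_le (L : ℕ) (x : ℝ) : expRem L x ≤ max 1 (Real.exp x) := by
  cases L with
  | zero => exact le_max_right _ _
  | succ L =>
    have h : ∀ u ∈ Icc (0 : ℝ) 1,
        (1 - u) ^ L / L.factorial * Real.exp (u * x) ≤ max 1 (Real.exp x) := by
      intro u hu
      have h1 : (1 - u) ^ L / L.factorial ≤ 1 := by
        rw [div_le_one (by positivity)]
        exact (pow_le_one₀ (by linarith [hu.2]) (by linarith [hu.1])).trans
          (by exact_mod_cast L.factorial_pos)
      have h2 : Real.exp (u * x) ≤ max 1 (Real.exp x) := by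
        rcases le_total x 0 with hx | hx
        · exact le_max_of_le_left (Real.exp_le_one_iff.2 (mul_nonpos_of_nonneg_of_nonpos hu.1 hx))
        · exact le_max_of_le_right (Real.exp_le_exp.2 (mul_le_of_le_one_left hx hu.2))
      have h3 : 0 ≤ (1 - u) ^ L / L.factorial := by
        have : 0 ≤ 1 - u := by linarith [hu.2]
        positivity
      calc _ ≤ 1 * Real.exp (u * x) := by gcongr
        _ ≤ _ := by rwa [one_mul]
    calc expRem (L + 1) x ≤ ∫ _ in (0 : ℝ)..1, max 1 (Real.exp x) :=
          intervalIntegral.integral_mono_on zero_le_one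
            (Continuous.intervalIntegrable (by fun_prop) _ _) (by simp) h
      _ = _ := by simp

/-- Integration by parts in u; iterating it yields Taylor's formula. -/
theorem expRem_eq_add (L : ℕ) (x : ℝ) :
    expRem L x = 1 / L.factorial + x * expRem (L + 1) x := by
  cases L with
  | zero =>
    have h : ∀ u ∈ uIcc (0 : ℝ) 1, HasDerivAt (fun u => Real.exp (u * x))
        (Real.exp (u * x) * x) u := fun u _ => by
      simpa using ((hasDerivAt_id u).mul_const x).exp
    have := intervalIntegral.integral_eq_sub_of_hasDerivAt h
      (Continuous.intervalIntegrable (by fun_prop) _ _)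
    rw [intervalIntegral.integral_mul_const] at this
    simp only [expRem, pow_zero, Nat.factorial_zero, Nat.cast_one, div_one, one_mul] at this ⊢
    simp only [zero_mul, Real.exp_zero] at this
    linarith
  | succ L =>
    have h : ∀ u ∈ uIcc (0 : ℝ) 1,
        HasDerivAt (fun u => (1 - u) ^ (L + 1) / (L + 1).factorial * Real.exp (u * x))
        (x * ((1 - u) ^ (L + 1) / (L + 1).factorial * Real.exp (u * x)) -
          (1 - u) ^ L / L.factorial * Real.exp (u * x)) u := fun u _ => by
      have h1 : HasDerivAt (fun u => Real.exp (u * x)) (Real.exp (u * x) * x) u := by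
        simpa using ((hasDerivAt_id u).mul_const x).exp
      have h2 : HasDerivAt (fun u : ℝ => (1 - u) ^ (L + 1) / (L + 1).factorial)
          (-((1 - u) ^ L / L.factorial)) u := by
        have := ((((hasDerivAt_id u).const_sub 1).pow (L + 1))).div_const ((L + 1).factorial : ℝ)
        refine this.congr_deriv ?_
        simp only [id, Nat.factorial_succ, Nat.cast_mul, Nat.cast_succ, Nat.add_sub_cancel]
        field_simp
      exact (h2.mul h1).congr_deriv (by ring)
    have := intervalIntegral.integral_eq_sub_of_hasDerivAt h
      (Continuous.intervalIntegrable (by fun_prop) _ _)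
    rw [intervalIntegral.integral_sub (Continuous.intervalIntegrable (by fun_prop) _ _)
      (Continuous.intervalIntegrable (by fun_prop) _ _), intervalIntegral.integral_const_mul] at this
    simp only [expRem]
    simp at this ⊢
    linarith

theorem exp_eq_sum_add_expRem (L : ℕ) (x : ℝ) :
    Real.exp x = ∑ l ∈ Finset.range L, x ^ l / l.factorial + x ^ L * expRem L x := by
  induction L with
  | zero => simp [expRem]
  | succ L ih => rw [ih, expRem_eq_add L, Finset.sum_range_succ]; ring

/-- Differentiation under the integral brings down u = 1 - (1 - u), so the derivative stays in the
same family of functions. -/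
theorem hasDerivAt_expRem (L : ℕ) (x : ℝ) :
    HasDerivAt (expRem L) (expRem L x - L * expRem (L + 1) x) x := by
  cases L with
  | zero =>
    have h : expRem 0 = Real.exp := rfl
    simpa [h] using Real.hasDerivAt_exp x
  | succ L =>
    have h := (intervalIntegral.hasDerivAt_integral_of_dominated_loc_of_deriv_le
      (μ := volume) (a := 0) (b := 1) (x₀ := x) (s := Metric.ball x 1)
      (F := fun x u => (1 - u) ^ L / L.factorial * Real.exp (u * x))
      (F' := fun x u => (1 - u) ^ L / L.factorial * (Real.exp (u * x) * u))
      (bound := fun _ => Real.exp (|x| + 1))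
      (Metric.ball_mem_nhds x one_pos)
      (Eventually.of_forall fun y => Continuous.aestronglyMeasurable (by fun_prop))
      (Continuous.intervalIntegrable (by fun_prop) _ _)
      (Continuous.aestronglyMeasurable (by fun_prop)) ?_ (by simp) ?_).2
    · refine h.congr_deriv ?_
      have hL : ((L + 1 : ℕ) : ℝ) * expRem (L + 2) x =
          ∫ u in (0 : ℝ)..1, (1 - u) ^ (L + 1) / L.factorial * Real.exp (u * x) := by
        rw [expRem, ← intervalIntegral.integral_const_mul]
        refine intervalIntegral.integral_congr fun u _ => ?_
        simp only [Nat.factorial_succ, Nat.cast_mul]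
        have : ((L + 1 : ℕ) : ℝ) ≠ 0 := by positivity
        field_simp
      rw [hL, expRem, ← intervalIntegral.integral_sub
        (Continuous.intervalIntegrable (by fun_prop) _ _)
        (Continuous.intervalIntegrable (by fun_prop) _ _)]
      refine intervalIntegral.integral_congr fun u _ => ?_
      ring
    · refine Eventually.of_forall fun u hu y hy => ?_
      rw [uIoc_of_le zero_le_one] at hu
      have h0 : 0 ≤ 1 - u := by linarith [hu.2]
      have hu0 : 0 ≤ u := hu.1.le
      have h1 : (1 - u) ^ L / L.factorial ≤ 1 := by
        rw [div_le_one (by positivity)]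
        exact (pow_le_one₀ h0 (by linarith)).trans (by exact_mod_cast L.factorial_pos)
      have hy' : |y| ≤ |x| + 1 := by
        rw [Metric.mem_ball, Real.dist_eq] at hy
        linarith [abs_sub_abs_le_abs_sub y x]
      have h2 : Real.exp (u * y) ≤ Real.exp (|x| + 1) := by
        refine Real.exp_le_exp.2 (le_trans ?_ hy')
        exact (mul_le_mul_of_nonneg_left (le_abs_self y) hu0).trans
          (mul_le_of_le_one_left (abs_nonneg y) hu.2)
      rw [Real.norm_of_nonneg (by positivity)]
      calc _ ≤ 1 * (Real.exp (|x| + 1) * 1) := by gcongr; exact hu.2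
        _ = _ := by ring
    · refine Eventually.of_forall fun u hu y hy => ?_
      have : HasDerivAt (fun y => Real.exp (u * y)) (Real.exp (u * y) * u) y := by
        simpa using ((hasDerivAt_id y).const_mul u).exp
      exact this.const_mul _

/-- This is y^l / l! ≤ e^y at y = tcw. It trades powers of t for negative powers of w, uniformly in
t. -/
theorem pow_mul_exp_neg_le {t c w : ℝ} (ht : 0 ≤ t) (hc : 0 < c) (hw : 0 < w) (l : ℕ) :
    t ^ l * Real.exp (-t * (c * w)) ≤ l.factorial / c ^ l * (w ^ l)⁻¹ := by
  have h := Real.pow_div_factorial_le_exp (x := t * (c * w)) (by positivity) l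
  rw [div_le_iff₀ (by positivity)] at h
  rw [neg_mul, Real.exp_neg, ← div_eq_mul_inv, ← div_eq_mul_inv, div_div, div_le_div_iff₀
    (Real.exp_pos _) (by positivity)]
  calc t ^ l * (c ^ l * w ^ l) = (t * (c * w)) ^ l := by rw [mul_pow, mul_pow]
    _ ≤ _ := by linarith

/-- Each derivative brings down one factor t, worth -α, and one of a' or R', of order α - 1, so the
order drops by exactly one. The induction must leave `l` and `L` free because differentiation raises
them. Lower bounds are needed for both a and a + R, since `expRem_le` is a maximum of two
exponentials. -/
theorem RadialBound.exp_mul_expRem {ι : Type} {U : Set ℝ} (hU : IsOpen U) (hU' : U ⊆ Ioi (-1 / 2))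
    {α c : ℝ} (hc : 0 < c) {a R : ℝ → ℝ} {t : ι → ℝ} (ht : ∀ i, 0 ≤ t i)
    (ha : ∀ k, RadialBound U k α fun _ : ι => a) (hR : ∀ k, RadialBound U k α fun _ : ι => R)
    (hca : ∀ x ∈ U, c * (1 + x) ^ α ≤ a x) (hcR : ∀ x ∈ U, c * (1 + x) ^ α ≤ a x + R x)
    (k l L : ℕ) :
    RadialBound U k (-(l * α))
      (fun i x => t i ^ l * (Real.exp (-t i * a x) * expRem L (-t i * R x))) := by
  have key : ∀ l L : ℕ, ∃ C : ℝ, ∀ i, ∀ x ∈ U,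
      |t i ^ l * (Real.exp (-t i * a x) * expRem L (-t i * R x))| ≤ C * (1 + x) ^ (-(l * α)) := by
    intro l L
    refine ⟨l.factorial / c ^ l, fun i x hx => ?_⟩
    have hx1 : (0 : ℝ) < 1 + x := by
      have : (-1 / 2 : ℝ) < x := hU' hx
      linarith
    have ht' := ht i
    have h1 : Real.exp (-t i * a x) * expRem L (-t i * R x) ≤
        Real.exp (-t i * (c * (1 + x) ^ α)) := by
      refine (mul_le_mul_of_nonneg_left (expRem_le L _) (Real.exp_pos _).le).trans ?_
      rw [mul_max_of_nonneg _ _ (Real.exp_pos _).le, ← Real.exp_add, mul_one, max_le_iff,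
        Real.exp_le_exp, Real.exp_le_exp]
      constructor
      · nlinarith [hca x hx]
      · nlinarith [hcR x hx]
    rw [abs_of_nonneg (mul_nonneg (by positivity)
      (mul_nonneg (Real.exp_pos _).le (expRem_nonneg _ _)))]
    refine (mul_le_mul_of_nonneg_left h1 (by positivity)).trans ?_
    refine (pow_mul_exp_neg_le ht' hc (Real.rpow_pos_of_pos hx1 α) l).trans (le_of_eq ?_)
    rw [Real.rpow_neg hx1.le, mul_comm (l : ℝ), Real.rpow_mul hx1.le, Real.rpow_natCast]
  induction k generalizing l L with
  | zero => exact key l L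
  | succ k ih =>
    have hd : ∀ i, ∀ x ∈ U,
        HasDerivAt (fun x => t i ^ l * (Real.exp (-t i * a x) * expRem L (-t i * R x)))
        (-(deriv a x * (t i ^ (l + 1) * (Real.exp (-t i * a x) * expRem L (-t i * R x)))) +
          (-(deriv R x * (t i ^ (l + 1) * (Real.exp (-t i * a x) * expRem L (-t i * R x)))) +
          L * (deriv R x *
            (t i ^ (l + 1) * (Real.exp (-t i * a x) * expRem (L + 1) (-t i * R x)))))) x := by
      intro i x hx
      have h1 := (((ha 1).2.1 i x hx).hasDerivAt.const_mul (-t i)).exp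
      have h2 := (hasDerivAt_expRem L (-t i * R x)).comp x
        (((hR 1).2.1 i x hx).hasDerivAt.const_mul (-t i))
      refine ((h1.mul h2).const_mul (t i ^ l)).congr_deriv ?_
      simp only [Function.comp]
      ring
    refine ⟨key l L, fun i x hx => (hd i x hx).differentiableAt, ?_⟩
    have e : α - 1 + -((l + 1 : ℕ) * α) = -(l * α) - 1 := by push_cast; ring
    have h1 := ((ha (k + 1)).2.2.mul hU hU' (ih (l + 1) L)).neg hU hU'
    have h2 := ((hR (k + 1)).2.2.mul hU hU' (ih (l + 1) L)).neg hU hU'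
    have h3 := ((hR (k + 1)).2.2.mul hU hU' (ih (l + 1) (L + 1))).const_mul hU hU' L
    rw [e] at h1 h2 h3
    exact (h1.add hU (h2.add hU h3)).congr hU fun i x hx => (hd i x hx).deriv

end

/-! ### Laplace transforms of functions with power bounds (Watson's lemma). -/

section

/-- `laplaceDeriv q j` is the `j`-th derivative of the Laplace transform of `q`. -/
def laplaceDeriv (q : ℝ → ℝ) (j : ℕ) (x : ℝ) : ℝ :=
  ∫ t in Ioi (0 : ℝ), (-t) ^ j * (Real.exp (-x * t) * q t)

/-- `q` is `O(t ^ (b - 1))` near `0` and near `∞`, and integrable in between. -/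
structure HasPowerBound (q : ℝ → ℝ) (b : ℝ) : Prop where
  pos : 0 < b
  meas : AEStronglyMeasurable q (volume.restrict (Ioi 0))
  bound : ∃ (C δ : ℝ) (g : ℝ → ℝ), 0 ≤ C ∧ 0 < δ ∧ IntegrableOn g (Ioi 0) ∧ (∀ t, 0 ≤ g t) ∧
    (∀ t, t ∉ Icc δ 1 → g t = 0) ∧
    ∀ᵐ t ∂(volume.restrict (Ioi (0 : ℝ))), |q t| ≤ C * t ^ (b - 1) + g t

theorem integrableOn_rpow_mul_exp {b x : ℝ} (hb : 0 < b) (hx : 0 < x) :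
    IntegrableOn (fun t : ℝ => t ^ (b - 1) * Real.exp (-(x * t))) (Ioi 0) := by
  have := integrableOn_rpow_mul_exp_neg_mul_rpow (s := b - 1) (p := 1) (b := x) (by linarith)
    one_pos hx
  simpa using this

namespace HasPowerBound

variable {q : ℝ → ℝ} {b : ℝ}

/-- The part `g` lives on [δ, 1], where t^j ≤ 1 and e^{-xt} ≤ e^{-xδ}, so it contributes only an
exponentially small term in x. The exceptional null set does not depend on x, as differentiation
under the integral requires. -/
theorem norm_le (h : HasPowerBound q b) : ∃ (C δ : ℝ) (g : ℝ → ℝ), 0 ≤ C ∧ 0 < δ ∧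
    IntegrableOn g (Ioi 0) ∧ (∀ t, 0 ≤ g t) ∧
    ∀ (j : ℕ), ∀ᵐ t ∂(volume.restrict (Ioi (0 : ℝ))), ∀ x > 0,
      ‖(-t) ^ j * (Real.exp (-x * t) * q t)‖ ≤
        C * (t ^ (j + b - 1) * Real.exp (-(x * t))) + Real.exp (-(x * δ)) * g t := by
  obtain ⟨C, δ, g, hC, hδ, hg, hg0, hgs, hq⟩ := h.bound
  refine ⟨C, δ, g, hC, hδ, hg, hg0, fun j => ?_⟩
  filter_upwards [hq, ae_restrict_mem measurableSet_Ioi] with t ht (ht0 : 0 < t) x hx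
  rw [norm_mul, norm_mul, norm_pow, norm_neg, Real.norm_eq_abs, Real.norm_eq_abs, Real.norm_eq_abs,
    abs_of_pos ht0, abs_of_pos (Real.exp_pos _)]
  have h1 : t ^ j * (Real.exp (-x * t) * g t) ≤ Real.exp (-(x * δ)) * g t := by
    by_cases hts : t ∈ Icc δ 1
    · have h2 : t ^ j ≤ 1 := pow_le_one₀ ht0.le hts.2
      have h3 : Real.exp (-x * t) ≤ Real.exp (-(x * δ)) :=
        Real.exp_le_exp.2 (by nlinarith [hts.1])
      have := hg0 t
      calc t ^ j * (Real.exp (-x * t) * g t) ≤ 1 * (Real.exp (-(x * δ)) * g t) := by gcongr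
        _ = _ := one_mul _
    · simp [hgs t hts]
  calc t ^ j * (Real.exp (-x * t) * |q t|)
      ≤ t ^ j * (Real.exp (-x * t) * (C * t ^ (b - 1) + g t)) := by gcongr
    _ = C * ((t ^ j * t ^ (b - 1)) * Real.exp (-(x * t))) + t ^ j * (Real.exp (-x * t) * g t) := by
        rw [neg_mul]; ring
    _ ≤ _ := by
        rw [← Real.rpow_natCast t j, ← Real.rpow_add ht0, ← add_sub_assoc]
        rw [← Real.rpow_natCast] at h1
        exact add_le_add le_rfl h1

theorem aestronglyMeasurable (h : HasPowerBound q b) (j : ℕ) (x : ℝ) :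
    AEStronglyMeasurable (fun t => (-t) ^ j * (Real.exp (-x * t) * q t))
      (volume.restrict (Ioi 0)) :=
  (Continuous.aestronglyMeasurable (by fun_prop)).mul
    ((Continuous.aestronglyMeasurable (by fun_prop)).mul h.meas)

theorem integrableOn (h : HasPowerBound q b) (j : ℕ) {x : ℝ} (hx : 0 < x) :
    IntegrableOn (fun t => (-t) ^ j * (Real.exp (-x * t) * q t)) (Ioi 0) := by
  obtain ⟨C, δ, g, hC, hδ, hg, hg0, hq⟩ := h.norm_le
  have hb := h.pos
  refine Integrable.mono' (((integrableOn_rpow_mul_exp (b := j + b) (by positivity) hx).const_mul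
    C).add (hg.const_mul (Real.exp (-(x * δ))))) (h.aestronglyMeasurable j x) ?_
  filter_upwards [hq j] with t ht using ht x hx

theorem hasDerivAt_laplaceDeriv (h : HasPowerBound q b) (j : ℕ) {x : ℝ} (hx : 0 < x) :
    HasDerivAt (laplaceDeriv q j) (laplaceDeriv q (j + 1) x) x := by
  obtain ⟨C, δ, g, hC, hδ, hg, hg0, hq⟩ := h.norm_le
  have hb := h.pos
  refine (hasDerivAt_integral_of_dominated_loc_of_deriv_le
    (F := fun x t => (-t) ^ j * (Real.exp (-x * t) * q t))
    (F' := fun x t => (-t) ^ (j + 1) * (Real.exp (-x * t) * q t))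
    (bound := fun t => C * (t ^ ((j + 1 : ℕ) + b - 1) * Real.exp (-(x / 2 * t))) + g t)
    (Ioi_mem_nhds (half_lt_self hx))
    (Eventually.of_forall fun y => h.aestronglyMeasurable j y) (h.integrableOn j hx)
    (h.aestronglyMeasurable (j + 1) x) ?_
    (((integrableOn_rpow_mul_exp (by positivity) (half_pos hx)).const_mul C).add hg) ?_).2
  · filter_upwards [hq (j + 1), ae_restrict_mem measurableSet_Ioi] with t ht (ht0 : 0 < t) y hy
    have hy' : x / 2 < y := hy
    have hy0 : 0 < y := (half_pos hx).trans hy'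
    refine (ht y hy0).trans ?_
    have h1 : Real.exp (-(y * t)) ≤ Real.exp (-(x / 2 * t)) :=
      Real.exp_le_exp.2 (by nlinarith)
    have h2 : Real.exp (-(y * δ)) ≤ 1 := Real.exp_le_one_iff.2 (by nlinarith)
    have := hg0 t
    gcongr
    exact mul_le_of_le_one_left this h2
  · refine Eventually.of_forall fun t y _ => ?_
    have : HasDerivAt (fun y => Real.exp (-y * t)) (Real.exp (-y * t) * -t) y := by
      simpa using (((hasDerivAt_id y).neg).mul_const t).exp
    exact ((this.mul_const (q t)).const_mul ((-t) ^ j)).congr_deriv (by ring)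

theorem abs_laplaceDeriv_le (h : HasPowerBound q b) (j : ℕ) : ∃ C D δ : ℝ, 0 ≤ C ∧ 0 ≤ D ∧ 0 < δ ∧
    ∀ x > 0, |laplaceDeriv q j x| ≤ C * x ^ (-b - j) + D * Real.exp (-(x * δ)) := by
  obtain ⟨C, δ, g, hC, hδ, hg, hg0, hq⟩ := h.norm_le
  have hb := h.pos
  have hΓ := Real.Gamma_pos_of_pos (show 0 < j + b by positivity)
  refine ⟨C * Real.Gamma (j + b), ∫ t in Ioi 0, g t, δ, by positivity,
    integral_nonneg hg0, hδ, fun x hx => ?_⟩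
  have hi := integrableOn_rpow_mul_exp (b := j + b) (by positivity) hx
  have h1 := norm_integral_le_of_norm_le ((hi.const_mul C).add (hg.const_mul (Real.exp (-(x * δ)))))
    ((hq j).mono fun t ht => ht x hx)
  rw [Real.norm_eq_abs] at h1
  refine h1.trans (le_of_eq ?_)
  simp only [Pi.add_apply]
  rw [integral_add (hi.const_mul C) (hg.const_mul _), integral_const_mul, integral_const_mul,
    Real.integral_rpow_mul_exp_neg_mul_Ioi (by positivity) hx, one_div, Real.inv_rpow hx.le,
    ← Real.rpow_neg hx.le, show -(j + b) = -b - j by ring]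
  ring

/-- The Gamma integral of the power bound gives x^{-b-j}; the exponentially small part is dominated
by any negative power. Derivatives are again of the form `laplaceDeriv`, so the induction shifts
`j`. -/
theorem radialBound_laplaceDeriv {ι : Type} (h : HasPowerBound q b) {c : ℝ} (hc : 0 < c)
    (k j : ℕ) : RadialBound (Ioi c) k (-b - j) (fun _ : ι => laplaceDeriv q j) := by
  have key : ∀ j : ℕ, ∃ C : ℝ, ∀ _ : ι, ∀ x ∈ Ioi c,
      |laplaceDeriv q j x| ≤ C * (1 + x) ^ (-b - j) := by
    intro j
    obtain ⟨C, D, δ, hC, hD, hδ, hq⟩ := h.abs_laplaceDeriv_le j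
    obtain ⟨C', hC'⟩ := (RadialBound.rpow (ι := Unit) (k := 0) hc (-b - j)).bound
    obtain ⟨M, hM⟩ := exists_nat_ge (b + j)
    refine ⟨C * C' + D * (Real.exp δ * (M.factorial / δ ^ M)), fun _ x hx => ?_⟩
    have hx0 : 0 < x := hc.trans hx
    refine (hq x hx0).trans ?_
    have h1 : x ^ (-b - j) ≤ C' * (1 + x) ^ (-b - j) := (le_abs_self _).trans (hC' () x hx)
    -- Here 1 + x plays the role of time; the shift by 1 is repaid by the factor exp δ.
    have h2 := pow_mul_exp_neg_le (t := 1 + x) (c := δ) (w := 1) (by positivity) hδ one_pos M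
    have h3 : (1 + x) ^ (b + j) ≤ (1 + x) ^ M := by
      rw [← Real.rpow_natCast]
      exact Real.rpow_le_rpow_of_exponent_le (by linarith) hM
    have h4 : Real.exp (-(x * δ)) ≤
        Real.exp δ * (M.factorial / δ ^ M) * (1 + x) ^ (-b - j) := by
      rw [show -b - j = -(b + j) by ring, Real.rpow_neg (by positivity), ← div_eq_mul_inv,
        le_div_iff₀ (by positivity)]
      rw [one_pow, inv_one, mul_one, mul_one] at h2
      calc Real.exp (-(x * δ)) * (1 + x) ^ (b + j)
          ≤ Real.exp (-(x * δ)) * (1 + x) ^ M := by gcongr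
        _ = Real.exp δ * ((1 + x) ^ M * Real.exp (-(1 + x) * δ)) := by
            rw [mul_left_comm, ← Real.exp_add, mul_comm]; congr 2; ring
        _ ≤ _ := by gcongr
    calc C * x ^ (-b - j) + D * Real.exp (-(x * δ))
        ≤ C * (C' * (1 + x) ^ (-b - j)) +
          D * (Real.exp δ * (M.factorial / δ ^ M) * (1 + x) ^ (-b - j)) := by gcongr
      _ = _ := by ring
  induction k generalizing j with
  | zero => exact key j
  | succ k ih =>
    have hd := fun (_ : ι) (x : ℝ) (hx : x ∈ Ioi c) =>
      h.hasDerivAt_laplaceDeriv j (hc.trans hx)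
    refine ⟨key j, fun i x hx => (hd i x hx).differentiableAt, ?_⟩
    have := ih (j + 1)
    rw [Nat.cast_succ, ← sub_sub] at this
    exact this.congr isOpen_Ioi fun i x hx => (hd i x hx).deriv

end HasPowerBound

end

/-! ### A smooth extension of exp(-s) to negative s, and the integral for a pure power density. -/

section

theorem contDiff_of_hasDerivAt_seq {F : ℕ → ℝ → ℝ}
    (h : ∀ j x, HasDerivAt (F j) (F (j + 1) x) x) (j : ℕ) : ContDiff ℝ ∞ (F j) := by
  refine contDiff_infty.2 fun N => ?_
  induction N generalizing j with
  | zero =>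
    exact contDiff_zero.2 (continuous_iff_continuousAt.2 fun x => (h j x).continuousAt)
  | succ N ih =>
    rw [Nat.cast_succ, contDiff_succ_iff_deriv]
    refine ⟨fun x => (h j x).differentiableAt, by simp, ?_⟩
    rw [show deriv (F j) = F (j + 1) from funext fun x => (h j x).deriv]
    exact ih (j + 1)

/-- A smooth function on `ℝ` with bounded derivatives that agrees with `exp (-s)` for `s ≥ 0`. -/
def dampedExp (s : ℝ) : ℝ := Real.exp (-s) * Real.smoothTransition (s + 1)

theorem dampedExp_of_nonneg {s : ℝ} (hs : 0 ≤ s) : dampedExp s = Real.exp (-s) := by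
  rw [dampedExp, Real.smoothTransition.one_of_one_le (by linarith), mul_one]

theorem contDiff_dampedExp : ContDiff ℝ ∞ dampedExp :=
  (Real.contDiff_exp.comp contDiff_neg).mul
    (Real.smoothTransition.contDiff.comp (contDiff_id.add contDiff_const))

/-- Three regions: zero for s < -1, a compact interval, and a decaying exponential for s > 0. -/
theorem exists_abs_iteratedDeriv_dampedExp_le (j : ℕ) :
    ∃ M : ℝ, 0 ≤ M ∧ ∀ s, |iteratedDeriv j dampedExp s| ≤ M := by
  have hcont : Continuous (iteratedDeriv j dampedExp) :=
    contDiff_dampedExp.continuous_iteratedDeriv j (by exact_mod_cast le_top)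
  obtain ⟨M, hM⟩ := (isCompact_Icc (a := (-1 : ℝ)) (b := 0)).exists_bound_of_continuousOn
    hcont.continuousOn
  refine ⟨max M 1, le_max_of_le_right zero_le_one, fun s => ?_⟩
  rcases lt_or_ge s (-1) with hs | hs
  · have h : dampedExp =ᶠ[𝓝 s] fun _ => 0 := by
      filter_upwards [Iio_mem_nhds hs] with x hx
      have hx' : x < -1 := hx
      rw [dampedExp, Real.smoothTransition.zero_of_nonpos (by linarith), mul_zero]
    rw [h.iteratedDeriv_eq]
    simp only [iteratedDeriv_fun_const_zero, abs_zero]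
    exact le_max_of_le_right zero_le_one
  rcases le_or_gt s 0 with hs0 | hs0
  · exact le_max_of_le_left (hM s ⟨hs, hs0⟩)
  · have h : dampedExp =ᶠ[𝓝 s] fun x => Real.exp (-1 * x) := by
      filter_upwards [Ioi_mem_nhds hs0] with x hx
      rw [dampedExp_of_nonneg (le_of_lt hx), neg_one_mul]
    rw [h.iteratedDeriv_eq, iteratedDeriv_exp_const_mul, abs_mul, abs_pow, abs_neg, abs_one,
      one_pow, one_mul, abs_of_pos (Real.exp_pos _)]
    exact le_max_of_le_right (Real.exp_le_one_iff.2 (by linarith))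

/-- A mean value estimate from s = 0. It makes (1 - `dampedExp` (xt)) m(t) dominated by a multiple
of t|m(t)|, for x of either sign. -/
theorem exists_abs_one_sub_dampedExp_le :
    ∃ M : ℝ, 0 ≤ M ∧ ∀ s, |1 - dampedExp s| ≤ M * |s| := by
  obtain ⟨M, hM0, hM⟩ := exists_abs_iteratedDeriv_dampedExp_le 1
  refine ⟨M, hM0, fun s => ?_⟩
  have h := Convex.norm_image_sub_le_of_norm_deriv_le (f := dampedExp) (s := univ) (x := 0) (y := s)
    (C := M) (fun x _ => (contDiff_dampedExp.differentiable (by simp)).differentiableAt)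
    (fun x _ => by simpa using hM x) convex_univ (mem_univ _) (mem_univ _)
  rw [dampedExp_of_nonneg le_rfl, neg_zero, Real.exp_zero, sub_zero, Real.norm_eq_abs,
    Real.norm_eq_abs] at h
  rwa [abs_sub_comm]

theorem one_sub_exp_neg_le {s : ℝ} : 1 - Real.exp (-s) ≤ s := by
  linarith [Real.add_one_le_exp (-s)]

theorem integrableOn_one_sub_exp_mul_rpow {α x : ℝ} (h0 : 0 < α) (h1 : α < 1) (hx : 0 < x) :
    IntegrableOn (fun t : ℝ => (1 - Real.exp (-x * t)) * t ^ (-1 - α)) (Ioi 0) := by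
  have hmeas : AEStronglyMeasurable (fun t : ℝ => (1 - Real.exp (-x * t)) * t ^ (-1 - α))
      (volume.restrict (Ioi 0)) := by
    refine ContinuousOn.aestronglyMeasurable (fun t ht => ?_) measurableSet_Ioi
    exact ((by fun_prop : Continuous fun t => 1 - Real.exp (-x * t)).continuousWithinAt).mul
      (Real.continuousAt_rpow_const _ _ (Or.inl (ne_of_gt ht))).continuousWithinAt
  rw [← Ioc_union_Ioi_eq_Ioi zero_le_one, integrableOn_union]
  constructor
  · have hint : IntegrableOn (fun t : ℝ => x * t ^ (-α)) (Ioc 0 1) :=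
      ((intervalIntegrable_iff_integrableOn_Ioc_of_le zero_le_one).1
        (intervalIntegral.intervalIntegrable_rpow' (by linarith))).const_mul x
    refine Integrable.mono' hint (hmeas.mono_set Ioc_subset_Ioi_self) ?_
    filter_upwards [ae_restrict_mem measurableSet_Ioc] with t ht
    have ht0 : 0 < t := ht.1
    have h2 : 0 ≤ 1 - Real.exp (-x * t) := by
      have := Real.exp_le_one_iff.2 (show -x * t ≤ 0 by nlinarith)
      linarith
    rw [Real.norm_of_nonneg (by positivity)]
    calc (1 - Real.exp (-x * t)) * t ^ (-1 - α) ≤ (x * t) * t ^ (-1 - α) := by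
          gcongr
          rw [neg_mul]
          exact one_sub_exp_neg_le
      _ = x * (t ^ (1 : ℝ) * t ^ (-1 - α)) := by rw [Real.rpow_one]; ring
      _ = _ := by rw [← Real.rpow_add ht0]; congr 2; ring
  · refine Integrable.mono' (integrableOn_Ioi_rpow_of_lt (show -1 - α < -1 by linarith) one_pos)
      (hmeas.mono_set (Ioi_subset_Ioi zero_le_one)) ?_
    filter_upwards [ae_restrict_mem measurableSet_Ioi] with t ht
    have ht0 : 0 < t := one_pos.trans ht
    have h2 : 0 ≤ 1 - Real.exp (-x * t) := by
      have := Real.exp_le_one_iff.2 (show -x * t ≤ 0 by nlinarith)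
      linarith
    rw [Real.norm_of_nonneg (by positivity)]
    exact mul_le_of_le_one_left (by positivity) (by linarith [Real.exp_pos (-x * t)])

/-- Integrating t^{-1-α} by parts to -t^{-α}/α leaves a convergent Gamma integral with value Γ(1-α)
= -αΓ(-α) up to scaling. The factor 1 - e^{-xt} = O(t) kills the boundary term at 0 because α < 1.
-/
theorem integral_one_sub_exp_mul_rpow {α x : ℝ} (h0 : 0 < α) (h1 : α < 1) (hx : 0 < x) :
    ∫ t in Ioi (0 : ℝ), (1 - Real.exp (-x * t)) * t ^ (-1 - α) = -Real.Gamma (-α) * x ^ α := by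
  have hu : ∀ t ∈ Ioi (0 : ℝ), HasDerivAt (fun t => 1 - Real.exp (-x * t))
      (x * Real.exp (-x * t)) t := fun t _ => by
    have : HasDerivAt (fun t => Real.exp (-x * t)) (Real.exp (-x * t) * -x) t := by
      simpa using ((hasDerivAt_id t).const_mul (-x)).exp
    exact (this.const_sub 1).congr_deriv (by ring)
  have hv : ∀ t ∈ Ioi (0 : ℝ), HasDerivAt (fun t : ℝ => -α⁻¹ * t ^ (-α)) (t ^ (-1 - α)) t :=
    fun t ht => by
      refine ((Real.hasDerivAt_rpow_const (Or.inl (ne_of_gt ht))).const_mul (-α⁻¹)).congr_deriv ?_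
      rw [← mul_assoc, show -α - 1 = -1 - α by ring]
      field_simp
  have hi := integrableOn_rpow_mul_exp (b := 1 - α) (by linarith) hx
  have hlow : Tendsto ((fun t => 1 - Real.exp (-x * t)) * fun t : ℝ => -α⁻¹ * t ^ (-α))
      (𝓝[>] 0) (𝓝 0) := by
    have hb : Tendsto (fun t : ℝ => x * α⁻¹ * t ^ (1 - α)) (𝓝[>] 0) (𝓝 0) := by
      have := (Real.continuousAt_rpow_const 0 (1 - α) (Or.inr (by linarith))).tendsto.const_mul
        (x * α⁻¹)
      rw [Real.zero_rpow (by linarith), mul_zero] at this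
      exact this.mono_left nhdsWithin_le_nhds
    refine squeeze_zero_norm' ?_ hb
    filter_upwards [self_mem_nhdsWithin] with t (ht : 0 < t)
    have h2 : 0 ≤ 1 - Real.exp (-x * t) := by
      have := Real.exp_le_one_iff.2 (show -x * t ≤ 0 by nlinarith)
      linarith
    rw [Pi.mul_apply, neg_mul α⁻¹, mul_neg, norm_neg, Real.norm_of_nonneg (by positivity)]
    calc (1 - Real.exp (-x * t)) * (α⁻¹ * t ^ (-α)) ≤ (x * t) * (α⁻¹ * t ^ (-α)) := by
          gcongr
          rw [neg_mul]
          exact one_sub_exp_neg_le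
      _ = x * α⁻¹ * (t ^ (1 : ℝ) * t ^ (-α)) := by rw [Real.rpow_one]; ring
      _ = _ := by rw [← Real.rpow_add ht, ← sub_eq_add_neg]
  have hhigh : Tendsto ((fun t => 1 - Real.exp (-x * t)) * fun t : ℝ => -α⁻¹ * t ^ (-α))
      atTop (𝓝 0) := by
    have hb : Tendsto (fun t : ℝ => α⁻¹ * t ^ (-α)) atTop (𝓝 0) := by
      simpa using (tendsto_rpow_neg_atTop h0).const_mul α⁻¹
    refine squeeze_zero_norm' ?_ hb
    filter_upwards [eventually_gt_atTop 0] with t ht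
    have h2 : 0 ≤ 1 - Real.exp (-x * t) := by
      have := Real.exp_le_one_iff.2 (show -x * t ≤ 0 by nlinarith)
      linarith
    rw [Pi.mul_apply, neg_mul α⁻¹, mul_neg, norm_neg, Real.norm_of_nonneg (by positivity)]
    exact mul_le_of_le_one_left (by positivity) (by linarith [Real.exp_pos (-x * t)])
  have heq : ((fun t => x * Real.exp (-x * t)) * fun t : ℝ => -α⁻¹ * t ^ (-α)) =
      fun t => (-(x * α⁻¹)) * (t ^ (1 - α - 1) * Real.exp (-(x * t))) := by
    funext t
    simp only [Pi.mul_apply, neg_mul, show 1 - α - 1 = -α by ring]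
    ring
  have key := integral_Ioi_mul_deriv_eq_deriv_mul hu hv
    (integrableOn_one_sub_exp_mul_rpow h0 h1 hx) (by rw [heq]; exact hi.const_mul _) hlow hhigh
  have h3 : ∫ t in Ioi (0 : ℝ), x * Real.exp (-x * t) * (-α⁻¹ * t ^ (-α)) =
      -(x * α⁻¹) * ((1 / x) ^ (1 - α) * Real.Gamma (1 - α)) := by
    rw [← Real.integral_rpow_mul_exp_neg_mul_Ioi (by linarith) hx, ← integral_const_mul]
    exact congrArg (fun f => ∫ t in Ioi (0 : ℝ), f t) heq
  rw [key, h3, one_div, Real.inv_rpow hx.le, ← Real.rpow_neg hx.le,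
    show 1 - α = -α + 1 by ring, Real.Gamma_add_one (by linarith), neg_add, neg_neg,
    Real.rpow_add hx, Real.rpow_neg_one]
  field_simp
  ring

end

/-! ### The shifted Bernstein function: smoothness, expansion at infinity, lower bound. -/

section

/-- The remainder after `N` terms in the expansion of `m` at `0`. -/
def levyRem (m : ℝ → ℝ) (α : ℝ) (p : ℕ → ℝ) (N : ℕ) (t : ℝ) : ℝ :=
  m t - ∑ k ∈ Finset.range N, p k * t ^ (-1 - α + k)

/-- A smooth function on `ℝ` that equals the Bernstein function minus `m̄(0,∞)` for `x ≥ 0`. -/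
def levySymbol (m : ℝ → ℝ) (α : ℝ) (p : ℕ → ℝ) (x : ℝ) : ℝ :=
  (∫ t in Ioi (0 : ℝ), (1 - dampedExp (x * t)) * m t) - mBar m (p 0) α

theorem levyRem_eq_add (m : ℝ → ℝ) (α : ℝ) (p : ℕ → ℝ) (N : ℕ) (t : ℝ) :
    levyRem m α p N t = levyRem m α p (N + 1) t + p N * t ^ (-1 - α + N) := by
  rw [levyRem, levyRem, Finset.sum_range_succ]; ring

theorem levySymbol_of_nonneg (m : ℝ → ℝ) (α : ℝ) (p : ℕ → ℝ) {x : ℝ} (hx : 0 ≤ x) :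
    levySymbol m α p x = bernstein m x - mBar m (p 0) α := by
  rw [levySymbol, bernstein]
  congr 1
  refine setIntegral_congr_fun measurableSet_Ioi fun t (ht : 0 < t) => ?_
  simp only [dampedExp_of_nonneg (by positivity : 0 ≤ x * t), neg_mul]

namespace LevyHypothesis

variable {m : ℝ → ℝ} {α : ℝ} {p : ℕ → ℝ}

theorem meas (hm : LevyHypothesis m α p) :
    AEStronglyMeasurable m (volume.restrict (Ioi 0)) :=
  hm.locallyIntegrable.aestronglyMeasurable

theorem continuousOn_sum (α : ℝ) (p : ℕ → ℝ) (N : ℕ) :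
    ContinuousOn (fun t : ℝ => ∑ k ∈ Finset.range N, p k * t ^ (-1 - α + k)) (Ioi 0) := by
  refine continuousOn_finsetSum _ fun k _ => continuousOn_const.mul ?_
  exact continuousOn_id.rpow_const fun t ht => Or.inl (ne_of_gt ht)

theorem meas_levyRem (hm : LevyHypothesis m α p) (N : ℕ) :
    AEStronglyMeasurable (levyRem m α p N) (volume.restrict (Ioi 0)) :=
  hm.meas.sub ((continuousOn_sum α p N).aestronglyMeasurable measurableSet_Ioi)

/-- Near 0 the hypothesis at index N controls the remainder after N + 1 terms, and adding back the
term p_N t^{-1-α+N} turns o into O. For t > 1 the rapid decay of m is applied at the matching power,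
and the subtracted powers with k < N are smaller than t^{-1-α+N}. In between, `g` is the remainder
itself, integrable by local integrability of m. -/
theorem exists_levyRem_le (hm : LevyHypothesis m α p) (N : ℕ) :
    ∃ (C δ : ℝ) (g : ℝ → ℝ), 0 ≤ C ∧ 0 < δ ∧ IntegrableOn g (Ioi 0) ∧ (∀ t, 0 ≤ g t) ∧
      (∀ t, t ∉ Icc δ 1 → g t = 0) ∧
      ∀ᵐ t ∂(volume.restrict (Ioi (0 : ℝ))), |levyRem m α p N t| ≤ C * t ^ (N - α - 1) + g t := by
  have he : ((N : ℝ) - α - 1) = -1 - α + N := by ring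
  rw [he]
  obtain ⟨δ, hδ, hsmall⟩ : ∃ δ > 0, ∀ t ∈ Ioo 0 δ,
      |levyRem m α p N t| ≤ (1 + |p N|) * t ^ (-1 - α + N) := by
    have h := (hm.expansion.2.2 N).eventually (Metric.ball_mem_nhds 0 one_pos)
    obtain ⟨δ, hδ, h⟩ := mem_nhdsGT_iff_exists_Ioo_subset.1 h
    refine ⟨δ, hδ, fun t ht => ?_⟩
    have h1 := h ht
    have ht0 : 0 < t := ht.1
    simp only [mem_ofPred_eq, dist_zero_right, Real.norm_eq_abs, abs_mul] at h1
    change |t ^ (-(-1 - α + (N : ℝ)))| * |levyRem m α p (N + 1) t| < 1 at h1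
    rw [abs_of_pos (by positivity), Real.rpow_neg ht0.le, inv_mul_lt_iff₀ (by positivity),
      mul_one] at h1
    rw [levyRem_eq_add]
    refine (abs_add_le _ _).trans ?_
    rw [abs_mul, abs_of_pos (by positivity : 0 < t ^ (-1 - α + (N : ℝ)))]
    linarith
  obtain ⟨C, hC⟩ := hm.rapidDecay (-(-1 - α + N))
  have hlarge : ∀ᵐ t ∂(volume.restrict (Ioi (0 : ℝ))), 1 < t →
      |levyRem m α p N t| ≤ (|C| + ∑ k ∈ Finset.range N, |p k|) * t ^ (-1 - α + N) := by
    rw [ae_restrict_iff' measurableSet_Ioi] at hC ⊢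
    filter_upwards [hC] with t ht _ ht1
    have ht0 : (0 : ℝ) < t := one_pos.trans ht1
    have h1 := (ht ht1).trans (le_abs_self C)
    rw [abs_mul, abs_of_pos (by positivity : 0 < t ^ (-(-1 - α + (N : ℝ)))), Real.rpow_neg ht0.le,
      ← div_eq_mul_inv, div_le_iff₀ (by positivity)] at h1
    rw [levyRem, add_mul, Finset.sum_mul]
    refine (abs_sub _ _).trans (add_le_add h1 ((Finset.abs_sum_le_sum_abs _ _).trans
      (Finset.sum_le_sum fun k hk => ?_)))
    rw [abs_mul, abs_of_pos (by positivity : 0 < t ^ (-1 - α + (k : ℝ)))]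
    have hk' : (k : ℝ) ≤ N := by exact_mod_cast (Finset.mem_range.1 hk).le
    gcongr
    exact ht1.le
  set B := (1 + |p N|) + (|C| + ∑ k ∈ Finset.range N, |p k|) with hB
  have hS : 0 ≤ ∑ k ∈ Finset.range N, |p k| := Finset.sum_nonneg fun _ _ => abs_nonneg _
  have hsub : Icc δ 1 ⊆ Ioi (0 : ℝ) := fun t ht => hδ.trans_le ht.1
  have hint : IntegrableOn (levyRem m α p N) (Icc δ 1) := by
    refine Integrable.sub (hm.locallyIntegrable.integrableOn_compact_subset hsub isCompact_Icc) ?_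
    exact ((continuousOn_sum α p N).mono hsub).integrableOn_compact isCompact_Icc
  refine ⟨B, δ, (Icc δ 1).indicator fun t => |levyRem m α p N t|, by positivity, hδ,
    ((integrable_indicator_iff measurableSet_Icc).2 hint.abs).integrableOn,
    fun t => indicator_nonneg (fun _ _ => abs_nonneg _) t,
    fun t ht => indicator_of_notMem ht _, ?_⟩
  filter_upwards [hlarge, ae_restrict_mem measurableSet_Ioi] with t ht (ht0 : 0 < t)
  have htp : 0 < t ^ (-1 - α + (N : ℝ)) := by positivity
  by_cases hts : t ∈ Icc δ 1
  · rw [indicator_of_mem hts]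
    have : 0 ≤ B * t ^ (-1 - α + (N : ℝ)) := by positivity
    linarith
  · rw [indicator_of_notMem hts, add_zero]
    rcases lt_or_ge t δ with h | h
    · refine (hsmall t ⟨ht0, h⟩).trans (mul_le_mul_of_nonneg_right ?_ htp.le)
      rw [hB]; linarith [abs_nonneg C]
    · have h1 : 1 < t := by
        by_contra h2; exact hts ⟨h, not_lt.1 h2⟩
      refine (ht h1).trans (mul_le_mul_of_nonneg_right ?_ htp.le)
      rw [hB]; linarith [abs_nonneg (p N)]

theorem hasPowerBound (hm : LevyHypothesis m α p) {N : ℕ} (hN : 1 ≤ N) :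
    HasPowerBound (levyRem m α p N) (N - α) where
  pos := by
    have : (1 : ℝ) ≤ N := by exact_mod_cast hN
    linarith [hm.alpha_lt_one]
  meas := hm.meas_levyRem N
  bound := hm.exists_levyRem_le N

theorem integrableOn_pow_mul (hm : LevyHypothesis m α p) {j : ℕ} (hj : 1 ≤ j) :
    IntegrableOn (fun t => t ^ j * m t) (Ioi 0) := by
  have hmeas : AEStronglyMeasurable (fun t => t ^ j * m t) (volume.restrict (Ioi 0)) :=
    (Continuous.aestronglyMeasurable (by fun_prop)).mul hm.meas
  have hj' : (1 : ℝ) ≤ j := by exact_mod_cast hj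
  rw [← Ioc_union_Ioi_eq_Ioi zero_le_one, integrableOn_union]
  constructor
  -- With no term subtracted this bounds m itself by t^{-1-α}; the factor t^j with j ≥ 1 restores
  -- integrability at 0.
  · obtain ⟨C, δ, g, hC, hδ, hg, hg0, hgs, hq⟩ := hm.exists_levyRem_le 0
    have hint : IntegrableOn (fun t : ℝ => t ^ (j - α - 1)) (Ioc 0 1) :=
      (intervalIntegrable_iff_integrableOn_Ioc_of_le zero_le_one).1
        (intervalIntegral.intervalIntegrable_rpow' (by linarith [hm.alpha_lt_one]))
    refine Integrable.mono' ((hint.const_mul C).add (hg.mono_set Ioc_subset_Ioi_self))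
      (hmeas.mono_set Ioc_subset_Ioi_self) ?_
    filter_upwards [ae_mono (Measure.restrict_mono Ioc_subset_Ioi_self le_rfl) hq,
      ae_restrict_mem measurableSet_Ioc] with t ht hts
    have ht0 : 0 < t := hts.1
    simp only [levyRem, Finset.range_zero, Finset.sum_empty, sub_zero, Nat.cast_zero,
      zero_sub] at ht
    rw [norm_mul, norm_pow, Real.norm_eq_abs, Real.norm_eq_abs, abs_of_pos ht0]
    have h1 : t ^ j ≤ 1 := pow_le_one₀ ht0.le hts.2
    calc t ^ j * |m t| ≤ t ^ j * (C * t ^ (-α - 1) + g t) := by gcongr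
      _ = C * (t ^ j * t ^ (-α - 1)) + t ^ j * g t := by ring
      _ ≤ C * (t ^ j * t ^ (-α - 1)) + 1 * g t := by
          have := hg0 t
          gcongr
      _ = _ := by
          rw [← Real.rpow_natCast, ← Real.rpow_add ht0, one_mul, Pi.add_apply]
          congr 3; ring
  -- The two extra powers leave t^{-2}, integrable at infinity.
  · obtain ⟨C, hC⟩ := hm.rapidDecay (j + 2)
    refine Integrable.mono' ((integrableOn_Ioi_rpow_of_lt (show (-2 : ℝ) < -1 by norm_num)
      one_pos).const_mul C) (hmeas.mono_set (Ioi_subset_Ioi zero_le_one)) ?_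
    filter_upwards [hC, ae_restrict_mem measurableSet_Ioi] with t ht (ht1 : 1 < t)
    have ht0 : 0 < t := one_pos.trans ht1
    rw [Real.rpow_add ht0, Real.rpow_natCast] at ht
    rw [Real.rpow_neg ht0.le, ← div_eq_mul_inv, le_div_iff₀ (by positivity), Real.norm_eq_abs]
    calc |t ^ j * m t| * t ^ (2 : ℝ) = |m t * (t ^ j * t ^ (2 : ℝ))| := by
          rw [abs_mul, abs_mul (m t), abs_mul (t ^ j),
            abs_of_pos (by positivity : 0 < t ^ (2 : ℝ))]
          ring
      _ ≤ C := ht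

/-- The integral of a non-integrable function is 0 by convention, so m̄(0,∞) < 0 already forces
convergence. -/
theorem integrableOn_levyRem_one (hm : LevyHypothesis m α p) :
    IntegrableOn (levyRem m α p 1) (Ioi 0) := by
  have h := hm.mBar_neg
  have he : levyRem m α p 1 = fun t => m t - p 0 * t ^ (-1 - α) := by
    funext t; simp [levyRem]
  rw [he]
  by_contra hn
  rw [mBar, integral_undef hn] at h
  exact lt_irrefl _ h

theorem mBar_eq (m : ℝ → ℝ) (α : ℝ) (p : ℕ → ℝ) :
    mBar m (p 0) α = ∫ t in Ioi (0 : ℝ), levyRem m α p 1 t := by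
  simp [mBar, levyRem]

/-- Every derivative can be taken under the integral: the j-th integrand is dominated by a constant
times t^j |m(t)|, integrable for j ≥ 1. With e^{-xt} in place of `dampedExp` this would fail for x <
0. -/
theorem contDiff_levySymbol (hm : LevyHypothesis m α p) : ContDiff ℝ ∞ (levySymbol m α p) := by
  choose M hM0 hM using exists_abs_iteratedDeriv_dampedExp_le
  obtain ⟨K, hK0, hK⟩ := exists_abs_one_sub_dampedExp_le
  have hd : ∀ j s, HasDerivAt (iteratedDeriv j dampedExp) (iteratedDeriv (j + 1) dampedExp s) s := by
    intro j s
    rw [iteratedDeriv_succ]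
    exact ((contDiff_dampedExp.differentiable_iteratedDeriv j
      (by exact_mod_cast WithTop.coe_lt_top _)) s).hasDerivAt
  have hcont : ∀ j, Continuous (iteratedDeriv j dampedExp) := fun j =>
    contDiff_dampedExp.continuous_iteratedDeriv j (by exact_mod_cast le_top)
  have hmeas : ∀ (j : ℕ) (x : ℝ), AEStronglyMeasurable
      (fun t => iteratedDeriv j dampedExp (x * t) * (t ^ j * m t)) (volume.restrict (Ioi 0)) :=
    fun j x => (((hcont j).comp (continuous_const_mul x)).aestronglyMeasurable).mul
      ((Continuous.aestronglyMeasurable (by fun_prop)).mul hm.meas)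
  have hbound : ∀ (j : ℕ) (x t : ℝ), ‖iteratedDeriv j dampedExp (x * t) * (t ^ j * m t)‖ ≤
      M j * ‖t ^ j * m t‖ := fun j x t => by
    rw [norm_mul]
    exact mul_le_mul_of_nonneg_right (hM j _) (norm_nonneg _)
  have hinner : ∀ (j : ℕ) (t y : ℝ),
      HasDerivAt (fun y => iteratedDeriv j dampedExp (y * t) * (t ^ j * m t))
        (iteratedDeriv (j + 1) dampedExp (y * t) * (t ^ (j + 1) * m t)) y := by
    intro j t y
    have := ((hd j (y * t)).comp y ((hasDerivAt_id y).mul_const t)).mul_const (t ^ j * m t)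
    exact this.congr_deriv (by ring)
  have hzero : ∀ x, HasDerivAt (levySymbol m α p)
      (-∫ t in Ioi (0 : ℝ), iteratedDeriv 1 dampedExp (x * t) * (t ^ 1 * m t)) x := by
    intro x
    have h := (hasDerivAt_integral_of_dominated_loc_of_deriv_le (x₀ := x) (s := univ)
      (μ := volume.restrict (Ioi 0))
      (F := fun x t => (1 - dampedExp (x * t)) * m t)
      (F' := fun x t => -(iteratedDeriv 1 dampedExp (x * t) * (t ^ 1 * m t)))
      (bound := fun t => M 1 * ‖t ^ 1 * m t‖) univ_mem
      (Eventually.of_forall fun y => (Continuous.aestronglyMeasurable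
        (continuous_const.sub (contDiff_dampedExp.continuous.comp (continuous_const_mul y)))).mul
          hm.meas) ?_ (hmeas 1 x).neg
      (Eventually.of_forall fun t y _ => by rw [norm_neg]; exact hbound 1 y t)
      ((hm.integrableOn_pow_mul le_rfl).norm.const_mul _)
      (Eventually.of_forall fun t y _ => ?_)).2
    · rw [integral_neg] at h
      exact h.sub_const _
    · refine Integrable.mono' (((hm.integrableOn_pow_mul le_rfl).norm).const_mul (K * |x|))
        ((Continuous.aestronglyMeasurable
        (continuous_const.sub (contDiff_dampedExp.continuous.comp (continuous_const_mul x)))).mul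
          hm.meas) (Eventually.of_forall fun t => ?_)
      rw [norm_mul, norm_mul, pow_one, Real.norm_eq_abs, Real.norm_eq_abs, Real.norm_eq_abs]
      calc |1 - dampedExp (x * t)| * |m t| ≤ (K * |x * t|) * |m t| := by gcongr; exact hK _
        _ = _ := by rw [abs_mul]; ring
    · have h0 := hinner 0 t y
      simp only [iteratedDeriv_zero, pow_zero, one_mul, zero_add] at h0
      simpa [sub_mul] using h0.const_sub (m t)
  have hsucc : ∀ (j : ℕ) (x : ℝ), HasDerivAt
      (fun x => -∫ t in Ioi (0 : ℝ), iteratedDeriv (j + 1) dampedExp (x * t) * (t ^ (j + 1) * m t))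
      (-∫ t in Ioi (0 : ℝ), iteratedDeriv (j + 2) dampedExp (x * t) * (t ^ (j + 2) * m t)) x := by
    intro j x
    refine (hasDerivAt_integral_of_dominated_loc_of_deriv_le (x₀ := x) (s := univ)
      (μ := volume.restrict (Ioi 0))
      (F := fun x t => iteratedDeriv (j + 1) dampedExp (x * t) * (t ^ (j + 1) * m t))
      (F' := fun x t => iteratedDeriv (j + 2) dampedExp (x * t) * (t ^ (j + 2) * m t))
      (bound := fun t => M (j + 2) * ‖t ^ (j + 2) * m t‖) univ_mem
      (Eventually.of_forall fun y => hmeas _ y) ?_ (hmeas _ x)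
      (Eventually.of_forall fun t y _ => hbound _ y t)
      ((hm.integrableOn_pow_mul (by omega)).norm.const_mul _)
      (Eventually.of_forall fun t y _ => hinner _ t y)).2.neg
    exact Integrable.mono' ((hm.integrableOn_pow_mul (by omega)).norm.const_mul _) (hmeas _ x)
      (Eventually.of_forall fun t => hbound _ x t)
  -- The recursor is only a case split: entry 0 involves 1 - `dampedExp` and the constant, all later
  -- entries have one common form.
  refine contDiff_of_hasDerivAt_seq (F := fun j => Nat.rec (levySymbol m α p) (fun j _ x =>
    -∫ t in Ioi (0 : ℝ), iteratedDeriv (j + 1) dampedExp (x * t) * (t ^ (j + 1) * m t)) j)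
    (fun j x => ?_) 0
  cases j with
  | zero => exact hzero x
  | succ j => exact hsucc j x

/-- For N = 1 the integral of the remainder is m̄(0,∞) and cancels the shift. Each later step
removes one more power from the remainder by the Gamma integral, convergent because N - α > 0. -/
theorem levySymbol_eq (hm : LevyHypothesis m α p) {x : ℝ} (hx : 0 < x) {N : ℕ} (hN : 1 ≤ N) :
    levySymbol m α p x = ∑ k ∈ Finset.range N, coeffAlpha α p k * x ^ (α - k) -
      laplaceDeriv (levyRem m α p N) 0 x := by
  have h0 := hm.alpha_pos
  have h1 := hm.alpha_lt_one
  induction N, hN using Nat.le_induction with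
  | base =>
    have hi1 := hm.integrableOn_levyRem_one
    have hi2 := (hm.hasPowerBound le_rfl).integrableOn 0 hx
    have hi3 := (integrableOn_one_sub_exp_mul_rpow h0 h1 hx).const_mul (p 0)
    simp only [pow_zero, one_mul] at hi2
    have he : bernstein m x = ∫ t in Ioi (0 : ℝ), ((levyRem m α p 1 t -
        Real.exp (-x * t) * levyRem m α p 1 t) +
        p 0 * ((1 - Real.exp (-x * t)) * t ^ (-1 - α))) := by
      refine setIntegral_congr_fun measurableSet_Ioi fun t _ => ?_
      simp only [levyRem, Finset.sum_range_one, Nat.cast_zero, add_zero]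
      ring
    rw [levySymbol_of_nonneg m α p hx.le, he, integral_add (by exact hi1.sub hi2) hi3,
      integral_sub hi1 hi2, integral_const_mul, integral_one_sub_exp_mul_rpow h0 h1 hx, mBar_eq]
    simp only [laplaceDeriv, pow_zero, one_mul, Finset.sum_range_one, coeffAlpha, Nat.cast_zero,
      add_zero, sub_zero]
    ring
  | succ N hN ih =>
    have hN' : (1 : ℝ) ≤ N := by exact_mod_cast hN
    have hi := (hm.hasPowerBound (N := N + 1) (by omega)).integrableOn 0 hx
    have hi2 := (integrableOn_rpow_mul_exp (b := N - α) (by linarith) hx).const_mul (p N)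
    have he : laplaceDeriv (levyRem m α p N) 0 x = laplaceDeriv (levyRem m α p (N + 1)) 0 x +
        p N * ((1 / x) ^ (N - α) * Real.Gamma (N - α)) := by
      rw [← Real.integral_rpow_mul_exp_neg_mul_Ioi (by linarith) hx, ← integral_const_mul,
        laplaceDeriv, laplaceDeriv, ← integral_add hi hi2]
      refine setIntegral_congr_fun measurableSet_Ioi fun t _ => ?_
      simp only [levyRem_eq_add m α p N, neg_mul, show -1 - α + N = N - α - 1 by ring]
      ring
    rw [ih, he, Finset.sum_range_succ, coeffAlpha, one_div, Real.inv_rpow hx.le,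
      ← Real.rpow_neg hx.le, show -(N - α) = α - N by ring, show -α + N = N - α by ring]
    ring

theorem radialBound_levySymbol_sub {ι : Type} (hm : LevyHypothesis m α p) {N : ℕ} (hN : 1 ≤ N)
    {c : ℝ} (hc : 0 < c) (k : ℕ) : RadialBound (Ioi c) k (α - N) (fun (_ : ι) x =>
      levySymbol m α p x - ∑ k ∈ Finset.range N, coeffAlpha α p k * x ^ (α - k)) := by
  have h := (hm.hasPowerBound hN).radialBound_laplaceDeriv (ι := ι) hc k 0
  rw [Nat.cast_zero, sub_zero, neg_sub] at h
  refine (h.neg isOpen_Ioi (Ioi_subset_Ioi (by linarith))).congr isOpen_Ioi fun _ x hx => ?_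
  rw [hm.levySymbol_eq (hc.trans hx) hN]
  ring

/-- Smoothness on a bounded interval is glued to the one-term expansion on the tail. -/
theorem radialBound_levySymbol {ι : Type} (hm : LevyHypothesis m α p) (k : ℕ) :
    RadialBound (Ioi (-1 / 2)) k α (fun _ : ι => levySymbol m α p) := by
  have hU : Ioi (1 / 16) ⊆ Ioi (-1 / 2 : ℝ) := Ioi_subset_Ioi (by norm_num)
  have h1 : RadialBound (Ioo (-1 / 2) 1) k α (fun _ : ι => levySymbol m α p) :=
    RadialBound.of_contDiff (a := -1 / 2) (b := 1) (by norm_num) Ioo_subset_Icc_self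
      hm.contDiff_levySymbol
  have h2 : RadialBound (Ioi (1 / 16)) k α (fun _ : ι => levySymbol m α p) := by
    have ha := (hm.radialBound_levySymbol_sub (ι := ι) le_rfl (c := 1 / 16) (by norm_num) k).mono
      hU (r := α) (by simp)
    have hb := (RadialBound.rpow (ι := ι) (k := k) (c := 1 / 16) (by norm_num) α).const_mul
      isOpen_Ioi hU (coeffAlpha α p 0)
    refine (ha.add isOpen_Ioi hb).congr isOpen_Ioi fun _ x hx => ?_
    simp
  have h3 := h1.union Ioo_subset_Ioi_self hU h2
  refine h3.mono_set fun x hx => ?_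
  rcases lt_or_ge x 1 with h | h
  · exact Or.inl ⟨hx, h⟩
  · exact Or.inr (mem_Ioi.2 (by linarith))

/-- Γ(-α) < 0 because -αΓ(-α) = Γ(1-α) > 0. If p₀ ≤ 0, the integrand of m̄(0,∞) would be
nonnegative, against m̄ < 0. -/
theorem coeffAlpha_zero_pos (hm : LevyHypothesis m α p) : 0 < coeffAlpha α p 0 := by
  have h0 := hm.alpha_pos
  have h1 := hm.alpha_lt_one
  have hΓ : Real.Gamma (-α) < 0 := by
    have h := Real.Gamma_add_one (s := -α) (by linarith)
    have h2 := Real.Gamma_pos_of_pos (show 0 < -α + 1 by linarith)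
    nlinarith
  have hp : 0 < p 0 := by
    by_contra hp
    have hp := not_lt.1 hp
    have : 0 ≤ mBar m (p 0) α := by
      refine integral_nonneg_of_ae ?_
      filter_upwards [hm.nonneg, ae_restrict_mem measurableSet_Ioi] with t ht (ht0 : 0 < t)
      have : p 0 * t ^ (-1 - α) ≤ 0 := mul_nonpos_of_nonpos_of_nonneg hp (by positivity)
      simp only [Pi.zero_apply]
      linarith
    linarith [hm.mBar_neg]
  rw [coeffAlpha, Nat.cast_zero, add_zero]
  nlinarith

theorem le_levySymbol_of_nonneg (hm : LevyHypothesis m α p) {x : ℝ} (hx : 0 ≤ x) :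
    -mBar m (p 0) α ≤ levySymbol m α p x := by
  rw [levySymbol_of_nonneg m α p hx]
  have : 0 ≤ bernstein m x := by
    refine integral_nonneg_of_ae ?_
    filter_upwards [hm.nonneg, ae_restrict_mem measurableSet_Ioi] with t ht (ht0 : 0 < t)
    have := Real.exp_le_one_iff.2 (show -x * t ≤ 0 by nlinarith)
    exact mul_nonneg (by linarith) ht
  linarith

/-- For large x the leading term α₀ x^α dominates. For smaller x ≥ 0 the constant -m̄ > 0 is a lower
bound, since the Bernstein function is nonnegative. Continuity at 0 carries half of it to slightly
negative x. -/
theorem exists_le_levySymbol (hm : LevyHypothesis m α p) : ∃ ε c : ℝ, 0 < ε ∧ ε ≤ 1 / 2 ∧ 0 < c ∧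
    ∀ x ∈ Ioi (-ε), c * (1 + x) ^ α ≤ levySymbol m α p x := by
  have h0 := hm.alpha_pos
  have h1 := hm.alpha_lt_one
  have hm0 := hm.mBar_neg
  have hα0 := hm.coeffAlpha_zero_pos
  set μ := -mBar m (p 0) α with hμ
  have hμ0 : 0 < μ := by linarith
  obtain ⟨X, hX0, hX⟩ : ∃ X : ℝ, 0 ≤ X ∧ ∀ x ≥ X,
      coeffAlpha α p 0 / 4 * (1 + x) ^ α ≤ levySymbol m α p x := by
    obtain ⟨C, hC0, hC⟩ := (hm.radialBound_levySymbol_sub (ι := Unit) le_rfl (c := 1) one_pos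
      0).bound_nonneg (Ioi_subset_Ioi (by norm_num))
    -- Beyond this point x^α ≥ (1+x)^α/2 and the error C(1+x)^{α-1} is at most (α₀/4)(1+x)^α, which
    -- leaves α₀/2 - α₀/4 = α₀/4.
    refine ⟨max 2 (4 * C / coeffAlpha α p 0), by positivity, fun x hx => ?_⟩
    have hx2 : 2 ≤ x := (le_max_left _ _).trans hx
    have hxC : 4 * C / coeffAlpha α p 0 ≤ x := (le_max_right _ _).trans hx
    rw [div_le_iff₀ hα0] at hxC
    have h2 := hC () x (mem_Ioi.2 (by linarith))
    simp only [Finset.sum_range_one, Nat.cast_zero, sub_zero, Nat.cast_one] at h2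
    have hw : 0 < (1 + x) ^ α := by positivity
    have h3 : (1 / 2) * (1 + x) ^ α ≤ x ^ α := by
      have h4 : (1 / 2 : ℝ) ≤ (1 / 2) ^ α := by
        simpa using Real.rpow_le_rpow_of_exponent_ge (by norm_num : (0 : ℝ) < 1 / 2) (by norm_num)
          h1.le
      calc (1 / 2) * (1 + x) ^ α ≤ (1 / 2) ^ α * (1 + x) ^ α := by gcongr
        _ = ((1 / 2) * (1 + x)) ^ α := (Real.mul_rpow (by norm_num) (by positivity)).symm
        _ ≤ x ^ α := Real.rpow_le_rpow (by positivity) (by linarith) h0.le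
    have h5 : C * (1 + x) ^ (α - 1) ≤ coeffAlpha α p 0 / 4 * (1 + x) ^ α := by
      rw [Real.rpow_sub_one (by positivity), ← mul_div_assoc, div_le_iff₀ (by positivity)]
      nlinarith
    have h6 := (abs_le.1 h2).1
    nlinarith
  obtain ⟨ε, hε0, hε⟩ : ∃ ε > 0, ∀ x, |x| < ε → μ / 2 ≤ levySymbol m α p x := by
    have hcont := hm.contDiff_levySymbol.continuous.continuousAt (x := 0)
    have hlt : μ / 2 < levySymbol m α p 0 := by
      linarith [hm.le_levySymbol_of_nonneg le_rfl]
    obtain ⟨ε, hε0, hε⟩ := Metric.eventually_nhds_iff.1 (hcont.eventually (lt_mem_nhds hlt))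
    exact ⟨ε, hε0, fun x hx => (hε (by simpa using hx)).le⟩
  have hw : 1 ≤ (1 + X) ^ α := Real.one_le_rpow (by linarith) h0.le
  refine ⟨min ε (1 / 2), min (coeffAlpha α p 0 / 4) (μ / 2 / (1 + X) ^ α), by positivity,
    min_le_right _ _, by positivity, fun x hx => ?_⟩
  have hx' : -min ε (1 / 2) < x := hx
  have hx1 : 0 < 1 + x := by linarith [min_le_right ε (1 / 2)]
  rcases le_or_gt X x with hXx | hXx
  · refine (mul_le_mul_of_nonneg_right (min_le_left _ _) (by positivity)).trans (hX x hXx)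
  · have hb : μ / 2 ≤ levySymbol m α p x := by
      rcases le_or_gt 0 x with h | h
      · linarith [hm.le_levySymbol_of_nonneg h]
      · exact hε x (by rw [abs_of_neg h]; linarith [min_le_left ε (1 / 2)])
    refine le_trans ?_ hb
    calc _ ≤ μ / 2 / (1 + X) ^ α * (1 + x) ^ α :=
          mul_le_mul_of_nonneg_right (min_le_right _ _) (by positivity)
      _ ≤ μ / 2 / (1 + X) ^ α * (1 + X) ^ α := by gcongr
      _ = μ / 2 := by field_simp

end LevyHypothesis

end

/-! ### Expansion of the heat symbol in the variable x. -/

section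

/-- The terms of the heat expansion as functions of `t` and `x = |ξ|²`. -/
def heatRadial (α : ℝ) (p : ℕ → ℝ) (i : ℕ) (t x : ℝ) : ℝ :=
  Real.exp (-t * (coeffAlpha α p 0 * x ^ α)) *
    ∑ c : Composition i, (-t) ^ c.length / (c.length.factorial : ℝ) *
      (c.blocks.map fun k : ℕ => coeffAlpha α p k * x ^ (α - k)).prod

/-- Functions `Fin l → {1, …, M - 1}`. -/
def blockFuns (M l : ℕ) : Finset (Fin l → ℕ) := Fintype.piFinset fun _ => Finset.Ico 1 M

/-- The blocks of a composition of length l form a function on `Fin l` with positive values.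
Compositions of numbers below M are regrouped by length, to match the Taylor index l; length and
blocks stay below M automatically. -/
theorem sum_composition_eq_sum_blockFuns (y w : ℕ → ℝ) (M : ℕ) :
    ∑ i ∈ Finset.range M, ∑ c : Composition i, w c.length * (c.blocks.map y).prod =
      ∑ l ∈ Finset.range M, w l *
        ∑ f ∈ (blockFuns M l).filter (fun f => ∑ ν, f ν < M), ∏ ν, y (f ν) := by
  classical
  rw [Finset.sum_sigma' (Finset.range M) (fun i => (Finset.univ : Finset (Composition i)))
    (fun i c => w c.length * (c.blocks.map y).prod)]
  rw [← Finset.sum_fiberwise_of_maps_to (t := Finset.range M)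
    (g := fun s : Σ i, Composition i => s.2.length)
    (fun s hs => by
      have h1 : s.1 < M := by simpa using hs
      exact Finset.mem_range.2 (s.2.length_le.trans_lt h1))]
  refine Finset.sum_congr rfl fun l _ => ?_
  rw [Finset.mul_sum]
  symm
  refine Finset.sum_bij (fun f hf => ⟨∑ ν, f ν, ⟨List.ofFn f, ?_, by rw [List.sum_ofFn]⟩⟩)
    ?_ ?_ ?_ ?_
  · intro i hi
    rw [List.mem_ofFn] at hi
    obtain ⟨ν, rfl⟩ := hi
    have := Fintype.mem_piFinset.1 (Finset.mem_filter.1 hf).1 ν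
    exact (Finset.mem_Ico.1 this).1
  · intro f hf
    have := (Finset.mem_filter.1 hf).2
    simp [Composition.length, this]
  · intro f hf f' hf' h
    have h2 : List.ofFn f = List.ofFn f' := by
      have := congrArg (fun s : Σ i, Composition i => s.2.blocks) h
      simpa using this
    exact List.ofFn_injective h2
  · rintro ⟨i, c⟩ hs
    rw [Finset.mem_filter, Finset.mem_sigma, Finset.mem_range] at hs
    obtain ⟨⟨hi, _⟩, rfl⟩ := hs
    have hsum : ∑ ν, c.blocksFun ν = i := c.sum_blocksFun
    refine ⟨c.blocksFun, Finset.mem_filter.2 ⟨Fintype.mem_piFinset.2 fun ν => ?_, ?_⟩, ?_⟩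
    · exact Finset.mem_Ico.2 ⟨c.one_le_blocksFun ν, (c.blocksFun_le ν).trans_lt hi⟩
    · rw [hsum]; exact hi
    · exact Composition.sigma_eq_iff_blocks_eq.2 c.ofFn_blocksFun
  · intro f hf
    simp [Composition.length, List.map_ofFn, List.prod_ofFn]

theorem pow_sum_eq_sum_blockFuns (y : ℕ → ℝ) (M l : ℕ) :
    (∑ k ∈ Finset.Ico 1 M, y k) ^ l =
      ∑ f ∈ (blockFuns M l).filter (fun f => ∑ ν, f ν < M), ∏ ν, y (f ν) +
      ∑ f ∈ (blockFuns M l).filter (fun f => ¬ ∑ ν, f ν < M), ∏ ν, y (f ν) := by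
  rw [Finset.sum_filter_add_sum_filter_not, blockFuns, ← Finset.prod_univ_sum]
  simp

section

variable {ι : Type} {m : ℝ → ℝ} {α : ℝ} {p : ℕ → ℝ}

/-- The geometric sum identity factors out φ - ψ, leaving l - 1 factors of order s. -/
theorem radialBound_pow_sub_pow {U : Set ℝ} (hU : IsOpen U) (hU' : U ⊆ Ioi (-1 / 2)) {k : ℕ}
    {s r : ℝ} {φ ψ : ι → ℝ → ℝ} (hφ : RadialBound U k s φ) (hψ : RadialBound U k s ψ)
    (h : RadialBound U k r fun i x => φ i x - ψ i x) (l : ℕ) :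
    RadialBound U k (r - s + l * s) fun i x => φ i x ^ l - ψ i x ^ l := by
  cases l with
  | zero => simpa using RadialBound.zero
  | succ l =>
    have h1 : RadialBound U k (l * s)
        (fun i x => ∑ j ∈ Finset.range (l + 1), φ i x ^ j * ψ i x ^ (l + 1 - 1 - j)) := by
      refine RadialBound.finset_sum hU fun j hj => ?_
      have hj' : j ≤ l := Nat.lt_succ_iff.1 (Finset.mem_range.1 hj)
      have := (hφ.pow hU hU' j).mul hU hU' (hψ.pow hU hU' (l + 1 - 1 - j))
      rw [Nat.add_sub_cancel, Nat.cast_sub hj', ← add_mul, add_sub_cancel] at this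
      exact this
    have h2 := h.mul hU hU' h1
    rw [show r - s + ((l + 1 : ℕ) : ℝ) * s = r + l * s by push_cast; ring]
    refine h2.congr hU fun i x _ => ?_
    exact ((Commute.all _ _).mul_geom_sum₂ _).symm

namespace LevyHypothesis

theorem exists_le_rpow (hm : LevyHypothesis m α p) : ∃ c : ℝ, 0 < c ∧
    (∀ x ∈ Ioi (1 / 16 : ℝ), c * (1 + x) ^ α ≤ coeffAlpha α p 0 * x ^ α) ∧
    ∀ x ∈ Ioi (1 / 16 : ℝ), c * (1 + x) ^ α ≤ levySymbol m α p x := by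
  have h0 := hm.alpha_pos
  have hα := hm.coeffAlpha_zero_pos
  obtain ⟨ε, c, hε, -, hc, h⟩ := hm.exists_le_levySymbol
  -- For x > 1/16 one has x ≥ (1 + x)/17.
  refine ⟨min c (coeffAlpha α p 0 * (1 / 17) ^ α), by positivity, fun x hx => ?_, fun x hx => ?_⟩
  · have hx' : (1 / 16 : ℝ) < x := hx
    calc _ ≤ coeffAlpha α p 0 * (1 / 17) ^ α * (1 + x) ^ α :=
          mul_le_mul_of_nonneg_right (min_le_right _ _) (Real.rpow_nonneg (by linarith) _)
      _ = coeffAlpha α p 0 * ((1 / 17) * (1 + x)) ^ α := by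
          rw [Real.mul_rpow (by norm_num) (by linarith), mul_assoc]
      _ ≤ _ := by
          gcongr
          linarith
  · have hx' : (1 / 16 : ℝ) < x := hx
    exact (mul_le_mul_of_nonneg_right (min_le_left _ _) (Real.rpow_nonneg (by linarith) _)).trans
      (h x (mem_Ioi.2 (by linarith)))

theorem radialBound_pow_mul_exp_leading (hm : LevyHypothesis m α p) {t : ι → ℝ}
    (ht : ∀ i, 0 ≤ t i) (k l : ℕ) : RadialBound (Ioi (1 / 16)) k (-(l * α))
      (fun i x => t i ^ l * Real.exp (-t i * (coeffAlpha α p 0 * x ^ α))) := by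
  have hU' : Ioi (1 / 16) ⊆ Ioi (-1 / 2 : ℝ) := Ioi_subset_Ioi (by norm_num)
  obtain ⟨c, hc, h1, h2⟩ := hm.exists_le_rpow
  have := RadialBound.exp_mul_expRem isOpen_Ioi hU' hc ht
    (a := fun x => coeffAlpha α p 0 * x ^ α) (R := fun _ => 0)
    (fun k => (RadialBound.rpow (by norm_num) α).const_mul isOpen_Ioi hU' _)
    (fun k => RadialBound.zero) h1 (by simpa using h1) k l 0
  simpa [expRem] using this

/-- After Taylor expansion of e^{-tR} to order M there are three errors: replacing R by the partial
sum P of its expansion, the products in P^l of total weight at least M, and the Taylor remainder.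
Each has order -M in x uniformly in t, because t^l e^{-ta} has order -lα. -/
theorem radialBound_exp_sub_sum (hm : LevyHypothesis m α p) {t : ι → ℝ} (ht : ∀ i, 0 ≤ t i)
    (k M : ℕ) : RadialBound (Ioi (1 / 16)) k (-M) (fun i x =>
      Real.exp (-t i * levySymbol m α p x) - ∑ i' ∈ Finset.range M, heatRadial α p i' (t i) x) := by
  have hU' : Ioi (1 / 16) ⊆ Ioi (-1 / 2 : ℝ) := Ioi_subset_Ioi (by norm_num)
  have hU : IsOpen (Ioi (1 / 16 : ℝ)) := isOpen_Ioi
  have hc0 : (0 : ℝ) < 1 / 16 := by norm_num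
  obtain ⟨c, hc, hca, hcσ⟩ := hm.exists_le_rpow
  set a : ℝ → ℝ := fun x => coeffAlpha α p 0 * x ^ α with ha
  set R : ℝ → ℝ := fun x => levySymbol m α p x - a x with hR
  set y : ℕ → ℝ → ℝ := fun j x => coeffAlpha α p j * x ^ (α - j) with hy
  set P : ℝ → ℝ := fun x => ∑ j ∈ Finset.Ico 1 M, y j x with hP
  have hyB : ∀ k j : ℕ, RadialBound (Ioi (1 / 16)) k (α - j) (fun _ : ι => y j) := fun k j =>
    (RadialBound.rpow hc0 _).const_mul hU hU' _
  have haB : ∀ k, RadialBound (Ioi (1 / 16)) k α (fun _ : ι => a) := fun k =>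
    (RadialBound.rpow hc0 _).const_mul hU hU' _
  have hRB : ∀ k, RadialBound (Ioi (1 / 16)) k (α - 1) (fun _ : ι => R) := fun k => by
    have := hm.radialBound_levySymbol_sub (ι := ι) le_rfl hc0 k
    simpa [hR, ha] using this
  have hPB : ∀ k, RadialBound (Ioi (1 / 16)) k (α - 1) (fun _ : ι => P) := fun k =>
    RadialBound.finset_sum hU fun j hj => (hyB k j).mono hU' (by
      have : (1 : ℝ) ≤ j := by exact_mod_cast (Finset.mem_Ico.1 hj).1
      linarith)
  have hF : ∀ l : ℕ, RadialBound (Ioi (1 / 16)) k (-(l * α))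
      (fun i x => t i ^ l * Real.exp (-t i * a x)) :=
    hm.radialBound_pow_mul_exp_leading ht k
  -- Taylor remainder: t^M times the exponentials has order -Mα, and the factor R^M, of order M(α -
  -- 1), brings this to -M.
  have hG := RadialBound.exp_mul_expRem hU hU' hc ht haB
    (fun k => (hRB k).mono hU' (by linarith)) hca (fun x hx => by
      have := hcσ x hx
      simp only [hR]; linarith) k M M
  have h1 : ∀ l ∈ Finset.range M, RadialBound (Ioi (1 / 16)) k (-M)
      (fun i x => ((-1) ^ l / (l.factorial : ℝ)) * ((t i ^ l * Real.exp (-t i * a x)) *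
        ((R x ^ l - P x ^ l) +
          ∑ f ∈ (blockFuns M l).filter (fun f => ¬ ∑ ν, f ν < M), ∏ ν, y (f ν) x))) := by
    intro l hl
    have hM : 1 ≤ M := by
      have := Finset.mem_range.1 hl
      omega
    refine RadialBound.const_mul hU hU' _ ?_
    have hdiff : RadialBound (Ioi (1 / 16)) k (α - M) (fun (_ : ι) x => R x - P x) := by
      refine (hm.radialBound_levySymbol_sub (ι := ι) hM hc0 k).congr hU fun _ x _ => ?_
      rw [Finset.range_eq_Ico, Finset.sum_eq_sum_Ico_succ_bot (by omega)]
      simp only [hR, hP, ha, hy, Nat.cast_zero, sub_zero, zero_add]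
      ring
    have h2 : RadialBound (Ioi (1 / 16)) k (l * α - M) (fun (_ : ι) x => R x ^ l - P x ^ l) := by
      rcases Nat.eq_zero_or_pos l with rfl | hl0
      · simpa using RadialBound.zero
      · have hl1 : (1 : ℝ) ≤ l := by exact_mod_cast hl0
        -- The order obtained is lα - M - (l - 1), at least as good as needed since l ≥ 1; for l = 0
        -- the difference vanishes.
        exact (radialBound_pow_sub_pow hU hU' (hRB k) (hPB k) hdiff l).mono hU' (by linarith)
    have h3 : RadialBound (Ioi (1 / 16)) k (l * α - M) (fun (_ : ι) x =>
        ∑ f ∈ (blockFuns M l).filter (fun f => ¬ ∑ ν, f ν < M), ∏ ν, y (f ν) x) := by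
      refine RadialBound.finset_sum hU fun f hf => ?_
      refine (RadialBound.finset_prod hU hU' fun ν _ => hyB k (f ν)).mono hU' ?_
      -- A product of l factors has order lα minus its total weight, and the weight is at least M
      -- here.
      have hMf : (M : ℝ) ≤ ∑ ν, (f ν : ℝ) := by
        exact_mod_cast not_lt.1 (Finset.mem_filter.1 hf).2
      rw [Finset.sum_sub_distrib]
      simp only [Finset.sum_const, Finset.card_univ, Fintype.card_fin, nsmul_eq_mul]
      linarith
    have h4 := (hF l).mul hU hU' (h2.add hU h3)
    rwa [show -(l * α) + (l * α - M) = -(M : ℝ) by ring] at h4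
  have h2 : RadialBound (Ioi (1 / 16)) k (-M) (fun i x => (-1) ^ M * (R x ^ M *
      (t i ^ M * (Real.exp (-t i * a x) * expRem M (-t i * R x))))) := by
    have := (((hRB k).pow hU hU' M).mul hU hU' hG).const_mul hU hU' ((-1) ^ M)
    rwa [show (M : ℝ) * (α - 1) + -(M * α) = -M by ring] at this
  refine ((RadialBound.finset_sum hU h1).add hU h2).congr hU fun i x _ => ?_
  have e1 : Real.exp (-t i * levySymbol m α p x) =
      Real.exp (-t i * a x) * Real.exp (-t i * R x) := by
    rw [← Real.exp_add]; congr 1; simp only [hR]; ring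
  have e2 : ∑ i' ∈ Finset.range M, heatRadial α p i' (t i) x =
      Real.exp (-t i * a x) * ∑ l ∈ Finset.range M, ((-t i) ^ l / (l.factorial : ℝ)) *
        ∑ f ∈ (blockFuns M l).filter (fun f => ∑ ν, f ν < M), ∏ ν, y (f ν) x := by
    rw [← sum_composition_eq_sum_blockFuns (fun j => y j x)
      (fun l => (-t i) ^ l / (l.factorial : ℝ)) M, Finset.mul_sum]
    rfl
  rw [e1, e2, exp_eq_sum_add_expRem M (-t i * R x), mul_add, Finset.mul_sum, Finset.mul_sum,
    add_sub_right_comm, ← Finset.sum_sub_distrib]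
  congr 1
  · refine Finset.sum_congr rfl fun l _ => ?_
    have := pow_sum_eq_sum_blockFuns (fun j => y j x) M l
    rw [show P x ^ l = _ from this, mul_pow, neg_pow (t i)]
    ring
  · rw [mul_pow, neg_pow (t i)]
    ring

end LevyHypothesis

end

end

section

variable {n : ℕ} {ι : Type} {m : ℝ → ℝ} {α : ℝ} {p : ℕ → ℝ}

/-! ### Cutoffs -/

/-- A smooth function that vanishes for `x ≤ 1/8` and equals `1` for `x ≥ 1/4`. -/
def radialCutoff (x : ℝ) : ℝ := Real.smoothTransition (8 * x - 1)

theorem radialBound_radialCutoff (k : ℕ) :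
    RadialBound (Ioi (-1 / 2)) k 0 (fun _ : ι => radialCutoff) := by
  have h1 : RadialBound (Ioo (-1 / 2) 1) k 0 (fun _ : ι => radialCutoff) :=
    RadialBound.of_contDiff (a := -1 / 2) (b := 1) (by norm_num) Ioo_subset_Icc_self
      (Real.smoothTransition.contDiff.comp ((contDiff_const.mul contDiff_id).sub contDiff_const))
  have h2 : RadialBound (Ioi (1 / 4)) k 0 (fun _ : ι => radialCutoff) :=
    (RadialBound.const 1).congr isOpen_Ioi fun _ x (hx : 1 / 4 < x) =>
      Real.smoothTransition.one_of_one_le (by linarith)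
  refine (h1.union Ioo_subset_Ioi_self (Ioi_subset_Ioi (by norm_num)) h2).mono_set fun x hx => ?_
  rcases lt_or_ge x 1 with h | h
  · exact Or.inl ⟨hx, h⟩
  · exact Or.inr (mem_Ioi.2 (by linarith))

theorem RadialBound.radialCutoff_mul {k : ℕ} {s : ℝ} {φ : ι → ℝ → ℝ}
    (h : RadialBound (Ioi (1 / 16)) k s φ) :
    RadialBound (Ioi (-1 / 2)) k s (fun i x => radialCutoff x * φ i x) := by
  have hU : Ioi (1 / 16) ⊆ Ioi (-1 / 2 : ℝ) := Ioi_subset_Ioi (by norm_num)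
  have h1 : RadialBound (Ioo (-1 / 2) (1 / 8)) k s (fun i x => radialCutoff x * φ i x) := by
    refine RadialBound.zero.congr isOpen_Ioo fun _ x hx => ?_
    rw [radialCutoff, Real.smoothTransition.zero_of_nonpos (by linarith [hx.2]), zero_mul]
  have h2 := ((radialBound_radialCutoff (ι := ι) k).mono_set hU).mul isOpen_Ioi hU h
  rw [zero_add] at h2
  refine (h1.union Ioo_subset_Ioi_self hU h2).mono_set fun x hx => ?_
  rcases lt_or_ge x (1 / 8) with h | h
  · exact Or.inl ⟨hx, h⟩
  · exact Or.inr (mem_Ioi.2 (by linarith))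

theorem IsCutoff.isMultiplierFamily_one_sub {χ : E n → ℂ} (hχ : IsCutoff χ) (r : ℝ) :
    IsMultiplierFamily r (fun (_ : ι) ξ => 1 - χ ξ) := by
  refine IsMultiplierFamily.of_hasCompactSupport (contDiff_const.sub hχ.1) ?_ r
  refine HasCompactSupport.intro (isCompact_closedBall (0 : E n) 1) fun ξ hξ => ?_
  rw [hχ.2.1 ξ (by simpa using (lt_of_not_ge fun h => hξ (by simpa using h)).le), sub_self]

theorem isMultiplierFamily_one : IsMultiplierFamily 0 (fun (_ : ι) (_ : E n) => (1 : ℂ)) := by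
  have := RadialBound.isMultiplierFamily (n := n) (ε := 1 / 2) (by norm_num) le_rfl
    (fun k => RadialBound.const (ι := ι) (k := k) 1)
  simpa using this

theorem IsMultiplierFamily.neg {r : ℝ} {g : ι → E n → ℂ} (h : IsMultiplierFamily r g) :
    IsMultiplierFamily r (fun i ξ => -g i ξ) := by
  refine ⟨fun i => (h.1 i).neg, fun k => ?_⟩
  obtain ⟨C, hC0, hC⟩ := h.2 k
  refine ⟨C, hC0, fun i ξ => ?_⟩
  have := iteratedFDeriv_neg_apply (𝕜 := ℝ) (i := k) (f := g i) (x := ξ)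
  change ‖iteratedFDeriv ℝ k (-(g i)) ξ‖ ≤ _
  rw [this, norm_neg]
  exact hC i ξ

theorem IsCutoff.isMultiplierFamily {χ : E n → ℂ} (hχ : IsCutoff χ) :
    IsMultiplierFamily 0 (fun (_ : ι) => χ) := by
  simpa using isMultiplierFamily_one.add (hχ.isMultiplierFamily_one_sub (ι := ι) 0).neg

/-- With ρ = `radialCutoff`, which is 1 wherever χ is nonzero, φ - χΦ = (1 - χ)φ + χ ρ (φ - Φ). The
first summand has compact support and so any order; the second needs the estimate for φ - Φ only
away from the origin. An arbitrary χ is thereby reduced to a radial cutoff. -/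
theorem IsCutoff.isMultiplierFamily_sub {χ : E n → ℂ} (hχ : IsCutoff χ) {ε s s' : ℝ} (hε : 0 < ε)
    (hε' : ε ≤ 1 / 2) {φ Φ : ι → ℝ → ℝ} (hφ : ∀ k, RadialBound (Ioi (-ε)) k s' φ)
    (h : ∀ k, RadialBound (Ioi (1 / 16)) k s fun i x => φ i x - Φ i x) :
    IsMultiplierFamily (2 * s) (fun i (ξ : E n) =>
      ((φ i (‖ξ‖ ^ 2) : ℝ) : ℂ) - χ ξ * ((Φ i (‖ξ‖ ^ 2) : ℝ) : ℂ)) := by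
  have h1 := (hχ.isMultiplierFamily_one_sub (ι := ι) (2 * s - 2 * s')).mul
    (RadialBound.isMultiplierFamily (n := n) hε hε' hφ)
  have h2 := (hχ.isMultiplierFamily (ι := ι)).mul
    (RadialBound.isMultiplierFamily (n := n) (ε := 1 / 2) (by norm_num) le_rfl
      fun k => by simpa [neg_div] using (h k).radialCutoff_mul)
  rw [sub_add_cancel] at h1
  rw [zero_add] at h2
  convert h1.add h2 using 3 with i ξ
  rcases le_or_gt ‖ξ‖ (1 / 2) with hξ | hξ
  · rw [hχ.2.2 ξ hξ]; ring
  · have : radialCutoff (‖ξ‖ ^ 2) = 1 :=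
      Real.smoothTransition.one_of_one_le (by nlinarith)
    rw [this]
    push_cast
    ring

/-! ### The symbol of the shifted operator -/

theorem norm_rpow_eq (ξ : E n) (a : ℝ) : ‖ξ‖ ^ (2 * a) = (‖ξ‖ ^ 2) ^ a := by
  rw [Real.rpow_mul (norm_nonneg ξ), Real.rpow_two]

theorem sum_range_even {A : Type} [AddCommMonoid A] (F : ℕ → A) (N : ℕ) :
    ∑ j ∈ Finset.range N, (if Even j then F (j / 2) else 0) =
      ∑ i ∈ Finset.range ((N + 1) / 2), F i := by
  induction N with
  | zero => simp
  | succ N ih =>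
    rw [Finset.sum_range_succ, ih]
    rcases Nat.even_or_odd' N with ⟨a, rfl | rfl⟩
    · rw [if_pos (by simp), show (2 * a + 1) / 2 = a by omega,
        show (2 * a + 1 + 1) / 2 = a + 1 by omega, show 2 * a / 2 = a by omega,
        Finset.sum_range_succ]
    · rw [if_neg (by simp), show (2 * a + 1 + 1) / 2 = a + 1 by omega,
        show (2 * a + 1 + 1 + 1) / 2 = a + 1 by omega, add_zero]

theorem symbolTerm_eq (j : ℕ) (ξ : E n) : symbolTerm α p j ξ =
    if Even j then ((coeffAlpha α p (j / 2) * (‖ξ‖ ^ 2) ^ (α - (j / 2 : ℕ)) : ℝ) : ℂ) else 0 := by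
  unfold symbolTerm
  split_ifs with hj
  · obtain ⟨i, rfl⟩ := hj
    rw [← norm_rpow_eq, ← two_mul, Nat.mul_div_cancel_left i two_pos]
    push_cast
    ring_nf
  · rfl

theorem heatTerm_eq (j : ℕ) (t : ℝ) (ξ : E n) : heatTerm α p j t ξ =
    if Even j then ((heatRadial α p (j / 2) t (‖ξ‖ ^ 2) : ℝ) : ℂ) else 0 := by
  unfold heatTerm heatRadial
  simp only [← norm_rpow_eq, mul_sub, mul_assoc]

theorem mapsTo_norm_sq_Ioi : MapsTo (fun ξ : E n => ‖ξ‖ ^ 2) {0}ᶜ (Ioi 0) := fun ξ hξ => by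
  have : 0 < ‖ξ‖ := norm_pos_iff.2 hξ
  exact mem_Ioi.2 (by positivity)

theorem contDiffOn_radial {φ : ℝ → ℝ} (h : ContDiffOn ℝ ∞ φ (Ioi 0)) :
    ContDiffOn ℝ ∞ (fun ξ : E n => ((φ (‖ξ‖ ^ 2) : ℝ) : ℂ)) {0}ᶜ :=
  Complex.ofRealCLM.contDiff.comp_contDiffOn
    (h.comp (contDiff_norm_sq ℝ).contDiffOn mapsTo_norm_sq_Ioi)

theorem contDiffOn_rpow_Ioi (s : ℝ) : ContDiffOn ℝ ∞ (fun x : ℝ => x ^ s) (Ioi 0) :=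
  contDiffOn_id.rpow_const_of_ne fun _ hx => ne_of_gt hx

theorem contDiffOn_symbolTerm (j : ℕ) :
    ContDiffOn ℝ ∞ (symbolTerm α p j : E n → ℂ) {0}ᶜ := by
  simp only [funext (symbolTerm_eq (n := n) (α := α) (p := p) j)]
  split_ifs
  · exact contDiffOn_radial (contDiffOn_const.mul (contDiffOn_rpow_Ioi _))
  · exact contDiffOn_const

theorem contDiffOn_heatTerm (j : ℕ) (t : ℝ) :
    ContDiffOn ℝ ∞ (heatTerm α p j t : E n → ℂ) {0}ᶜ := by
  simp only [funext (heatTerm_eq (n := n) (α := α) (p := p) j t)]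
  split_ifs
  · refine contDiffOn_radial ((Real.contDiff_exp.comp_contDiffOn
      (contDiffOn_const.mul (contDiffOn_const.mul (contDiffOn_rpow_Ioi _)))).mul ?_)
    refine ContDiffOn.sum fun c _ => contDiffOn_const.mul ?_
    induction c.blocks with
    | nil => simpa using contDiffOn_const
    | cons k L ih =>
      simp only [List.map_cons, List.prod_cons]
      exact (contDiffOn_const.mul (contDiffOn_rpow_Ioi _)).mul ih
  · exact contDiffOn_const

/-- The symbol of the shifted operator. -/
def tildeSymbol (m : ℝ → ℝ) (α : ℝ) (p : ℕ → ℝ) (ξ : E n) : ℂ :=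
  ((levySymbol m α p (‖ξ‖ ^ 2) : ℝ) : ℂ)

/-- The symbol of the heat operator. -/
def heatSymbol (m : ℝ → ℝ) (α : ℝ) (p : ℕ → ℝ) (t : ℝ) (ξ : E n) : ℂ :=
  ((Real.exp (-t * levySymbol m α p (‖ξ‖ ^ 2)) : ℝ) : ℂ)

namespace LevyHypothesis

theorem isMultiplierFamily_tildeSymbol (hm : LevyHypothesis m α p) :
    IsMultiplierFamily (2 * α) (fun _ : ι => (tildeSymbol m α p : E n → ℂ)) :=
  RadialBound.isMultiplierFamily (ε := 1 / 2) (by norm_num) le_rfl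
    (fun k => by simpa [neg_div] using hm.radialBound_levySymbol (ι := ι) k)

theorem isElliptic (hm : LevyHypothesis m α p) :
    IsElliptic (2 * α) (tildeSymbol m α p : E n → ℂ) := by
  obtain ⟨ε, c, hε, -, hc, h⟩ := hm.exists_le_levySymbol
  refine ⟨c, hc, fun ξ => ⟨Complex.ofReal_im _, ?_⟩⟩
  rw [← one_add_norm_sq_rpow]
  exact h _ (mem_Ioi.2 (by have : 0 ≤ ‖ξ‖ ^ 2 := by positivity
                           linarith))

theorem hasExpansion (hm : LevyHypothesis m α p) :
    HasExpansion (2 * α) (tildeSymbol m α p : E n → ℂ) (symbolTerm α p) := by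
  refine ⟨(hm.isMultiplierFamily_tildeSymbol (ι := Unit)).isSymbol (),
    contDiffOn_symbolTerm, fun χ hχ N => ?_⟩
  have h1 : ∀ k, RadialBound (Ioi (1 / 16)) k (α - ((N + 1) / 2 : ℕ)) (fun (_ : Unit) x =>
      levySymbol m α p x - ∑ k ∈ Finset.range ((N + 1) / 2), coeffAlpha α p k * x ^ (α - k)) := by
    intro k
    -- The Laplace representation needs at least one subtracted term, so the empty sum is treated by
    -- the order of the symbol itself.
    rcases Nat.eq_zero_or_pos ((N + 1) / 2) with h | h
    · rw [h]
      simpa using (hm.radialBound_levySymbol (ι := Unit) k).mono_set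
        (Ioi_subset_Ioi (by norm_num))
    · exact hm.radialBound_levySymbol_sub h (by norm_num) k
  have h2 := (hχ.isMultiplierFamily_sub (ε := 1 / 2) (by norm_num) le_rfl (fun k => by
    simpa [neg_div] using hm.radialBound_levySymbol (ι := Unit) k) h1).mono
      (r' := 2 * α - N) (by
        have : N ≤ 2 * ((N + 1) / 2) := by omega
        have : (N : ℝ) ≤ 2 * ((N + 1) / 2 : ℕ) := by exact_mod_cast this
        linarith)
  have h3 : ∀ ξ : E n, ∑ k ∈ Finset.range N, χ ξ * symbolTerm α p k ξ = χ ξ *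
      ((∑ k ∈ Finset.range ((N + 1) / 2), coeffAlpha α p k * (‖ξ‖ ^ 2) ^ (α - k) : ℝ) : ℂ) := by
    intro ξ
    simp only [symbolTerm_eq, ← Finset.mul_sum]
    rw [sum_range_even (fun i => ((coeffAlpha α p i * (‖ξ‖ ^ 2) ^ (α - i) : ℝ) : ℂ)),
      Complex.ofReal_sum]
  simp only [h3]
  exact h2.isSymbol ()

theorem isClassicalSymbol (hm : LevyHypothesis m α p) :
    IsClassicalSymbol (2 * α) (tildeSymbol m α p : E n → ℂ) := by
  refine ⟨symbolTerm α p, hm.hasExpansion, fun k τ ξ hτ hξ => ?_⟩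
  unfold symbolTerm
  split_ifs
  · rw [norm_smul, Real.norm_eq_abs, abs_of_pos hτ, Real.mul_rpow hτ.le (norm_nonneg ξ)]
    push_cast
    ring
  · simp

/-! ### The symbol of the heat operator -/

theorem exists_radialBound_pow_mul_exp (hm : LevyHypothesis m α p) {t : ι → ℝ}
    (ht : ∀ i, 0 ≤ t i) : ∃ ε : ℝ, 0 < ε ∧ ε ≤ 1 / 2 ∧ ∀ k l : ℕ,
      RadialBound (Ioi (-ε)) k (-(l * α))
        (fun i x => t i ^ l * Real.exp (-t i * levySymbol m α p x)) := by
  obtain ⟨ε, c, hε, hε', hc, h⟩ := hm.exists_le_levySymbol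
  have hU' : Ioi (-ε) ⊆ Ioi (-1 / 2 : ℝ) := Ioi_subset_Ioi (by linarith)
  refine ⟨ε, hε, hε', fun k l => ?_⟩
  have := RadialBound.exp_mul_expRem isOpen_Ioi hU' hc ht (R := fun _ => 0)
    (fun k => (hm.radialBound_levySymbol k).mono_set hU') (fun k => RadialBound.zero) h
    (by simpa using h) k l 0
  simpa [expRem] using this

/-- A positive power of a fixed `t > 0` can be dropped, so bounds of arbitrarily low order hold. -/
theorem radialBound_of_pow_mul {U : Set ℝ} (hU : IsOpen U) (hU' : U ⊆ Ioi (-1 / 2)) (hα : 0 < α)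
    {t : ℝ} (ht : 0 < t) {k : ℕ} {φ : ℝ → ℝ}
    (h : ∀ l : ℕ, RadialBound U k (-(l * α)) (fun (_ : ι) x => t ^ l * φ x)) (s : ℝ) :
    RadialBound U k s (fun _ : ι => φ) := by
  obtain ⟨l, hl⟩ := exists_nat_ge (-s / α)
  rw [div_le_iff₀ hα] at hl
  refine (((h l).mono hU' (r := s) (by linarith)).const_mul hU hU' (t ^ l)⁻¹).congr hU
    fun _ x _ => ?_
  rw [inv_mul_cancel_left₀ (by positivity)]

theorem isMultiplierFamily_heatSymbol (hm : LevyHypothesis m α p) {t : ℝ} (ht : 0 < t) (r : ℝ) :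
    IsMultiplierFamily r (fun _ : ι => (heatSymbol m α p t : E n → ℂ)) := by
  obtain ⟨ε, hε, hε', h⟩ := hm.exists_radialBound_pow_mul_exp (ι := ι) (t := fun _ => t)
    fun _ => ht.le
  have := RadialBound.isMultiplierFamily (n := n) hε hε' (fun k => radialBound_of_pow_mul
    isOpen_Ioi (Ioi_subset_Ioi (by linarith)) hm.alpha_pos ht (h k) (r / 2))
  rwa [mul_div_cancel₀ _ two_ne_zero] at this

theorem isSmoothingSymbol (hm : LevyHypothesis m α p) {t : ℝ} (ht : 0 < t) :
    IsSmoothingSymbol 0 (fun (_ : E n) ξ => heatSymbol m α p t ξ) := fun r =>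
  (hm.isMultiplierFamily_heatSymbol (ι := Unit) ht r).isSymbol ()

/-- A symbol of order -∞ is classical in every order, with all homogeneous terms zero. -/
theorem isClassicalSmoothingSymbol (hm : LevyHypothesis m α p) {t : ℝ} (ht : 0 < t) :
    IsClassicalSmoothingSymbol (heatSymbol m α p t : E n → ℂ) := by
  refine fun r => ⟨fun _ _ => 0, ⟨hm.isSmoothingSymbol ht r, fun _ => contDiffOn_const,
    fun χ _ N => ?_⟩, by simp⟩
  simpa using hm.isSmoothingSymbol (n := n) ht (r - N)

/-- For fixed t the factor e^{-tα₀x^α} has every order, so it compensates the order of each product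
of powers. -/
theorem radialBound_heatRadial (hm : LevyHypothesis m α p) {t : ℝ} (ht : 0 < t) (i k : ℕ) (s : ℝ) :
    RadialBound (Ioi (1 / 16)) k s (fun _ : ι => heatRadial α p i t) := by
  have hU' : Ioi (1 / 16) ⊆ Ioi (-1 / 2 : ℝ) := Ioi_subset_Ioi (by norm_num)
  have hU : IsOpen (Ioi (1 / 16 : ℝ)) := isOpen_Ioi
  have hexp : ∀ s, RadialBound (Ioi (1 / 16)) k s
      (fun (_ : ι) x => Real.exp (-t * (coeffAlpha α p 0 * x ^ α))) :=
    radialBound_of_pow_mul hU hU' hm.alpha_pos ht fun l =>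
      hm.radialBound_pow_mul_exp_leading (t := fun _ => t) (fun _ => ht.le) k l
  have hprod : ∀ L : List ℕ, RadialBound (Ioi (1 / 16)) k (L.map fun k : ℕ => α - k).sum
      (fun (_ : ι) x => (L.map fun k : ℕ => coeffAlpha α p k * x ^ (α - k)).prod) := by
    intro L
    induction L with
    | nil => simpa using RadialBound.const 1
    | cons a L ih =>
      simp only [List.map_cons, List.sum_cons, List.prod_cons]
      exact ((RadialBound.rpow (by norm_num) _).const_mul hU hU' _).mul hU hU' ih
  unfold heatRadial
  simp only [Finset.mul_sum]
  refine RadialBound.finset_sum hU fun c _ => ?_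
  have := (hexp (s - (c.blocks.map fun k : ℕ => α - k).sum)).mul hU hU'
    ((hprod c.blocks).const_mul hU hU' ((-t) ^ c.length / (c.length.factorial : ℝ)))
  rwa [sub_add_cancel] at this

theorem sum_heatTerm (χ : E n → ℂ) (N : ℕ) (t : ℝ) (ξ : E n) :
    ∑ k ∈ Finset.range N, χ ξ * heatTerm α p k t ξ =
      χ ξ * ((∑ i ∈ Finset.range ((N + 1) / 2), heatRadial α p i t (‖ξ‖ ^ 2) : ℝ) : ℂ) := by
  simp only [heatTerm_eq, ← Finset.mul_sum]
  rw [sum_range_even (fun i => ((heatRadial α p i t (‖ξ‖ ^ 2) : ℝ) : ℂ)), Complex.ofReal_sum]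

/-- No cancellation is involved: for fixed t the symbol and every term are separately of order -∞
away from the origin. -/
theorem hasSmoothingExpansion (hm : LevyHypothesis m α p) {t : ℝ} (ht : 0 < t) :
    HasSmoothingExpansion (heatSymbol m α p t : E n → ℂ) (fun j => heatTerm α p j t) := by
  refine ⟨hm.isSmoothingSymbol ht, fun k => contDiffOn_heatTerm k t, fun χ hχ N r => ?_⟩
  have hU' : Ioi (1 / 16) ⊆ Ioi (-1 / 2 : ℝ) := Ioi_subset_Ioi (by norm_num)
  obtain ⟨ε, hε, hε', h⟩ := hm.exists_radialBound_pow_mul_exp (ι := Unit) (t := fun _ => t)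
    fun _ => ht.le
  have h0 := fun k => radialBound_of_pow_mul isOpen_Ioi (Ioi_subset_Ioi (by linarith))
    hm.alpha_pos ht (h k) (r / 2)
  have h1 := hχ.isMultiplierFamily_sub (s := r / 2) hε hε' h0 (fun k =>
    ((h0 k).mono_set (Ioi_subset_Ioi (by linarith))).sub isOpen_Ioi hU'
      (RadialBound.finset_sum isOpen_Ioi fun i (_ : i ∈ Finset.range ((N + 1) / 2)) =>
        hm.radialBound_heatRadial ht i k (r / 2)))
  rw [mul_div_cancel₀ _ two_ne_zero] at h1
  have h2 := h1.isSymbol ()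
  simp only [sum_heatTerm]
  exact h2

/-- Below index N there are M = ⌊(N+1)/2⌋ even terms. The radial remainder of order -M becomes order
-2M ≤ -N in ξ. -/
theorem hasUniformExpansion (hm : LevyHypothesis m α p) :
    HasUniformExpansion (heatSymbol m α p : ℝ → E n → ℂ) (heatTerm α p) := by
  intro χ hχ N
  have ht : ∀ t : Ioi (0 : ℝ), 0 ≤ (t : ℝ) := fun t => le_of_lt t.2
  obtain ⟨ε, hε, hε', h⟩ := hm.exists_radialBound_pow_mul_exp ht
  have h1 := (hχ.isMultiplierFamily_sub hε hε' (fun k => by simpa using h k 0)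
    (fun k => hm.radialBound_exp_sub_sum ht k ((N + 1) / 2))).mono (r' := -(N : ℝ)) (by
        have : N ≤ 2 * ((N + 1) / 2) := by omega
        have : (N : ℝ) ≤ 2 * ((N + 1) / 2 : ℕ) := by exact_mod_cast this
        linarith)
  simp only [sum_heatTerm]
  exact h1.isBoundedSymbolFamily

end LevyHypothesis

end

/-! ### Quasi-homogeneity and explicit low-order terms. -/

section

variable {n : ℕ} {α : ℝ} {p : ℕ → ℝ}

theorem list_prod_smul_rpow (a : ℕ → ℝ) {τ : ℝ} (hτ : 0 < τ) (ξ : E n) (L : List ℕ) :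
    (L.map fun k : ℕ => a k * ‖τ • ξ‖ ^ (2 * α - 2 * k)).prod =
      τ ^ (2 * α * L.length - 2 * L.sum) * (L.map fun k : ℕ => a k * ‖ξ‖ ^ (2 * α - 2 * k)).prod := by
  induction L with
  | nil => simp
  | cons k L ih =>
    simp only [List.map_cons, List.prod_cons, List.length_cons, List.sum_cons, ih]
    rw [norm_smul, Real.norm_eq_abs, abs_of_pos hτ, Real.mul_rpow hτ.le (norm_nonneg ξ),
      show 2 * α * ((L.length + 1 : ℕ) : ℝ) - 2 * ((k + L.sum : ℕ) : ℝ) =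
        (2 * α - 2 * k) + (2 * α * L.length - 2 * L.sum) by push_cast; ring,
      Real.rpow_add hτ]
    ring

/-- The exponent t|ξ|^{2α} is invariant. For a composition of length l, t^l scales by τ^{-2αl} and
the product by τ^{2αl-j}, since twice the sum of the blocks is j. -/
theorem heatTerm_quasihomogeneous (j : ℕ) {τ : ℝ} (t : ℝ) (ξ : E n) (hτ : 0 < τ) :
    heatTerm α p j (τ ^ (-(2 * α)) * t) (τ • ξ) =
      ((τ ^ (-(j : ℝ)) : ℝ) : ℂ) * heatTerm α p j t ξ := by
  unfold heatTerm
  split_ifs with hj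
  · rw [← Complex.ofReal_mul]
    congr 1
    have h1 : -(τ ^ (-(2 * α)) * t) * coeffAlpha α p 0 * ‖τ • ξ‖ ^ (2 * α) =
        -t * coeffAlpha α p 0 * ‖ξ‖ ^ (2 * α) := by
      rw [norm_smul, Real.norm_eq_abs, abs_of_pos hτ, Real.mul_rpow hτ.le (norm_nonneg ξ),
        Real.rpow_neg hτ.le]
      field_simp
    rw [h1, mul_left_comm]
    congr 1
    rw [Finset.mul_sum]
    refine Finset.sum_congr rfl fun c _ => ?_
    have hsum : (2 : ℝ) * (c.blocks.sum : ℕ) = j := by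
      rw [c.blocks_sum]
      obtain ⟨i, rfl⟩ := hj
      rw [← two_mul, Nat.mul_div_cancel_left i two_pos]
      push_cast; ring
    rw [list_prod_smul_rpow _ hτ, hsum, c.blocks_length, neg_mul_eq_mul_neg, mul_pow,
      ← Real.rpow_natCast (τ ^ (-(2 * α))), ← Real.rpow_mul hτ.le,
      show -(j : ℝ) = -(2 * α) * c.length + (2 * α * c.length - j) by ring, Real.rpow_add hτ]
    ring
  · simp

theorem univ_composition_one : (Finset.univ : Finset (Composition 1)) = {Composition.ones 1} := by
  refine Finset.eq_singleton_iff_unique_mem.2 ⟨Finset.mem_univ _, fun c _ => ?_⟩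
  exact Composition.eq_ones_iff_le_length.2 (c.length_pos_iff.2 one_pos)

theorem univ_composition_two : (Finset.univ : Finset (Composition 2)) =
    {Composition.single 2 two_pos, Composition.ones 2} := by
  refine (Finset.eq_univ_of_forall fun c => ?_).symm
  have h1 : 0 < c.length := c.length_pos_iff.2 two_pos
  rw [Finset.mem_insert, Finset.mem_singleton, Composition.eq_single_iff_length,
    Composition.eq_ones_iff_le_length]
  omega

theorem heatTerm_zero (t : ℝ) (ξ : E n) : heatTerm α p 0 t ξ =
    ((Real.exp (-t * coeffAlpha α p 0 * ‖ξ‖ ^ (2 * α)) : ℝ) : ℂ) := by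
  have h : (Finset.univ : Finset (Composition (0 / 2))) = {Composition.ones 0} := by decide
  rw [heatTerm, if_pos (by decide), h]
  simp

theorem heatTerm_two (t : ℝ) (ξ : E n) : heatTerm α p 2 t ξ =
    ((-(coeffAlpha α p 1 * ‖ξ‖ ^ (2 * α - 2)) * t *
      Real.exp (-t * coeffAlpha α p 0 * ‖ξ‖ ^ (2 * α)) : ℝ) : ℂ) := by
  rw [heatTerm, if_pos (by decide)]
  congr 1
  change _ * ∑ c : Composition 1, _ = _
  rw [univ_composition_one, Finset.sum_singleton]
  simp
  ring

theorem heatTerm_four (t : ℝ) {ξ : E n} (hξ : ξ ≠ 0) : heatTerm α p 4 t ξ =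
    (((-(coeffAlpha α p 2 * ‖ξ‖ ^ (2 * α - 4)) * t
        + 1 / 2 * coeffAlpha α p 1 ^ 2 * ‖ξ‖ ^ (4 * α - 4) * t ^ 2) *
        Real.exp (-t * coeffAlpha α p 0 * ‖ξ‖ ^ (2 * α)) : ℝ) : ℂ) := by
  have hpos : 0 < ‖ξ‖ := norm_pos_iff.2 hξ
  rw [heatTerm, if_pos (by decide)]
  congr 1
  change _ * ∑ c : Composition 2, _ = _
  have h1 : ‖ξ‖ ^ (4 * α - 4) = ‖ξ‖ ^ (2 * α - 2) * ‖ξ‖ ^ (2 * α - 2) := by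
    rw [← Real.rpow_add hpos]; congr 1; ring
  rw [univ_composition_two, Finset.sum_pair (by decide), h1]
  simp [List.replicate]
  norm_num
  ring

theorem heatTerm_odd {j : ℕ} (hj : ¬ Even j) (t : ℝ) (ξ : E n) : heatTerm α p j t ξ = 0 :=
  if_neg hj

end

section

variable {n : ℕ}

/-! ### Uniqueness of semigroups -/

namespace IsC0Semigroup

variable {T : ℝ≥0 → L2 n →L[ℂ] L2 n}

theorem tendsto_nhds_zero (hT : IsC0Semigroup T) (u : L2 n) :
    Tendsto (fun t => T t u) (𝓝 0) (𝓝 u) := by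
  have h : 𝓝 (0 : ℝ≥0) = pure 0 ⊔ 𝓝[>] 0 := by
    rw [← nhdsWithin_univ, ← insert_eq_of_mem (mem_univ (0 : ℝ≥0))]
    rw [← nhdsWithin_singleton, ← nhdsWithin_union]
    congr 1
    ext x
    simp
  rw [h]
  refine Tendsto.sup ?_ (hT.2.2 u)
  rw [tendsto_pure_left]
  intro s hs
  rw [hT.1]
  exact mem_of_mem_nhds hs

/-- Otherwise the norms would blow up along some sequence tending to 0, against the uniform
boundedness principle. -/
theorem exists_norm_le_near_zero (hT : IsC0Semigroup T) :
    ∃ δ : ℝ≥0, 0 < δ ∧ ∃ M : ℝ, ∀ t ≤ δ, ‖T t‖ ≤ M := by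
  by_contra! h
  choose t ht hT' using fun k : ℕ => h (1 / (k + 1)) (by positivity) k
  have hlim : Tendsto t atTop (𝓝 0) :=
    tendsto_of_tendsto_of_tendsto_of_le_of_le tendsto_const_nhds
      tendsto_one_div_add_atTop_nhds_zero_nat (fun _ => zero_le) ht
  obtain ⟨C, hC⟩ := banach_steinhaus (g := fun k => T (t k)) fun u => by
    obtain ⟨C, hC⟩ := ((hT.tendsto_nhds_zero u).comp hlim).norm.bddAbove_range
    exact ⟨C, fun k => hC ⟨k, rfl⟩⟩
  obtain ⟨k, hk⟩ := exists_nat_gt C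
  exact absurd ((hT' k).trans_le (hC k)) (not_lt.2 hk.le)

theorem exists_norm_le (hT : IsC0Semigroup T) (B : ℝ≥0) : ∃ K : ℝ, 0 ≤ K ∧ ∀ t ≤ B, ‖T t‖ ≤ K := by
  obtain ⟨δ, hδ, M, hM⟩ := hT.exists_norm_le_near_zero
  have hM0 : 0 ≤ M := (norm_nonneg _).trans (hM 0 zero_le)
  have key : ∀ N : ℕ, ∃ K : ℝ, 0 ≤ K ∧ ∀ t ≤ N * δ, ‖T t‖ ≤ K := by
    intro N
    induction N with
    | zero =>
      refine ⟨M, hM0, fun t ht => hM t (ht.trans ?_)⟩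
      simp
    | succ N ih =>
      obtain ⟨K, hK, h⟩ := ih
      refine ⟨M * K, by positivity, fun t ht => ?_⟩
      -- Truncated subtraction makes this valid also for t ≤ δ.
      have e : t = min t δ + (t - δ) := by
        rcases le_total t δ with h | h
        · rw [min_eq_left h, tsub_eq_zero_of_le h, add_zero]
        · rw [min_eq_right h, add_tsub_cancel_of_le h]
      rw [e, hT.2.1]
      refine (ContinuousLinearMap.opNorm_comp_le _ _).trans
        (mul_le_mul (hM _ (min_le_right _ _)) (h _ ?_) (norm_nonneg _) hM0)
      rw [tsub_le_iff_right]
      refine ht.trans (le_of_eq ?_)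
      push_cast; ring
  obtain ⟨N, hN⟩ := exists_nat_ge (B / δ)
  obtain ⟨K, hK, h⟩ := key N
  exact ⟨K, hK, fun t ht => h t (ht.trans ((div_le_iff₀ hδ).1 hN))⟩

theorem continuous_orbit (hT : IsC0Semigroup T) (u : L2 n) : Continuous fun t => T t u := by
  refine continuous_iff_continuousAt.2 fun t₀ => ?_
  obtain ⟨K, hK, h⟩ := hT.exists_norm_le (t₀ + 1)
  have key : ∀ s t : ℝ≥0, s ≤ t → s ≤ t₀ + 1 → ‖T t u - T s u‖ ≤ K * ‖T (nndist t s) u - u‖ := by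
    intro s t hst hs
    have e : t = s + nndist t s := by
      rw [← NNReal.coe_inj]
      push_cast
      rw [NNReal.dist_eq, abs_of_nonneg (by simpa using hst)]
      ring
    calc ‖T t u - T s u‖ = ‖T s (T (nndist t s) u - u)‖ := by
          conv_lhs => rw [e, hT.2.1]
          rw [map_sub]; rfl
      _ ≤ _ := (T s).le_of_opNorm_le (h s hs) _
  rw [ContinuousAt, tendsto_iff_norm_sub_tendsto_zero]
  have hlim : Tendsto (fun t => K * ‖T (nndist t t₀) u - u‖) (𝓝 t₀) (𝓝 0) := by
    have h1 : Tendsto (fun t : ℝ≥0 => nndist t t₀) (𝓝 t₀) (𝓝 0) := by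
      have : Continuous fun t : ℝ≥0 => nndist t t₀ := by fun_prop
      simpa using this.tendsto t₀
    have := (((hT.tendsto_nhds_zero u).comp h1).sub_const u).norm.const_mul K
    simpa using this
  refine squeeze_zero' (Eventually.of_forall fun _ => norm_nonneg _) ?_ hlim
  filter_upwards [Iic_mem_nhds (show t₀ < t₀ + 1 by simp)] with t ht
  rcases le_total t₀ t with h1 | h1
  · exact key t₀ t h1 (by simp)
  · rw [norm_sub_rev, nndist_comm]
    exact key t t₀ h1 ht

theorem map_mem_generatorGraph (hT : IsC0Semigroup T) {u w : L2 n} (h : (u, w) ∈ generatorGraph T)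
    (s : ℝ≥0) : (T s u, T s w) ∈ generatorGraph T := by
  have h1 := ((T s).continuous.tendsto w).comp h
  refine h1.congr fun t => ?_
  have e : T t (T s u) = T s (T t u) := by
    have h2 := hT.2.1 t s
    rw [add_comm, hT.2.1] at h2
    exact (congrArg (fun A : L2 n →L[ℂ] L2 n => A u) h2).symm
  simp only [Function.comp, map_smul, map_sub, e]

/-- For u in the domain, s ↦ S(t - s)T(s)u is continuous with right derivative zero, hence constant;
comparing s = 0 and s = t gives the claim on a dense set. Contractivity of S allows limits to pass
through S(t - s). -/
theorem eq_of_generatorGraph_eq {S : ℝ≥0 → L2 n →L[ℂ] L2 n} (hT : IsC0Semigroup T)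
    (hS : IsC0Semigroup S) (hS1 : ∀ t, ‖S t‖ ≤ 1) (hG : generatorGraph T = generatorGraph S)
    (hd : Dense (Prod.fst '' generatorGraph S)) (t : ℝ≥0) : T t = S t := by
  have key : ∀ u w, (u, w) ∈ generatorGraph T → T t u = S t u := by
    intro u w hu
    set φ : ℝ → L2 n := fun s => S (t - s.toNNReal) (T s.toNNReal u) with hφ
    have hcont : Continuous φ := by
      refine continuous_iff_continuousAt.2 fun s₀ => ?_
      have h1 : Tendsto (fun s : ℝ => T s.toNNReal u) (𝓝 s₀) (𝓝 (T s₀.toNNReal u)) :=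
        ((hT.continuous_orbit u).comp continuous_real_toNNReal).tendsto s₀
      have h2 : Tendsto (fun s : ℝ => S (t - s.toNNReal) (T s₀.toNNReal u)) (𝓝 s₀)
          (𝓝 (φ s₀)) :=
        ((hS.continuous_orbit _).comp
          (continuous_const.sub continuous_real_toNNReal)).tendsto s₀
      have h3 : Tendsto (fun s : ℝ => S (t - s.toNNReal) (T s.toNNReal u - T s₀.toNNReal u))
          (𝓝 s₀) (𝓝 0) := by
        refine squeeze_zero_norm (fun s => ?_) (tendsto_iff_norm_sub_tendsto_zero.1 h1)
        exact ((S _).le_of_opNorm_le (hS1 _) _).trans (one_mul _).le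
      have := h3.add h2
      rw [zero_add] at this
      refine this.congr fun s => ?_
      rw [← map_add, sub_add_cancel]
    have hderiv : ∀ s ∈ Ico (0 : ℝ) t, HasDerivWithinAt φ 0 (Ici s) s := by
      intro s hs
      rw [← hasDerivWithinAt_Ioi_iff_Ici, hasDerivWithinAt_iff_tendsto_slope'
        (self_notMem_Ioi)]
      set v := T s.toNNReal u with hv
      have hvT := hT.map_mem_generatorGraph hu s.toNNReal
      have hvS := hvT
      rw [hG] at hvS
      -- The generators agree and the orbit of u stays in the domain, so both difference quotients
      -- at v have the same limit.
      have hdiff : Tendsto (fun h : ℝ≥0 => ‖((h : ℝ) : ℂ)⁻¹ • (T h v - v) -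
          ((h : ℝ) : ℂ)⁻¹ • (S h v - v)‖) (𝓝[>] 0) (𝓝 0) := by
        have := (Tendsto.sub hvT hvS).norm
        simpa using this
      have hlim : Tendsto (fun y : ℝ => (y - s).toNNReal) (𝓝[>] s) (𝓝[>] 0) := by
        refine tendsto_nhdsWithin_iff.2 ⟨?_, ?_⟩
        · have : Continuous fun y : ℝ => (y - s).toNNReal := by fun_prop
          simpa using (this.tendsto s).mono_left nhdsWithin_le_nhds
        · filter_upwards [self_mem_nhdsWithin] with y hy
          simpa using hy
      refine squeeze_zero_norm' ?_ (hdiff.comp hlim)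
      filter_upwards [Ioo_mem_nhdsGT hs.2] with y hy
      set h := (y - s).toNNReal with hh
      have hhs : ((h : ℝ≥0) : ℝ) = y - s := Real.coe_toNNReal _ (by linarith [hy.1])
      have e1 : y.toNNReal = h + s.toNNReal := by
        rw [hh, ← Real.toNNReal_add (by linarith [hy.1]) hs.1, sub_add_cancel]
      have hyt : y.toNNReal ≤ t := by
        rw [Real.toNNReal_le_iff_le_coe]; exact hy.2.le
      have e2 : t - s.toNNReal = (t - y.toNNReal) + h := by
        rw [e1] at hyt ⊢
        rw [← NNReal.coe_inj, NNReal.coe_add, NNReal.coe_sub hyt,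
          NNReal.coe_sub (le_trans (by simp) hyt), NNReal.coe_add]
        ring
      have e3 : φ y - φ s = S (t - y.toNNReal) ((T h v - v) - (S h v - v)) := by
        simp only [hφ]
        rw [e2, hS.2.1]
        conv_lhs => rw [show T y.toNNReal = (T h).comp (T s.toNNReal) by rw [e1, hT.2.1]]
        simp only [ContinuousLinearMap.comp_apply, map_sub, hv]
        abel
      rw [slope_def_module, e3]
      have e4 : (y - s)⁻¹ • S (t - y.toNNReal) ((T h v - v) - (S h v - v)) =
          S (t - y.toNNReal) (((h : ℝ) : ℂ)⁻¹ • (T h v - v) - ((h : ℝ) : ℂ)⁻¹ • (S h v - v)) := by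
        rw [← smul_sub, map_smul, hhs, ← Complex.ofReal_inv, Complex.coe_smul]
        rfl
      rw [e4]
      exact ((S _).le_of_opNorm_le (hS1 _) _).trans (one_mul _).le
    have h := constant_of_has_deriv_right_zero hcont.continuousOn hderiv t ⟨t.2, le_rfl⟩
    simp only [hφ, Real.toNNReal_coe, tsub_self, Real.toNNReal_zero, tsub_zero, hS.1, hT.1] at h
    exact h
  refine ContinuousLinearMap.ext_on (s := Prod.fst '' generatorGraph S) ?_ ?_
  · exact hd.mono Submodule.subset_span
  · rintro _ ⟨⟨u, w⟩, hw, rfl⟩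
    exact key u w (hG ▸ hw)

end IsC0Semigroup

end

section

variable {n : ℕ}

/-! ### Multiplication operators on `L²` -/

theorem memLp_boundedContinuous_mul (a : BoundedContinuousFunction (E n) ℂ) (u : L2 n) :
    MemLp (fun x => a x * u x) 2 volume :=
  (Lp.memLp u).of_le_mul (c := ‖a‖)
    (a.continuous.aestronglyMeasurable.mul (Lp.aestronglyMeasurable u))
    (Eventually.of_forall fun x => by
      rw [norm_mul]
      exact mul_le_mul_of_nonneg_right (a.norm_coe_le_norm x) (norm_nonneg _))

/-- Multiplication by a bounded continuous function on `L²`. -/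
def mulOp (a : BoundedContinuousFunction (E n) ℂ) : L2 n →L[ℂ] L2 n :=
  LinearMap.mkContinuous
    { toFun := fun u => (memLp_boundedContinuous_mul a u).toLp _
      map_add' := fun u v => by
        rw [← MemLp.toLp_add]
        refine MemLp.toLp_congr _ _ ?_
        filter_upwards [Lp.coeFn_add u v] with x hx
        rw [hx, Pi.add_apply, mul_add, Pi.add_apply]
      map_smul' := fun c u => by
        rw [RingHom.id_apply, ← MemLp.toLp_const_smul]
        refine MemLp.toLp_congr _ _ ?_
        filter_upwards [Lp.coeFn_smul c u] with x hx
        simp [hx, mul_left_comm] } ‖a‖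
    fun u => by
      refine Lp.norm_le_mul_norm_of_ae_le_mul ?_
      filter_upwards [(memLp_boundedContinuous_mul a u).coeFn_toLp] with x hx
      change ‖((memLp_boundedContinuous_mul a u).toLp _ : E n → ℂ) x‖ ≤ _
      rw [hx, norm_mul]
      exact mul_le_mul_of_nonneg_right (a.norm_coe_le_norm x) (norm_nonneg _)

theorem coeFn_mulOp (a : BoundedContinuousFunction (E n) ℂ) (u : L2 n) :
    (mulOp a u : E n → ℂ) =ᵐ[volume] fun x => a x * u x :=
  (memLp_boundedContinuous_mul a u).coeFn_toLp

theorem norm_mulOp_le (a : BoundedContinuousFunction (E n) ℂ) : ‖mulOp a‖ ≤ ‖a‖ :=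
  LinearMap.mkContinuous_norm_le _ (norm_nonneg _) _

theorem mulOp_mul (a b : BoundedContinuousFunction (E n) ℂ) :
    mulOp (a * b) = (mulOp a).comp (mulOp b) := by
  ext1 u
  refine Lp.ext ?_
  filter_upwards [coeFn_mulOp (a * b) u, coeFn_mulOp a (mulOp b u), coeFn_mulOp b u]
    with x h1 h2 h3
  rw [h1, ContinuousLinearMap.comp_apply, h2, h3, BoundedContinuousFunction.mul_apply, mul_assoc]

theorem mulOp_one : mulOp (1 : BoundedContinuousFunction (E n) ℂ) = ContinuousLinearMap.id ℂ _ := by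
  ext1 u
  refine Lp.ext ?_
  filter_upwards [coeFn_mulOp 1 u] with x h1
  simp [h1]

theorem mulOp_sub (a b : BoundedContinuousFunction (E n) ℂ) :
    mulOp (a - b) = mulOp a - mulOp b := by
  ext1 u
  refine Lp.ext ?_
  filter_upwards [coeFn_mulOp (a - b) u, coeFn_mulOp a u, coeFn_mulOp b u,
    Lp.coeFn_sub (mulOp a u) (mulOp b u)] with x h1 h2 h3 h4
  rw [h1, BoundedContinuousFunction.sub_apply, sub_apply, h4, Pi.sub_apply, h2, h3, sub_mul]

theorem mulOp_smul (c : ℂ) (a : BoundedContinuousFunction (E n) ℂ) :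
    mulOp (c • a) = c • mulOp a := by
  ext1 u
  refine Lp.ext ?_
  filter_upwards [coeFn_mulOp (c • a) u, coeFn_mulOp a u, Lp.coeFn_smul c (mulOp a u)]
    with x h1 h2 h3
  rw [h1, BoundedContinuousFunction.smul_apply, smul_apply, h3, Pi.smul_apply, h2, smul_eq_mul,
    smul_eq_mul, mul_assoc]

theorem norm_sq_eq_integral (u : L2 n) : ‖u‖ ^ 2 = ∫ x, ‖u x‖ ^ 2 := by
  have h : (((‖u‖ ^ 2 : ℝ)) : ℂ) = ((∫ x, ‖u x‖ ^ 2 : ℝ) : ℂ) := by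
    rw [← integral_complex_ofReal]
    have h1 := inner_self_eq_norm_sq_to_K (𝕜 := ℂ) u
    rw [L2.inner_def] at h1
    simp only [inner_self_eq_norm_sq_to_K] at h1
    push_cast
    exact h1.symm
  exact_mod_cast h

/-- Dominated convergence for |a_i - b|²|u|²: bounded pointwise convergence of multipliers gives
strong convergence. -/
theorem tendsto_mulOp {ι : Type*} {l : Filter ι} [l.IsCountablyGenerated]
    {a : ι → BoundedContinuousFunction (E n) ℂ} {b : BoundedContinuousFunction (E n) ℂ} {C : ℝ}
    (hC : ∀ᶠ i in l, ‖a i‖ ≤ C) (h : ∀ x, Tendsto (fun i => a i x) l (𝓝 (b x))) (u : L2 n) :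
    Tendsto (fun i => mulOp (a i) u) l (𝓝 (mulOp b u)) := by
  rw [tendsto_iff_norm_sub_tendsto_zero]
  have e : ∀ i, ‖mulOp (a i) u - mulOp b u‖ ^ 2 = ∫ x, ‖(a i x - b x) * u x‖ ^ 2 := by
    intro i
    rw [← sub_apply, ← mulOp_sub, norm_sq_eq_integral]
    refine integral_congr_ae ?_
    filter_upwards [coeFn_mulOp (a i - b) u] with x hx
    rw [hx, BoundedContinuousFunction.sub_apply]
  have h2 : Tendsto (fun i => ∫ x, ‖(a i x - b x) * u x‖ ^ 2) l (𝓝 (∫ _ : E n, (0 : ℝ))) := by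
    refine tendsto_integral_filter_of_dominated_convergence
      (fun x => (C + ‖b‖) ^ 2 * ‖u x‖ ^ 2) ?_ ?_ ?_ ?_
    · refine Eventually.of_forall fun i => ?_
      exact (((a i).continuous.sub b.continuous).aestronglyMeasurable.mul
        (Lp.aestronglyMeasurable u)).norm.pow 2
    · filter_upwards [hC] with i hi
      refine Eventually.of_forall fun x => ?_
      rw [norm_pow, norm_norm, norm_mul, mul_pow]
      gcongr
      exact (norm_sub_le _ _).trans
        (add_le_add (((a i).norm_coe_le_norm x).trans hi) (b.norm_coe_le_norm x))
    · exact ((memLp_two_iff_integrable_sq_norm (Lp.aestronglyMeasurable u)).1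
        (Lp.memLp u)).const_mul _
    · refine Eventually.of_forall fun x => ?_
      have := ((((h x).sub_const (b x)).mul_const (u x)).norm).pow 2
      simpa using this
  rw [integral_zero] at h2
  have h3 := (h2.congr fun i => (e i).symm).sqrt
  simpa using h3

end

section

variable {n : ℕ}

/-! ### Fourier multipliers -/

/-- The Fourier multiplier on `L²` with a bounded continuous symbol, for the Fourier transform
normalized as `∫ e^{-2πi x·η} u(x) dx`. -/
def fourierOp (a : BoundedContinuousFunction (E n) ℂ) : L2 n →L[ℂ] L2 n :=
  ((Lp.fourierTransformₗᵢ (E n) ℂ).symm.toContinuousLinearEquiv : L2 n →L[ℂ] L2 n).comp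
    ((mulOp a).comp ((Lp.fourierTransformₗᵢ (E n) ℂ).toContinuousLinearEquiv : L2 n →L[ℂ] L2 n))

theorem fourierOp_apply (a : BoundedContinuousFunction (E n) ℂ) (u : L2 n) :
    fourierOp a u = (Lp.fourierTransformₗᵢ (E n) ℂ).symm
      (mulOp a (Lp.fourierTransformₗᵢ (E n) ℂ u)) := rfl

theorem norm_fourierOp_le (a : BoundedContinuousFunction (E n) ℂ) : ‖fourierOp a‖ ≤ ‖a‖ := by
  refine ContinuousLinearMap.opNorm_le_bound _ (norm_nonneg _) fun u => ?_
  rw [fourierOp_apply, LinearIsometryEquiv.norm_map]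
  refine ((mulOp a).le_of_opNorm_le (norm_mulOp_le a) _).trans ?_
  rw [LinearIsometryEquiv.norm_map]

theorem fourierOp_mul (a b : BoundedContinuousFunction (E n) ℂ) :
    fourierOp (a * b) = (fourierOp a).comp (fourierOp b) := by
  ext1 u
  simp [fourierOp_apply, mulOp_mul]

theorem fourierOp_one :
    fourierOp (1 : BoundedContinuousFunction (E n) ℂ) = ContinuousLinearMap.id ℂ _ := by
  ext1 u
  simp [fourierOp_apply, mulOp_one]

theorem fourierOp_sub (a b : BoundedContinuousFunction (E n) ℂ) :
    fourierOp (a - b) = fourierOp a - fourierOp b := by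
  ext1 u
  simp [fourierOp_apply, mulOp_sub]

theorem fourierOp_smul (c : ℂ) (a : BoundedContinuousFunction (E n) ℂ) :
    fourierOp (c • a) = c • fourierOp a := by
  ext1 u
  simp [fourierOp_apply, mulOp_smul]

theorem tendsto_fourierOp {ι : Type*} {l : Filter ι} [l.IsCountablyGenerated]
    {a : ι → BoundedContinuousFunction (E n) ℂ} {b : BoundedContinuousFunction (E n) ℂ} {C : ℝ}
    (hC : ∀ᶠ i in l, ‖a i‖ ≤ C) (h : ∀ x, Tendsto (fun i => a i x) l (𝓝 (b x))) (u : L2 n) :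
    Tendsto (fun i => fourierOp (a i) u) l (𝓝 (fourierOp b u)) :=
  ((Lp.fourierTransformₗᵢ (E n) ℂ).symm.continuous.tendsto _).comp (tendsto_mulOp hC h _)

theorem fourierOp_toLp {a : BoundedContinuousFunction (E n) ℂ} (ha : Function.HasTemperateGrowth a)
    (u : 𝓢(E n, ℂ)) : fourierOp a (u.toLp 2 volume) =
      (SchwartzMap.fourierMultiplierCLM ℂ (a : E n → ℂ) u).toLp 2 volume := by
  have h1 : Lp.fourierTransformₗᵢ (E n) ℂ (u.toLp 2 volume) =
      (FourierTransform.fourier u).toLp 2 volume := SchwartzMap.toLp_fourier_eq u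
  have h2 : mulOp a ((FourierTransform.fourier u).toLp 2 volume) =
      (SchwartzMap.smulLeftCLM ℂ (a : E n → ℂ) (FourierTransform.fourier u)).toLp 2 volume := by
    refine Lp.ext ?_
    filter_upwards [coeFn_mulOp a ((FourierTransform.fourier u).toLp 2 volume),
      SchwartzMap.coeFn_toLp (FourierTransform.fourier u) 2 volume,
      SchwartzMap.coeFn_toLp (SchwartzMap.smulLeftCLM ℂ (a : E n → ℂ)
        (FourierTransform.fourier u)) 2 volume] with x h1 h2 h3
    rw [h1, h2, h3, SchwartzMap.smulLeftCLM_apply_apply ha, smul_eq_mul]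
  rw [fourierOp_apply, h1, h2, SchwartzMap.fourierMultiplierCLM_apply]
  exact SchwartzMap.toLp_fourierInv_eq _

theorem fourierHat_two_pi_smul (u : 𝓢(E n, ℂ)) (η : E n) :
    fourierHat u ((2 * Real.pi) • η) =
      (((2 * Real.pi) ^ (-(n : ℝ) / 2) : ℝ) : ℂ) * FourierTransform.fourier u η := by
  rw [fourierHat, SchwartzMap.fourier_coe, Real.fourier_eq]
  congr 1
  refine integral_congr_ae (Eventually.of_forall fun x => ?_)
  simp only [Circle.smul_def, Real.fourierChar_apply, smul_eq_mul]
  congr 2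
  rw [inner_smul_right]
  push_cast
  ring

/-- The substitution ξ = 2πη reconciles the two Fourier normalizations; its Jacobian (2π)^n cancels
the two factors (2π)^{-n/2}. -/
theorem opOfSymbol_eq_fourierMultiplierCLM {σ : E n → ℂ} (hσ : Function.HasTemperateGrowth σ)
    (u : 𝓢(E n, ℂ)) (x : E n) : opOfSymbol (fun _ ξ => σ ξ) u x =
      SchwartzMap.fourierMultiplierCLM ℂ (fun η => σ ((2 * Real.pi) • η)) u x := by
  have hσ' : Function.HasTemperateGrowth fun η : E n => σ ((2 * Real.pi) • η) := by
    refine hσ.comp ?_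
    fun_prop
  have hpi : (0 : ℝ) < 2 * Real.pi := by positivity
  have h := Measure.integral_comp_smul volume (fun ξ : E n =>
    Complex.exp (Complex.I * (inner ℝ x ξ : ℝ)) * σ ξ * fourierHat u ξ) (2 * Real.pi)
  rw [finrank_euclideanSpace_fin, abs_of_pos (by positivity)] at h
  have h' : ∫ ξ : E n, Complex.exp (Complex.I * (inner ℝ x ξ : ℝ)) * σ ξ * fourierHat u ξ =
      ((2 * Real.pi) ^ n : ℝ) • ∫ η : E n, Complex.exp (Complex.I * (inner ℝ x ((2 * Real.pi) • η) : ℝ))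
        * σ ((2 * Real.pi) • η) * fourierHat u ((2 * Real.pi) • η) := by
    rw [h, smul_smul, mul_inv_cancel₀ (by positivity), one_smul]
  rw [opOfSymbol, h', SchwartzMap.fourierMultiplierCLM_apply, SchwartzMap.fourierInv_coe,
    Real.fourierInv_eq]
  simp only [fourierHat_two_pi_smul, SchwartzMap.smulLeftCLM_apply_apply hσ']
  rw [Complex.real_smul, ← integral_const_mul, ← integral_const_mul]
  refine integral_congr_ae (Eventually.of_forall fun η => ?_)
  have hc : (((2 * Real.pi) ^ (-(n : ℝ) / 2) : ℝ) : ℂ) * (((2 * Real.pi) ^ n : ℝ) : ℂ) *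
      (((2 * Real.pi) ^ (-(n : ℝ) / 2) : ℝ) : ℂ) = 1 := by
    rw [← Complex.ofReal_mul, ← Complex.ofReal_mul, ← Real.rpow_natCast,
      ← Real.rpow_add hpi, ← Real.rpow_add hpi]
    ring_nf
    simp
  have he : Complex.exp (Complex.I * (inner ℝ x ((2 * Real.pi) • η) : ℝ)) =
      ((Real.fourierChar (inner ℝ η x)) : ℂ) := by
    rw [Real.fourierChar_apply, inner_smul_right, real_inner_comm]
    push_cast
    ring_nf
  simp only [Circle.smul_def, smul_eq_mul, he]
  linear_combination (Real.fourierChar (inner ℝ η x) : ℂ) * σ ((2 * Real.pi) • η) *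
    FourierTransform.fourier u η * hc

end

section

variable {n : ℕ}

/-! ### The semigroup of a positive Fourier multiplier -/

/-- A continuous real function on `ℝⁿ` with a positive lower bound. -/
structure IsPositiveMultiplier (s : E n → ℝ) (c : ℝ) : Prop where
  continuous : Continuous s
  pos : 0 < c
  le : ∀ η, c ≤ s η

namespace IsPositiveMultiplier

variable {s : E n → ℝ} {c : ℝ}

theorem apply_pos (hs : IsPositiveMultiplier s c) (η : E n) : 0 < s η := hs.pos.trans_le (hs.le η)

/-- The multiplier `e^{-ts}`. -/
def expMultiplier (hs : IsPositiveMultiplier s c) (t : ℝ≥0) : BoundedContinuousFunction (E n) ℂ :=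
  BoundedContinuousFunction.ofNormedAddCommGroup (fun η => ((Real.exp (-t * s η) : ℝ) : ℂ))
    (by have := hs.continuous; fun_prop) 1 fun η => by
      rw [Complex.norm_real, Real.norm_eq_abs, Real.abs_exp, Real.exp_le_one_iff]
      exact mul_nonpos_of_nonpos_of_nonneg (neg_nonpos.2 t.2) (hs.apply_pos η).le

/-- The multiplier `1/s`. -/
def invMultiplier (hs : IsPositiveMultiplier s c) : BoundedContinuousFunction (E n) ℂ :=
  BoundedContinuousFunction.ofNormedAddCommGroup (fun η => (((s η)⁻¹ : ℝ) : ℂ))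
    (Complex.continuous_ofReal.comp (hs.continuous.inv₀ fun η => (hs.apply_pos η).ne')) c⁻¹
    fun η => by
      rw [Complex.norm_real, Real.norm_eq_abs, abs_of_pos (inv_pos.2 (hs.apply_pos η))]
      exact inv_anti₀ hs.pos (hs.le η)

theorem expMultiplier_apply (hs : IsPositiveMultiplier s c) (t : ℝ≥0) (η : E n) :
    hs.expMultiplier t η = ((Real.exp (-t * s η) : ℝ) : ℂ) := rfl

theorem invMultiplier_apply (hs : IsPositiveMultiplier s c) (η : E n) :
    hs.invMultiplier η = (((s η)⁻¹ : ℝ) : ℂ) := rfl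

theorem norm_expMultiplier_le (hs : IsPositiveMultiplier s c) (t : ℝ≥0) :
    ‖hs.expMultiplier t‖ ≤ 1 :=
  BoundedContinuousFunction.norm_ofNormedAddCommGroup_le _ zero_le_one _

/-- The operator `e^{-tB}`, where `B` is the Fourier multiplier with symbol `s`. -/
def semigroup (hs : IsPositiveMultiplier s c) (t : ℝ≥0) : L2 n →L[ℂ] L2 n :=
  fourierOp (hs.expMultiplier t)

/-- The inverse of the Fourier multiplier with symbol `s`. -/
def inverse (hs : IsPositiveMultiplier s c) : L2 n →L[ℂ] L2 n := fourierOp hs.invMultiplier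

theorem norm_semigroup_le (hs : IsPositiveMultiplier s c) (t : ℝ≥0) : ‖hs.semigroup t‖ ≤ 1 :=
  (norm_fourierOp_le _).trans (hs.norm_expMultiplier_le t)

theorem tendsto_coe_nhdsGT_zero : Tendsto ((↑) : ℝ≥0 → ℝ) (𝓝[>] 0) (𝓝[>] 0) := by
  refine tendsto_nhdsWithin_iff.2 ⟨?_, ?_⟩
  · exact (NNReal.continuous_coe.tendsto 0).mono_left nhdsWithin_le_nhds
  · filter_upwards [self_mem_nhdsWithin] with t ht using NNReal.coe_pos.2 ht

theorem isC0Semigroup (hs : IsPositiveMultiplier s c) : IsC0Semigroup hs.semigroup := by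
  refine ⟨?_, fun t t' => ?_, fun u => ?_⟩
  · rw [semigroup, ← fourierOp_one]
    congr 1
    ext η
    simp [expMultiplier_apply]
  · rw [semigroup, semigroup, semigroup, ← fourierOp_mul]
    congr 1
    ext η
    rw [BoundedContinuousFunction.mul_apply]
    simp only [expMultiplier_apply]
    rw [← Complex.ofReal_mul, ← Real.exp_add]
    push_cast
    ring_nf
  · have h := tendsto_fourierOp (l := 𝓝[>] (0 : ℝ≥0)) (a := hs.expMultiplier) (b := 1) (C := 1)
      (Eventually.of_forall hs.norm_expMultiplier_le) (fun η => ?_) u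
    · rwa [fourierOp_one] at h
    · have h1 : Continuous fun t : ℝ≥0 => ((Real.exp (-t * s η) : ℝ) : ℂ) := by fun_prop
      simpa [expMultiplier_apply] using (h1.tendsto 0).mono_left nhdsWithin_le_nhds

/-- The multiplier `(1 - e^{-ts}) / (ts)`. -/
def quotientMultiplier (hs : IsPositiveMultiplier s c) (t : ℝ≥0) :
    BoundedContinuousFunction (E n) ℂ :=
  ((t : ℝ) : ℂ)⁻¹ • ((1 - hs.expMultiplier t) * hs.invMultiplier)

theorem quotientMultiplier_apply (hs : IsPositiveMultiplier s c) (t : ℝ≥0) (η : E n) :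
    hs.quotientMultiplier t η =
      (((t : ℝ)⁻¹ * ((1 - Real.exp (-t * s η)) * (s η)⁻¹) : ℝ) : ℂ) := by
  simp [quotientMultiplier, expMultiplier_apply, invMultiplier_apply]

theorem norm_quotientMultiplier_le (hs : IsPositiveMultiplier s c) {t : ℝ≥0} (ht : 0 < t) :
    ‖hs.quotientMultiplier t‖ ≤ 1 := by
  refine (BoundedContinuousFunction.norm_le zero_le_one).2 fun η => ?_
  have ht' : (0 : ℝ) < t := ht
  have hη := hs.apply_pos η
  have h1 : Real.exp (-t * s η) ≤ 1 := Real.exp_le_one_iff.2 (by nlinarith)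
  have h2 := Real.add_one_le_exp (-t * s η)
  rw [quotientMultiplier_apply, Complex.norm_real, Real.norm_eq_abs, abs_of_nonneg]
  · rw [← mul_assoc, mul_comm ((t : ℝ)⁻¹), mul_assoc, ← mul_inv, ← div_eq_mul_inv,
      div_le_one (by positivity)]
    linarith
  · have : 0 ≤ 1 - Real.exp (-t * s η) := by linarith
    positivity

theorem tendsto_quotientMultiplier (hs : IsPositiveMultiplier s c) (η : E n) :
    Tendsto (fun t => hs.quotientMultiplier t η) (𝓝[>] 0) (𝓝 1) := by
  have h1 : HasDerivAt (fun t : ℝ => Real.exp (-t * s η)) (-s η) 0 := by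
    have := ((hasDerivAt_id (0 : ℝ)).neg.mul_const (s η)).exp
    simpa using this
  have h2 := (h1.tendsto_slope_zero_right.comp tendsto_coe_nhdsGT_zero).mul_const (-(s η)⁻¹)
  have h3 : -s η * -(s η)⁻¹ = 1 := by
    rw [neg_mul_neg, mul_inv_cancel₀ (hs.apply_pos η).ne']
  rw [h3] at h2
  have h4 := (Complex.continuous_ofReal.tendsto 1).comp h2
  rw [Complex.ofReal_one] at h4
  refine h4.congr fun t => ?_
  rw [quotientMultiplier_apply]
  simp only [Function.comp, zero_add, smul_eq_mul, neg_zero, zero_mul, Real.exp_zero]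
  congr 1
  ring

theorem tendsto_fourierOp_quotientMultiplier (hs : IsPositiveMultiplier s c) (u : L2 n) :
    Tendsto (fun t => fourierOp (hs.quotientMultiplier t) u) (𝓝[>] 0) (𝓝 u) := by
  have h := tendsto_fourierOp (l := 𝓝[>] (0 : ℝ≥0)) (a := hs.quotientMultiplier) (b := 1) (C := 1)
    (by filter_upwards [self_mem_nhdsWithin] with t ht using hs.norm_quotientMultiplier_le ht)
    hs.tendsto_quotientMultiplier u
  rwa [fourierOp_one] at h

theorem fourierOp_quotientMultiplier (hs : IsPositiveMultiplier s c) (t : ℝ≥0) (u : L2 n) :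
    fourierOp (hs.quotientMultiplier t) u =
      ((t : ℝ) : ℂ)⁻¹ • (hs.inverse u - hs.semigroup t (hs.inverse u)) := by
  rw [quotientMultiplier, fourierOp_smul, fourierOp_mul, fourierOp_sub, fourierOp_one]
  rfl

theorem fourierOp_quotientMultiplier' (hs : IsPositiveMultiplier s c) (t : ℝ≥0) (u : L2 n) :
    fourierOp (hs.quotientMultiplier t) u =
      hs.inverse (((t : ℝ) : ℂ)⁻¹ • (u - hs.semigroup t u)) := by
  rw [quotientMultiplier, mul_comm, fourierOp_smul, fourierOp_mul, fourierOp_sub, fourierOp_one,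
    map_smul]
  rfl

/-- The multiplier (1 - e^{-ts})/(ts) is bounded by 1 and tends to 1, so its operator tends strongly
to the identity. Reading it as a difference quotient at `inverse` w, or as `inverse` applied to a
difference quotient, gives the two inclusions. Using 1/s avoids describing the domain of the
unbounded multiplier. -/
theorem generatorGraph_semigroup (hs : IsPositiveMultiplier s c) :
    generatorGraph hs.semigroup = {w | w.1 = -hs.inverse w.2} := by
  ext ⟨u, w⟩
  simp only [generatorGraph, mem_ofPred_eq]
  constructor
  · intro h
    have h1 := ((hs.inverse.continuous.tendsto w).comp h).neg
    have h2 := hs.tendsto_fourierOp_quotientMultiplier u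
    refine tendsto_nhds_unique (h2.congr fun t => ?_) h1
    rw [fourierOp_quotientMultiplier', Function.comp_apply, ← map_neg, ← smul_neg, neg_sub]
  · rintro rfl
    refine (hs.tendsto_fourierOp_quotientMultiplier w).congr fun t => ?_
    rw [fourierOp_quotientMultiplier, map_neg, neg_sub_neg]

theorem inverse_toLp (hs : IsPositiveMultiplier s c)
    (hg' : Function.HasTemperateGrowth fun η => (((s η)⁻¹ : ℝ) : ℂ)) (u : 𝓢(E n, ℂ)) :
    hs.inverse (u.toLp 2 volume) =
      (SchwartzMap.fourierMultiplierCLM ℂ (fun η => (((s η)⁻¹ : ℝ) : ℂ)) u).toLp 2 volume :=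
  fourierOp_toLp (a := hs.invMultiplier) hg' u

/-- The candidate set is closed, being the graph of a bounded operator with coordinates swapped.
Since 1/s preserves Schwartz functions, the pairs with Schwartz second entry all belong to the
Schwartz graph, and they are dense in it by density of Schwartz functions in L². -/
theorem closure_schwartzGraph (hs : IsPositiveMultiplier s c)
    (hg : Function.HasTemperateGrowth fun η => ((s η : ℝ) : ℂ))
    (hg' : Function.HasTemperateGrowth fun η => (((s η)⁻¹ : ℝ) : ℂ)) {B : 𝓢(E n, ℂ) → E n → ℂ}
    (hB : ∀ u x, B u x = SchwartzMap.fourierMultiplierCLM ℂ (fun η => ((s η : ℝ) : ℂ)) u x) :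
    closure (schwartzGraph fun u x => -B u x) = {w | w.1 = -hs.inverse w.2} := by
  have e1 : (fun η => ((s η : ℝ) : ℂ)) * (fun η => (((s η)⁻¹ : ℝ) : ℂ)) = fun _ => 1 := by
    ext η
    rw [Pi.mul_apply, ← Complex.ofReal_mul, mul_inv_cancel₀ (hs.apply_pos η).ne',
      Complex.ofReal_one]
  have toLp_neg : ∀ v : 𝓢(E n, ℂ), (-v).toLp 2 volume = -(v.toLp 2 volume) :=
    fun v => map_neg (SchwartzMap.toLpCLM ℂ ℂ 2 volume) v
  refine Subset.antisymm (closure_minimal ?_ ?_) ?_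
  · rintro ⟨u', w⟩ ⟨u, hu, hw⟩
    have hw' : w = (-(SchwartzMap.fourierMultiplierCLM ℂ
        (fun η => ((s η : ℝ) : ℂ)) u)).toLp 2 volume := by
      refine Lp.ext (hw.trans ?_)
      filter_upwards [SchwartzMap.coeFn_toLp (-(SchwartzMap.fourierMultiplierCLM ℂ
        (fun η => ((s η : ℝ) : ℂ)) u)) 2 volume] with x hx
      rw [hx, hB]
      rfl
    simp only [mem_ofPred_eq] at hu ⊢
    rw [hw', toLp_neg, map_neg, neg_neg, inverse_toLp hs hg',
      SchwartzMap.fourierMultiplierCLM_fourierMultiplierCLM_apply hg' hg, mul_comm, e1,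
      SchwartzMap.fourierMultiplierCLM_const, hu]
    simp
  · exact isClosed_eq continuous_fst (hs.inverse.continuous.comp continuous_snd).neg
  · rintro ⟨u', w⟩ h
    simp only [mem_ofPred_eq] at h
    subst h
    have hcont : Continuous fun v : L2 n => (-hs.inverse v, v) :=
      hs.inverse.continuous.neg.prodMk continuous_id
    have hd : w ∈ closure (range (SchwartzMap.toLpCLM ℝ ℂ 2 (volume : Measure (E n)))) :=
      SchwartzMap.denseRange_toLpCLM ENNReal.ofNat_ne_top w
    refine closure_mono ?_ (image_closure_subset_closure_image hcont ⟨w, hd, rfl⟩)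
    rintro _ ⟨_, ⟨v, rfl⟩, rfl⟩
    refine ⟨-(SchwartzMap.fourierMultiplierCLM ℂ (fun η => (((s η)⁻¹ : ℝ) : ℂ)) v), ?_, ?_⟩
    · rw [toLp_neg, ← inverse_toLp hs hg']
      rfl
    · refine (SchwartzMap.coeFn_toLp v 2 volume).trans (Eventually.of_forall fun x => ?_)
      simp only [hB, map_neg]
      rw [SchwartzMap.fourierMultiplierCLM_fourierMultiplierCLM_apply hg hg', e1,
        SchwartzMap.fourierMultiplierCLM_const]
      simp

theorem isHeatSemigroup (hs : IsPositiveMultiplier s c)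
    (hg : Function.HasTemperateGrowth fun η => ((s η : ℝ) : ℂ))
    (hg' : Function.HasTemperateGrowth fun η => (((s η)⁻¹ : ℝ) : ℂ)) {B : 𝓢(E n, ℂ) → E n → ℂ}
    (hB : ∀ u x, B u x = SchwartzMap.fourierMultiplierCLM ℂ (fun η => ((s η : ℝ) : ℂ)) u x) :
    IsHeatSemigroup B hs.semigroup :=
  ⟨hs.isC0Semigroup, hs.generatorGraph_semigroup.trans (hs.closure_schwartzGraph hg hg' hB).symm⟩

theorem eq_semigroup (hs : IsPositiveMultiplier s c)
    (hg : Function.HasTemperateGrowth fun η => ((s η : ℝ) : ℂ))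
    (hg' : Function.HasTemperateGrowth fun η => (((s η)⁻¹ : ℝ) : ℂ)) {B : 𝓢(E n, ℂ) → E n → ℂ}
    (hB : ∀ u x, B u x = SchwartzMap.fourierMultiplierCLM ℂ (fun η => ((s η : ℝ) : ℂ)) u x)
    {T : ℝ≥0 → L2 n →L[ℂ] L2 n} (hT : IsHeatSemigroup B T) (t : ℝ≥0) : T t = hs.semigroup t := by
  have h := hs.isHeatSemigroup hg hg' hB
  refine hT.1.eq_of_generatorGraph_eq hs.isC0Semigroup hs.norm_semigroup_le
    (hT.2.trans h.2.symm) ?_ t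
  have hd : DenseRange (SchwartzMap.toLpCLM ℝ ℂ 2 (volume : Measure (E n))) :=
    SchwartzMap.denseRange_toLpCLM ENNReal.ofNat_ne_top
  refine Dense.mono ?_ hd
  rintro _ ⟨u, rfl⟩
  rw [h.2]
  refine ⟨(u.toLp 2 volume, (-(SchwartzMap.fourierMultiplierCLM ℂ
    (fun η => ((s η : ℝ) : ℂ)) u)).toLp 2 volume), subset_closure ⟨u, rfl, ?_⟩, rfl⟩
  filter_upwards [SchwartzMap.coeFn_toLp (-(SchwartzMap.fourierMultiplierCLM ℂ
    (fun η => ((s η : ℝ) : ℂ)) u)) 2 volume] with x hx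
  rw [hx, hB]
  rfl

end IsPositiveMultiplier

end

section

variable {n : ℕ}

/-! ### The heat semigroup of a subordinate Brownian motion -/

/-- Induction through (1/φ)' = -(1/φ)² φ', whose order is -2s + (s - 1) = -s - 1. It makes 1/σ act
on Schwartz functions. -/
theorem RadialBound.inv {ι : Type} {U : Set ℝ} {k : ℕ} {s c : ℝ} {φ : ι → ℝ → ℝ} (hU : IsOpen U)
    (hU' : U ⊆ Ioi (-1 / 2)) (hc : 0 < c) (hφ : ∀ i, ∀ x ∈ U, c * (1 + x) ^ s ≤ φ i x)
    (h : RadialBound U k s φ) : RadialBound U k (-s) (fun i x => (φ i x)⁻¹) := by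
  have hx1 : ∀ x ∈ U, 0 < 1 + x := fun x hx => by
    have : -1 / 2 < x := hU' hx
    linarith
  have hpos : ∀ i, ∀ x ∈ U, 0 < φ i x := fun i x hx =>
    (mul_pos hc (Real.rpow_pos_of_pos (hx1 x hx) s)).trans_le (hφ i x hx)
  have hb : ∃ C : ℝ, ∀ i, ∀ x ∈ U, |(φ i x)⁻¹| ≤ C * (1 + x) ^ (-s) := by
    refine ⟨c⁻¹, fun i x hx => ?_⟩
    rw [abs_of_pos (inv_pos.2 (hpos i x hx)), Real.rpow_neg (hx1 x hx).le, ← mul_inv]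
    exact inv_anti₀ (mul_pos hc (Real.rpow_pos_of_pos (hx1 x hx) s)) (hφ i x hx)
  induction k with
  | zero => exact hb
  | succ k ih =>
    have hi := ih h.of_succ
    refine ⟨hb, fun i x hx => (h.2.1 i x hx).fun_inv (hpos i x hx).ne', ?_⟩
    have h1 := ((hi.mul hU hU' hi).mul hU hU' h.2.2).neg hU hU'
    rw [show -s + -s + (s - 1) = -s - 1 by ring] at h1
    refine h1.congr hU fun i x hx => ?_
    rw [deriv_fun_inv'' (h.2.1 i x hx) (hpos i x hx).ne']
    field_simp

theorem fourierMultiplierCLM_add_const {g : E n → ℂ} (hg : Function.HasTemperateGrowth g) (c : ℂ)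
    (u : 𝓢(E n, ℂ)) (x : E n) : SchwartzMap.fourierMultiplierCLM ℂ (fun η => g η + c) u x =
      SchwartzMap.fourierMultiplierCLM ℂ g u x + c * u x := by
  have h1 : c * u x = SchwartzMap.fourierMultiplierCLM ℂ (fun _ : E n => c) u x := by
    rw [SchwartzMap.fourierMultiplierCLM_const]
    rfl
  have h2 : SchwartzMap.smulLeftCLM ℂ (fun η => g η + c) =
      SchwartzMap.smulLeftCLM ℂ g + SchwartzMap.smulLeftCLM ℂ (fun _ : E n => c) :=
    SchwartzMap.smulLeftCLM_add hg (.const c)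
  rw [h1, SchwartzMap.fourierMultiplierCLM_apply, h2, add_apply, FourierTransform.fourierInv_add]
  rfl

namespace LevyHypothesis

variable {m : ℝ → ℝ} {α : ℝ} {p : ℕ → ℝ}

theorem hasTemperateGrowth_tildeSymbol (hm : LevyHypothesis m α p) :
    Function.HasTemperateGrowth (tildeSymbol m α p : E n → ℂ) :=
  (hm.isMultiplierFamily_tildeSymbol (ι := Unit)).hasTemperateGrowth ()

theorem hasTemperateGrowth_inv (hm : LevyHypothesis m α p) :
    Function.HasTemperateGrowth fun ξ : E n => (((levySymbol m α p (‖ξ‖ ^ 2))⁻¹ : ℝ) : ℂ) := by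
  obtain ⟨ε, c, hε, hε', hc, h⟩ := hm.exists_le_levySymbol
  have hU' : Ioi (-ε) ⊆ Ioi (-1 / 2) := Ioi_subset_Ioi (by linarith)
  exact (RadialBound.isMultiplierFamily (ι := Unit) hε hε' fun k =>
    RadialBound.inv (φ := fun _ => levySymbol m α p) isOpen_Ioi hU' hc (fun _ => h)
      ((hm.radialBound_levySymbol k).mono_set hU')).hasTemperateGrowth ()

theorem opATilde_eq (hm : LevyHypothesis m α p) (u : 𝓢(E n, ℂ)) (x : E n) :
    opATilde m α p u x = opOfSymbol (fun _ ξ => tildeSymbol m α p ξ) u x := by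
  have hA := hm.hasTemperateGrowth_tildeSymbol (n := n)
  have hpi : Function.HasTemperateGrowth fun η : E n => (2 * Real.pi) • η := by fun_prop
  have e : (fun ξ : E n => ((bernstein m (‖ξ‖ ^ 2) : ℝ) : ℂ)) =
      fun ξ => tildeSymbol m α p ξ + ((mBar m (p 0) α : ℝ) : ℂ) := by
    ext ξ
    rw [tildeSymbol, levySymbol_of_nonneg m α p (by positivity)]
    push_cast
    ring
  have e' := congrFun (congrFun (congrArg (fun σ : E n → ℂ => opOfSymbol fun _ => σ) e) u) x
  rw [opATilde, opA, sub_eq_iff_eq_add]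
  refine e'.trans ?_
  rw [opOfSymbol_eq_fourierMultiplierCLM hA]
  exact (opOfSymbol_eq_fourierMultiplierCLM (hA.add (.const _)) u x).trans
    (fourierMultiplierCLM_add_const (hA.comp hpi) _ u x)

theorem isPseudoDiff (hm : LevyHypothesis m α p) :
    IsPseudoDiff (opATilde m α p) (tildeSymbol m α p : E n → ℂ) := fun u =>
  ⟨SchwartzMap.fourierMultiplierCLM ℂ (fun η => tildeSymbol m α p ((2 * Real.pi) • η)) u,
    fun x => by
      rw [hm.opATilde_eq, opOfSymbol_eq_fourierMultiplierCLM hm.hasTemperateGrowth_tildeSymbol],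
    fun x => (opOfSymbol_eq_fourierMultiplierCLM hm.hasTemperateGrowth_tildeSymbol u x).symm⟩

theorem exists_isPositiveMultiplier (hm : LevyHypothesis m α p) : ∃ c, IsPositiveMultiplier
    (fun η : E n => levySymbol m α p (‖(2 * Real.pi) • η‖ ^ 2)) c := by
  obtain ⟨ε, c, hε, -, hc, h⟩ := hm.exists_le_levySymbol
  refine ⟨c, ?_, hc, fun η => ?_⟩
  · have := hm.contDiff_levySymbol.continuous
    fun_prop
  · have h0 : 0 ≤ ‖(2 * Real.pi) • η‖ ^ 2 := by positivity
    refine le_trans ?_ (h _ (mem_Ioi.2 (by linarith)))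
    exact le_mul_of_one_le_right hc.le (Real.one_le_rpow (by linarith) hm.alpha_pos.le)

theorem isPseudoDiffL2_semigroup (hm : LevyHypothesis m α p) {c : ℝ}
    (hs : IsPositiveMultiplier (fun η : E n => levySymbol m α p (‖(2 * Real.pi) • η‖ ^ 2)) c)
    {t : ℝ≥0} (ht : 0 < t) : IsPseudoDiffL2 (hs.semigroup t) (heatSymbol m α p t) := fun u => by
  have hg : Function.HasTemperateGrowth (heatSymbol m α p t : E n → ℂ) :=
    (hm.isMultiplierFamily_heatSymbol (ι := Unit) (NNReal.coe_pos.2 ht) 0).hasTemperateGrowth ()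
  have hpi : Function.HasTemperateGrowth fun η : E n => (2 * Real.pi) • η := by fun_prop
  exact ⟨_, fourierOp_toLp (a := hs.expMultiplier t) (hg.comp hpi) u,
    fun x => (opOfSymbol_eq_fourierMultiplierCLM hg u x).symm⟩

end LevyHypothesis

end

end SubordinateHeat

end

theorem mainTheorem3 (n : ℕ) (m : ℝ → ℝ) (α : ℝ) (p : ℕ → ℝ) (hm : LevyHypothesis m α p) :
    -- (i) the shifted operator
    (∃ σ : E n → ℂ,
      IsPseudoDiff (opATilde m α p) σ ∧
      IsClassicalSymbol (2 * α) σ ∧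
      IsElliptic (2 * α) σ ∧
      HasExpansion (2 * α) σ (symbolTerm α p)) ∧
    -- (ii) the heat operator exists
    (∃ T : ℝ≥0 → L2 n →L[ℂ] L2 n, IsHeatSemigroup (opATilde m α p) T) ∧
    -- and is a pseudodifferential operator with the stated symbol expansion
    (∀ T : ℝ≥0 → L2 n →L[ℂ] L2 n, IsHeatSemigroup (opATilde m α p) T →
      ∃ h : ℝ → E n → ℂ,
        (∀ t : ℝ≥0, 0 < t →
          IsPseudoDiffL2 (T t) (h t) ∧
          IsSmoothingSymbol 0 (fun _ ξ => h t ξ) ∧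
          IsClassicalSmoothingSymbol (h t) ∧
          HasSmoothingExpansion (h t) (fun j => heatTerm α p j t)) ∧
        HasUniformExpansion h (heatTerm α p)) ∧
    -- the terms are quasi-homogeneous, and those of lowest order are explicit
    (∀ (j : ℕ) (τ t : ℝ) (ξ : E n), 0 < τ → 0 < t → ξ ≠ 0 →
      heatTerm α p j (τ ^ (-(2 * α)) * t) (τ • ξ) = ((τ ^ (-(j : ℝ)) : ℝ) : ℂ) * heatTerm α p j t ξ) ∧
    (∀ (t : ℝ) (ξ : E n), 0 < t → ξ ≠ 0 →
      heatTerm α p 0 t ξ = ((Real.exp (-t * coeffAlpha α p 0 * ‖ξ‖ ^ (2 * α)) : ℝ) : ℂ) ∧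
      heatTerm α p 2 t ξ = ((-(coeffAlpha α p 1 * ‖ξ‖ ^ (2 * α - 2)) * t *
        Real.exp (-t * coeffAlpha α p 0 * ‖ξ‖ ^ (2 * α)) : ℝ) : ℂ) ∧
      heatTerm α p 4 t ξ = (((-(coeffAlpha α p 2 * ‖ξ‖ ^ (2 * α - 4)) * t
        + 1 / 2 * coeffAlpha α p 1 ^ 2 * ‖ξ‖ ^ (4 * α - 4) * t ^ 2) *
        Real.exp (-t * coeffAlpha α p 0 * ‖ξ‖ ^ (2 * α)) : ℝ) : ℂ) ∧
      heatTerm α p 1 t ξ = 0 ∧ heatTerm α p 3 t ξ = 0) := by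
  obtain ⟨c, hs⟩ := hm.exists_isPositiveMultiplier (n := n)
  have hpi : Function.HasTemperateGrowth fun η : E n => (2 * Real.pi) • η := by fun_prop
  have hg := (hm.hasTemperateGrowth_tildeSymbol (n := n)).comp hpi
  have hg' := (hm.hasTemperateGrowth_inv (n := n)).comp hpi
  have hB : ∀ (u : 𝓢(E n, ℂ)) (x : E n), opATilde m α p u x = SchwartzMap.fourierMultiplierCLM ℂ
      (fun η => ((levySymbol m α p (‖(2 * Real.pi) • η‖ ^ 2) : ℝ) : ℂ)) u x := fun u x =>
    (hm.opATilde_eq u x).trans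
      (opOfSymbol_eq_fourierMultiplierCLM hm.hasTemperateGrowth_tildeSymbol u x)
  refine ⟨⟨tildeSymbol m α p, hm.isPseudoDiff, hm.isClassicalSymbol, hm.isElliptic,
    hm.hasExpansion⟩, ⟨hs.semigroup, hs.isHeatSemigroup hg hg' hB⟩,
    fun T hT => ⟨heatSymbol m α p, fun t ht => ⟨?_, hm.isSmoothingSymbol ht,
      hm.isClassicalSmoothingSymbol ht, hm.hasSmoothingExpansion ht⟩, hm.hasUniformExpansion⟩,
    fun j τ t ξ hτ _ _ => heatTerm_quasihomogeneous j t ξ hτ,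
    fun t ξ _ hξ => ⟨heatTerm_zero t ξ, heatTerm_two t ξ, heatTerm_four t hξ,
      heatTerm_odd (by decide) t ξ, heatTerm_odd (by decide) t ξ⟩⟩
  -- The semigroup given here is arbitrary; uniqueness identifies it with the Fourier multiplier
  -- e^{-tσ}.
  rw [hs.eq_semigroup hg hg' hB hT t]
  exact hm.isPseudoDiffL2_semigroup hs ht
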